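/- Let $a<0<b$ and let $\lambda:\mathbb R\to[0,\infty)$ be continuously differentiable with $\lambda(y)=0$ for $y\in[-1,1]$, $\lambda(y)>0$ for $y\notin[-1,1]$, and $$\int_{-1-\varepsilon}^{-1}\frac{dy}{\lambda(y)}=\int_{1}^{1+\varepsilon}\frac{dy}{\lambda(y)}=\infty\qquad\text{for all }\varepsilon>0 .$$ Put $S^1=\mathbb R/2\pi\mathbb Z$ and let $\mathfrak C$ be the cylinder $S^1\times[a,b]$ with all points of $S^1\times\{0\}$ identified to a single point $\mathfrak o$, with the quotient topology; let $C(\mathfrak C)$ be the space of real continuous functions on $\mathfrak C$ with the supremum norm. Put $u(y)=\int_0^y\lambda(s)\,ds$, $v(y)=2u(y)$, and, for $h\in\{u,v,\lambda\}$, let $\tilde h(y)=h(y-1)$ for $y<0$, $\tilde h(y)=h(y+1)$ for $y>0$, and $\tilde h(0)=0$. For a strictly increasing continuous function $w$ write $D_w g(y)=\lim_{z\to y}\frac{g(z)-g(y)}{w(z)-w(y)}$. For $\theta\in S^1$ and $y\in(a,0)\cup(0,b)$ put $$Af(\theta,y)=D_{\tilde u}D_{\tilde v}f(\theta,y)+\frac1{\tilde\lambda(y)^2}\,\frac{\partial^2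 f}{\partial\theta^2}(\theta,y),$$ where $D_{\tilde u},D_{\tilde v}$ act in the variable $y$. Let $D(A)$ be the set of all $f\in C(\mathfrak C)$ such that the derivatives in $Af$ exist and they and $Af$ are continuous on $S^1\times((a,0)\cup(0,b))$, and 1. for every $\theta\in S^1$ the finite limits $L_\pm(\theta)=\lim_{\theta'\to\theta,\ y\to0\pm}D_{\tilde u}f(\theta',y)$ exist; 2. for every $\theta\in S^1$ the finite limit $\lim_{\theta'\to\theta,\ y\to0}Af(\theta',y)$ exists, and it does not depend on $\theta$; 3. $\lim_{\theta'\to\theta,\ y\to a}Af(\theta',y)=\lim_{\theta'\to\theta,\ y\to b}Af(\theta',y)=0$ for every $\theta\in S^1$; 4. $\int_0^{2\pi}L_-(\theta)\,d\theta=\int_0^{2\pi}L_+(\theta)\,d\theta$. For $f\in D(A)$ define $Af(\mathfrak o)$ as the limit in 2 and $Af(\theta,a)=Af(\theta,b)=0$; thus $A:D(A)\to C(\mathfrak C)$ is a linear operator. **Lemma.** The operator $A$ with domain $D(A)$ is closable, and its closure $\overline A$ is the infinitesimal operator of a Markov semigroup on $C(\mathfrak C)$: there are bounded linear operators $T_t$,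 $t\ge0$, on $C(\mathfrak C)$ with $T_0=I$, $T_{s+t}=T_sT_t$, $T_tf\to f$ in norm as $t\downarrow0$ for every $f$, $T_tf\ge0$ whenever $f\ge0$, and $T_t1=1$, such that $f\in D(\overline A)$ and $\overline Af=g$ if and only if $(T_tf-f)/t\to g$ in norm as $t\downarrow0$. -/

import Mathlib

open Filter Topology Set

noncomputable section

namespace VanishingFriction

/-! ### The glued cylinder -/

/-- The cylinder `S¹ × [a, b]`, with `S¹ = ℝ / 2πℤ`. -/
abbrev Cyl (a b : ℝ) : Type := AddCircle (2 * Real.pi) × Icc a b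

/-- Two points of the cylinder are identified iff they are equal or both lie on `S¹ × {0}`. -/
def glueSetoid (a b : ℝ) : Setoid (Cyl a b) where
  r p q := p = q ∨ ((p.2 : ℝ) = 0 ∧ (q.2 : ℝ) = 0)
  iseqv :=
    { refl := fun _ => Or.inl rfl
      symm := by
        rintro p q (h | h)
        · exact Or.inl h.symm
        · exact Or.inr ⟨h.2, h.1⟩
      trans := by
        rintro p q r (rfl | h) (rfl | h')
        · exact Or.inl rfl
        · exact Or.inr h'
        · exact Or.inr h
        · exact Or.inr ⟨h.1, h'.2⟩ }

/-- The glued cylinder: `S¹ × [a, b]` with the circle `S¹ × {0}` collapsed to one point,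
with the quotient topology. -/
def Glued (a b : ℝ) : Type := Quotient (glueSetoid a b)

instance (a b : ℝ) : TopologicalSpace (Glued a b) :=
  inferInstanceAs (TopologicalSpace (Quotient (glueSetoid a b)))

instance (a b : ℝ) : CompactSpace (Glued a b) :=
  haveI : Fact (0 < 2 * Real.pi) := ⟨Real.two_pi_pos⟩
  inferInstanceAs (CompactSpace (Quotient (glueSetoid a b)))

/-- The point of the glued cylinder with angle `θ` and height `y`. -/
def pt {a b : ℝ} (θ : ℝ) (y : Icc a b) : Glued a b :=
  Quotient.mk (glueSetoid a b) ((θ : AddCircle (2 * Real.pi)), y)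

open Classical in
/-- A function on the glued cylinder in the coordinates `(θ, y)`, with `θ ∈ ℝ` (so it is
`2π`-periodic in `θ`) and `y ∈ [a, b]`. The value `0` for `y ∉ [a, b]` is never used. -/
def coord {a b : ℝ} (f : C(Glued a b, ℝ)) (θ y : ℝ) : ℝ :=
  if h : y ∈ Icc a b then f (pt θ ⟨y, h⟩) else 0

/-! ### Differentiation with respect to a monotone function -/

/-- `D_w g (y) = L`: the quotients `(g z - g y) / (w z - w y)` tend to `L` as `z → y`. -/
def HasDerivWrt (w g : ℝ → ℝ) (L y : ℝ) : Prop :=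
  Tendsto (fun z => (g z - g y) / (w z - w y)) (𝓝[≠] y) (𝓝 L)

/-- The derivative `D_w g (y)` exists as a finite limit. -/
def DiffWrt (w g : ℝ → ℝ) (y : ℝ) : Prop := ∃ L, HasDerivWrt w g L y

/-- The derivative `D_w g (y)`; meaningful where `DiffWrt w g y` holds. -/
def derivWrt (w g : ℝ → ℝ) (y : ℝ) : ℝ :=
  limUnder (𝓝[≠] y) (fun z => (g z - g y) / (w z - w y))

/-! ### The functions built from the friction coefficient -/

/-- Shift of a function of `y ∈ ℝ ∖ [-1, 1]` to the glued coordinate: `h (y - 1)` for `y < 0`,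
`h (y + 1)` for `y > 0`, and `0` at `y = 0`. -/
def shift (h : ℝ → ℝ) (y : ℝ) : ℝ :=
  if y < 0 then h (y - 1) else if 0 < y then h (y + 1) else 0

/-- The shift of `u(y) = ∫₀^y lam`. -/
def uTilde (lam : ℝ → ℝ) : ℝ → ℝ := shift (fun y => ∫ s in (0 : ℝ)..y, lam s)

/-- The shift of `v(y) = 2 ∫₀^y lam`. -/
def vTilde (lam : ℝ → ℝ) : ℝ → ℝ := shift (fun y => 2 * ∫ s in (0 : ℝ)..y, lam s)

/-- The shift of `lam`. -/
def lamTilde (lam : ℝ → ℝ) : ℝ → ℝ := shift lam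

/-! ### The differential expression and the domain -/

/-- Heights at which the differential expression is evaluated: `a < y < b`, `y ≠ 0`. -/
def Inner (a b : ℝ) : Set ℝ := Ioo a b \ {0}

/-- `D_u D_v f + lam⁻² ∂²f/∂θ²` at the point `(θ, y)`. -/
def expr {a b : ℝ} (lam : ℝ → ℝ) (f : C(Glued a b, ℝ)) (θ y : ℝ) : ℝ :=
  derivWrt (uTilde lam) (derivWrt (vTilde lam) (coord f θ)) y
    + 1 / (lamTilde lam y) ^ 2 * iteratedDeriv 2 (fun t => coord f t y) θ

/-- The domain of the operator. -/
structure MemDom {a b : ℝ} (lam : ℝ → ℝ) (f : C(Glued a b, ℝ)) : Prop where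
  /-- the derivatives in the differential expression exist away from `y = 0` -/
  diff_v : ∀ θ, ∀ y ∈ Inner a b, DiffWrt (vTilde lam) (coord f θ) y
  diff_uv : ∀ θ, ∀ y ∈ Inner a b,
    DiffWrt (uTilde lam) (derivWrt (vTilde lam) (coord f θ)) y
  diff_θ : ∀ y ∈ Inner a b, ContDiff ℝ 2 (fun t => coord f t y)
  /-- these derivatives and the expression itself are continuous away from `y = 0` -/
  cont_v : ContinuousOn (fun p : ℝ × ℝ => derivWrt (vTilde lam) (coord f p.1) p.2)
    (univ ×ˢ Inner a b)
  cont_uv : ContinuousOn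
    (fun p : ℝ × ℝ => derivWrt (uTilde lam) (derivWrt (vTilde lam) (coord f p.1)) p.2)
    (univ ×ˢ Inner a b)
  cont_θ : ContinuousOn (fun p : ℝ × ℝ => deriv (fun t => coord f t p.2) p.1)
    (univ ×ˢ Inner a b)
  cont_θθ : ContinuousOn (fun p : ℝ × ℝ => iteratedDeriv 2 (fun t => coord f t p.2) p.1)
    (univ ×ˢ Inner a b)
  cont_expr : ContinuousOn (fun p : ℝ × ℝ => expr lam f p.1 p.2) (univ ×ˢ Inner a b)
  /-- the one-sided limits of `D_u f` at `y = 0` exist for every `θ`, and their integrals over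
  the circle coincide -/
  glue : ∃ Lm Lp : ℝ → ℝ,
    (∀ θ, Tendsto (fun p : ℝ × ℝ => derivWrt (uTilde lam) (coord f p.1) p.2)
      (𝓝 θ ×ˢ 𝓝[<] 0) (𝓝 (Lm θ))) ∧
    (∀ θ, Tendsto (fun p : ℝ × ℝ => derivWrt (uTilde lam) (coord f p.1) p.2)
      (𝓝 θ ×ˢ 𝓝[>] 0) (𝓝 (Lp θ))) ∧
    ∫ θ in (0 : ℝ)..(2 * Real.pi), Lm θ = ∫ θ in (0 : ℝ)..(2 * Real.pi), Lp θ
  /-- the expression has a limit at `y = 0` that does not depend on `θ` -/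
  lim_zero : ∃ l : ℝ, ∀ θ, Tendsto (fun p : ℝ × ℝ => expr lam f p.1 p.2)
    (𝓝 θ ×ˢ 𝓝[≠] 0) (𝓝 l)
  /-- the expression tends to `0` at both ends of the cylinder -/
  lim_left : ∀ θ, Tendsto (fun p : ℝ × ℝ => expr lam f p.1 p.2) (𝓝 θ ×ˢ 𝓝[>] a) (𝓝 0)
  lim_right : ∀ θ, Tendsto (fun p : ℝ × ℝ => expr lam f p.1 p.2) (𝓝 θ ×ˢ 𝓝[<] b) (𝓝 0)

/-! ### Linearity -/

variable {a b : ℝ} {lam : ℝ → ℝ}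

theorem HasDerivWrt.derivWrt {w g : ℝ → ℝ} {L y : ℝ} (h : HasDerivWrt w g L y) :
    derivWrt w g y = L := Tendsto.limUnder_eq h

theorem DiffWrt.has {w g : ℝ → ℝ} {y : ℝ} (h : DiffWrt w g y) :
    HasDerivWrt w g (VanishingFriction.derivWrt w g y) y := by
  obtain ⟨L, hL⟩ := h
  rwa [hL.derivWrt]

theorem HasDerivWrt.comb {w g h : ℝ → ℝ} {L M y : ℝ} (c : ℝ) (hg : HasDerivWrt w g L y)
    (hh : HasDerivWrt w h M y) : HasDerivWrt w (fun z => c * g z + h z) (c * L + M) y := by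
  unfold HasDerivWrt at *
  refine ((hg.const_mul c).add hh).congr fun z => ?_
  ring

theorem HasDerivWrt.congr {w g h : ℝ → ℝ} {L y : ℝ} {s : Set ℝ} (hs : IsOpen s) (hy : y ∈ s)
    (e : ∀ z ∈ s, h z = g z) (hg : HasDerivWrt w g L y) : HasDerivWrt w h L y := by
  unfold HasDerivWrt at *
  refine hg.congr' ?_
  filter_upwards [mem_nhdsWithin_of_mem_nhds (hs.mem_nhds hy)] with z hz
  rw [e z hz, e y hy]

theorem isOpen_inner : IsOpen (Inner a b) := isOpen_Ioo.sdiff isClosed_singleton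

theorem coord_comb (c : ℝ) (f g : C(Glued a b, ℝ)) (θ y : ℝ) :
    coord (c • f + g) θ y = c * coord f θ y + coord g θ y := by
  unfold coord
  split_ifs <;> simp

theorem coord_periodic (f : C(Glued a b, ℝ)) (y : ℝ) :
    Function.Periodic (fun θ => coord f θ y) (2 * Real.pi) := by
  intro θ
  simp [coord, pt]

theorem diffWrt_u {w g : ℝ → ℝ} {y : ℝ} (h : DiffWrt (fun z => 2 * w z) g y) :
    DiffWrt w g y := by
  obtain ⟨L, hL⟩ := h
  refine ⟨2 * L, ?_⟩
  unfold HasDerivWrt at *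
  refine (hL.const_mul 2).congr fun z => ?_
  rw [← mul_sub, div_mul_eq_div_div, ← mul_div_assoc, mul_div_assoc', mul_div_cancel_left₀]
  norm_num

theorem vTilde_eq : vTilde lam = fun y => 2 * uTilde lam y := by
  funext y
  unfold vTilde uTilde shift
  split_ifs <;> simp

theorem MemDom.diff_u {f : C(Glued a b, ℝ)} (hf : MemDom lam f) (θ : ℝ) {y : ℝ}
    (hy : y ∈ Inner a b) : DiffWrt (uTilde lam) (coord f θ) y := by
  have := hf.diff_v θ y hy
  rw [vTilde_eq] at this
  exact diffWrt_u this

theorem MemDom.u_comb {f g : C(Glued a b, ℝ)} (hf : MemDom lam f) (hg : MemDom lam g) (c : ℝ)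
    (θ : ℝ) {y : ℝ} (hy : y ∈ Inner a b) :
    derivWrt (uTilde lam) (coord (c • f + g) θ) y
      = c * derivWrt (uTilde lam) (coord f θ) y + derivWrt (uTilde lam) (coord g θ) y := by
  rw [show coord (c • f + g) θ = fun z => c * coord f θ z + coord g θ z from
    funext fun z => coord_comb c f g θ z]
  exact ((hf.diff_u θ hy).has.comb c (hg.diff_u θ hy).has).derivWrt

theorem MemDom.has_v_comb {f g : C(Glued a b, ℝ)} (hf : MemDom lam f) (hg : MemDom lam g) (c : ℝ)
    (θ : ℝ) {y : ℝ} (hy : y ∈ Inner a b) :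
    HasDerivWrt (vTilde lam) (coord (c • f + g) θ)
      (c * derivWrt (vTilde lam) (coord f θ) y + derivWrt (vTilde lam) (coord g θ) y) y := by
  rw [show coord (c • f + g) θ = fun z => c * coord f θ z + coord g θ z from
    funext fun z => coord_comb c f g θ z]
  exact (hf.diff_v θ y hy).has.comb c (hg.diff_v θ y hy).has

theorem MemDom.has_uv_comb {f g : C(Glued a b, ℝ)} (hf : MemDom lam f) (hg : MemDom lam g)
    (c : ℝ) (θ : ℝ) {y : ℝ} (hy : y ∈ Inner a b) :
    HasDerivWrt (uTilde lam) (derivWrt (vTilde lam) (coord (c • f + g) θ))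
      (c * derivWrt (uTilde lam) (derivWrt (vTilde lam) (coord f θ)) y
        + derivWrt (uTilde lam) (derivWrt (vTilde lam) (coord g θ)) y) y :=
  ((hf.diff_uv θ y hy).has.comb c (hg.diff_uv θ y hy).has).congr isOpen_inner hy
    fun _ hz => (hf.has_v_comb hg c θ hz).derivWrt

theorem MemDom.deriv_comb {f g : C(Glued a b, ℝ)} (hf : MemDom lam f) (hg : MemDom lam g)
    (c : ℝ) (θ : ℝ) {y : ℝ} (hy : y ∈ Inner a b) :
    deriv (fun t => coord (c • f + g) t y) θ
      = c * deriv (fun t => coord f t y) θ + deriv (fun t => coord g t y) θ := by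
  simp only [coord_comb]
  have h1 := ((hf.diff_θ y hy).differentiable (by norm_num)) θ
  have h2 := ((hg.diff_θ y hy).differentiable (by norm_num)) θ
  exact ((h1.hasDerivAt.const_mul c).add h2.hasDerivAt).deriv

theorem MemDom.deriv2_comb {f g : C(Glued a b, ℝ)} (hf : MemDom lam f) (hg : MemDom lam g)
    (c : ℝ) (θ : ℝ) {y : ℝ} (hy : y ∈ Inner a b) :
    iteratedDeriv 2 (fun t => coord (c • f + g) t y) θ
      = c * iteratedDeriv 2 (fun t => coord f t y) θ
        + iteratedDeriv 2 (fun t => coord g t y) θ := by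
  have e : deriv (fun t => coord (c • f + g) t y) = fun θ =>
      c * deriv (fun t => coord f t y) θ + deriv (fun t => coord g t y) θ :=
    funext fun θ => hf.deriv_comb hg c θ hy
  have key : ∀ {k : C(Glued a b, ℝ)}, MemDom lam k →
      DifferentiableAt ℝ (deriv (fun t => coord k t y)) θ := fun {k} hk =>
    (((contDiff_succ_iff_deriv (n := 1)).1
      (by simpa [one_add_one_eq_two] using hk.diff_θ y hy)).2.2.differentiable (by norm_num)) θ
  simp only [iteratedDeriv_succ, iteratedDeriv_zero]
  rw [e]
  exact (((key hf).hasDerivAt.const_mul c).add (key hg).hasDerivAt).deriv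

theorem MemDom.expr_comb {f g : C(Glued a b, ℝ)} (hf : MemDom lam f) (hg : MemDom lam g)
    (c : ℝ) (θ : ℝ) {y : ℝ} (hy : y ∈ Inner a b) :
    expr lam (c • f + g) θ y = c * expr lam f θ y + expr lam g θ y := by
  unfold expr
  rw [hf.deriv2_comb hg c θ hy, (hf.has_uv_comb hg c θ hy).derivWrt]
  ring

theorem inner_zero (ha : a < 0) (hb : 0 < b) : Inner a b ∈ 𝓝[≠] (0 : ℝ) := by
  filter_upwards [mem_nhdsWithin_of_mem_nhds (Ioo_mem_nhds ha hb), self_mem_nhdsWithin]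
    with y h1 h2 using ⟨h1, h2⟩

theorem inner_left (ha : a < 0) (hb : 0 < b) : Inner a b ∈ 𝓝[>] a := by
  filter_upwards [Ioo_mem_nhdsGT ha] with y hy
  exact ⟨⟨hy.1, hy.2.trans hb⟩, hy.2.ne⟩

theorem inner_right (ha : a < 0) (hb : 0 < b) : Inner a b ∈ 𝓝[<] b := by
  filter_upwards [Ioo_mem_nhdsLT hb] with y hy
  exact ⟨⟨ha.trans hy.1, hy.2⟩, hy.1.ne'⟩

theorem tendsto_comb {F G H : ℝ × ℝ → ℝ} {θ c l m : ℝ} {φ : Filter ℝ} (hφ : Inner a b ∈ φ)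
    (e : ∀ θ, ∀ y ∈ Inner a b, H (θ, y) = c * F (θ, y) + G (θ, y))
    (hF : Tendsto F (𝓝 θ ×ˢ φ) (𝓝 l)) (hG : Tendsto G (𝓝 θ ×ˢ φ) (𝓝 m)) :
    Tendsto H (𝓝 θ ×ˢ φ) (𝓝 (c * l + m)) := by
  refine ((hF.const_mul c).add hG).congr' ?_
  filter_upwards [prod_mem_prod univ_mem hφ] with p hp using (e p.1 p.2 hp.2).symm

theorem continuousOn_comb {F G H : ℝ × ℝ → ℝ} {c : ℝ}
    (e : ∀ θ, ∀ y ∈ Inner a b, H (θ, y) = c * F (θ, y) + G (θ, y))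
    (hF : ContinuousOn F (univ ×ˢ Inner a b)) (hG : ContinuousOn G (univ ×ˢ Inner a b)) :
    ContinuousOn H (univ ×ˢ Inner a b) :=
  ((hF.const_mul c).add hG).congr fun p hp => e p.1 p.2 hp.2

/-- A joint limit along `θ' → θ` at every `θ` depends continuously on `θ`. -/
theorem continuous_lim {F : ℝ × ℝ → ℝ} {L : ℝ → ℝ} {φ : Filter ℝ} [φ.NeBot]
    (h : ∀ θ, Tendsto F (𝓝 θ ×ˢ φ) (𝓝 (L θ))) : Continuous L := by
  rw [continuous_iff_continuousAt]
  intro θ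
  rw [ContinuousAt, (closed_nhds_basis (L θ)).tendsto_right_iff]
  rintro s ⟨hs, hsc⟩
  obtain ⟨U, hU, V, hV, hUV⟩ := mem_prod_iff.1 (h θ hs)
  filter_upwards [eventually_mem_nhds_iff.2 hU] with t ht
  refine hsc.mem_of_tendsto (h t) ?_
  filter_upwards [prod_mem_prod ht hV] with p hp using hUV hp

theorem MemDom.comb (ha : a < 0) (hb : 0 < b) {f g : C(Glued a b, ℝ)} (hf : MemDom lam f)
    (hg : MemDom lam g) (c : ℝ) : MemDom lam (c • f + g) where
  diff_v θ y hy := ⟨_, hf.has_v_comb hg c θ hy⟩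
  diff_uv θ y hy := ⟨_, hf.has_uv_comb hg c θ hy⟩
  diff_θ y hy := by
    simp only [coord_comb]
    exact (contDiff_const.mul (hf.diff_θ y hy)).add (hg.diff_θ y hy)
  cont_v := continuousOn_comb (fun θ _ hy => (hf.has_v_comb hg c θ hy).derivWrt)
    hf.cont_v hg.cont_v
  cont_uv := continuousOn_comb (fun θ _ hy => (hf.has_uv_comb hg c θ hy).derivWrt)
    hf.cont_uv hg.cont_uv
  cont_θ := continuousOn_comb (fun θ _ hy => hf.deriv_comb hg c θ hy) hf.cont_θ hg.cont_θ
  cont_θθ := continuousOn_comb (fun θ _ hy => hf.deriv2_comb hg c θ hy) hf.cont_θθ hg.cont_θθ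
  cont_expr := continuousOn_comb (fun θ _ hy => hf.expr_comb hg c θ hy)
    hf.cont_expr hg.cont_expr
  glue := by
    obtain ⟨Lm, Lp, h1, h2, h3⟩ := hf.glue
    obtain ⟨Mm, Mp, k1, k2, k3⟩ := hg.glue
    refine ⟨fun θ => c * Lm θ + Mm θ, fun θ => c * Lp θ + Mp θ, fun θ => ?_, fun θ => ?_, ?_⟩
    · exact tendsto_comb (nhdsWithin_mono _ (fun _ h => ne_of_lt h) (inner_zero ha hb))
        (fun θ _ hy => hf.u_comb hg c θ hy) (h1 θ) (k1 θ)
    · exact tendsto_comb (nhdsWithin_mono _ (fun _ h => ne_of_gt h) (inner_zero ha hb))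
        (fun θ _ hy => hf.u_comb hg c θ hy) (h2 θ) (k2 θ)
    · have i1 := (continuous_lim h1).intervalIntegrable (μ := MeasureTheory.volume) 0 (2 * Real.pi)
      have i2 := (continuous_lim h2).intervalIntegrable (μ := MeasureTheory.volume) 0 (2 * Real.pi)
      have j1 := (continuous_lim k1).intervalIntegrable (μ := MeasureTheory.volume) 0 (2 * Real.pi)
      have j2 := (continuous_lim k2).intervalIntegrable (μ := MeasureTheory.volume) 0 (2 * Real.pi)
      rw [intervalIntegral.integral_add (i1.const_mul c) j1,
        intervalIntegral.integral_add (i2.const_mul c) j2,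
        intervalIntegral.integral_const_mul, intervalIntegral.integral_const_mul, h3, k3]
  lim_zero := by
    obtain ⟨l, hl⟩ := hf.lim_zero
    obtain ⟨m, hm⟩ := hg.lim_zero
    exact ⟨c * l + m, fun θ => tendsto_comb (inner_zero ha hb)
      (fun θ _ hy => hf.expr_comb hg c θ hy) (hl θ) (hm θ)⟩
  lim_left θ := by
    simpa using tendsto_comb (inner_left ha hb)
      (fun θ _ hy => hf.expr_comb hg c θ hy) (hf.lim_left θ) (hg.lim_left θ)
  lim_right θ := by
    simpa using tendsto_comb (inner_right ha hb)
      (fun θ _ hy => hf.expr_comb hg c θ hy) (hf.lim_right θ) (hg.lim_right θ)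

theorem memDom_zero : MemDom lam (0 : C(Glued a b, ℝ)) := by
  have h0 : ∀ θ y, coord (0 : C(Glued a b, ℝ)) θ y = 0 := fun θ y => by simp [coord]
  have h1 : ∀ θ, coord (0 : C(Glued a b, ℝ)) θ = fun _ => 0 := fun θ => funext (h0 θ)
  have d : ∀ (w : ℝ → ℝ) y, HasDerivWrt w (fun _ => 0) 0 y := fun w y => by
    simp [HasDerivWrt]
  have d' : ∀ w : ℝ → ℝ, derivWrt w (fun _ => 0) = fun _ => 0 := fun w =>
    funext fun y => (d w y).derivWrt
  have e : ∀ θ y, expr lam (0 : C(Glued a b, ℝ)) θ y = 0 := fun θ y => by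
    simp [expr, h1, h0, d']
  constructor
  · intro θ y _; rw [h1]; exact ⟨0, d _ _⟩
  · intro θ y _; rw [h1, d']; exact ⟨0, d _ _⟩
  · intro y _; simp only [h0]; exact contDiff_const
  · simp only [h1, d']; exact continuousOn_const
  · simp only [h1, d']; exact continuousOn_const
  · simp only [h0, deriv_const]; exact continuousOn_const
  · simp only [h0, iteratedDeriv_const]; exact continuousOn_const
  · simp only [e]; exact continuousOn_const
  · refine ⟨fun _ => 0, fun _ => 0, fun θ => ?_, fun θ => ?_, rfl⟩ <;>
      (simp only [h1, d']; exact tendsto_const_nhds)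
  · refine ⟨0, fun θ => ?_⟩
    simp only [e]; exact tendsto_const_nhds
  · intro θ; simp only [e]; exact tendsto_const_nhds
  · intro θ; simp only [e]; exact tendsto_const_nhds

/-- The domain is a linear subspace. -/
def dom (lam : ℝ → ℝ) (ha : a < 0) (hb : 0 < b) : Submodule ℝ C(Glued a b, ℝ) where
  carrier := {f | MemDom lam f}
  zero_mem' := memDom_zero
  add_mem' {f g} hf hg := by simpa using MemDom.comb ha hb hf hg 1
  smul_mem' c f hf := by simpa using MemDom.comb ha hb hf memDom_zero c

/-! ### The operator -/

theorem expr_periodic (f : C(Glued a b, ℝ)) (θ y : ℝ) (n : ℤ) :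
    expr lam f (θ + n * (2 * Real.pi)) y = expr lam f θ y := by
  have h1 : coord f (θ + n * (2 * Real.pi)) = coord f θ :=
    funext fun y => (coord_periodic f y).int_mul n θ
  have h2 : iteratedDeriv 2 (fun t => coord f t y) (θ + n * (2 * Real.pi))
      = iteratedDeriv 2 (fun t => coord f t y) θ := by
    have h := congrFun (iteratedDeriv_comp_add_const 2 (fun t => coord f t y)
      (n * (2 * Real.pi))) θ
    rw [← h]
    congr 1
    exact funext fun t => (coord_periodic f y).int_mul n t
  simp only [expr, h1, h2]

theorem isQuotientMap_pt :
    IsQuotientMap (fun p : ℝ × Icc a b => (pt p.1 p.2 : Glued a b)) := by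
  have h1 : IsOpenQuotientMap (fun t : ℝ => (t : AddCircle (2 * Real.pi))) :=
    QuotientAddGroup.isOpenQuotientMap_mk
  have h2 := (h1.prodMap (IsOpenQuotientMap.id (X := Icc a b))).isQuotientMap
  exact (isQuotientMap_quotient_mk' (s := glueSetoid a b)).comp h2

/-- A continuous function on the glued cylinder is determined by its values at heights in
`Inner a b`. -/
theorem ext_inner (ha : a < 0) (hb : 0 < b) {g h : C(Glued a b, ℝ)}
    (e : ∀ θ, ∀ y ∈ Inner a b, coord g θ y = coord h θ y) : g = h := by
  have hc : ∀ (k : C(Glued a b, ℝ)) θ, ContinuousOn (coord k θ) (Icc a b) := by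
    intro k θ
    rw [continuousOn_iff_continuous_domRestrict]
    have e : (Icc a b).domRestrict (coord k θ) = fun y : Icc a b => k (pt θ y) :=
      funext fun y => dif_pos y.2
    rw [e]
    exact k.continuous.comp (isQuotientMap_pt.continuous.comp (Continuous.prodMk_right θ))
  have key : ∀ θ, ∀ y ∈ Icc a b, coord g θ y = coord h θ y := by
    intro θ y hy
    have lim : ∀ φ : Filter ℝ, φ.NeBot → φ ≤ 𝓝 y → Inner a b ∈ φ →
        coord g θ y = coord h θ y := by
      intro φ _ hle hφ
      have hle' : φ ≤ 𝓝[Icc a b] y := le_inf hle (le_principal_iff.2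
        (mem_of_superset hφ fun z hz => Ioo_subset_Icc_self hz.1))
      refine tendsto_nhds_unique ((hc g θ y hy).mono_left hle')
        (((hc h θ y hy).mono_left hle').congr' ?_)
      filter_upwards [hφ] with z hz using (e θ z hz).symm
    rcases eq_or_ne y 0 with rfl | h0
    · exact lim (𝓝[≠] 0) inferInstance nhdsWithin_le_nhds (inner_zero ha hb)
    rcases eq_or_ne y a with rfl | h1
    · exact lim (𝓝[>] y) inferInstance nhdsWithin_le_nhds (inner_left ha hb)
    rcases eq_or_ne y b with rfl | h2
    · exact lim (𝓝[<] y) inferInstance nhdsWithin_le_nhds (inner_right ha hb)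
    · exact e θ y ⟨⟨lt_of_le_of_ne hy.1 h1.symm, lt_of_le_of_ne hy.2 h2⟩, h0⟩
  ext x
  obtain ⟨⟨θ, y⟩, rfl⟩ := isQuotientMap_pt.surjective x
  have := key θ y y.2
  simpa [coord, y.2.1, y.2.2] using this

theorem continuousWithinAt_ext {H F : ℝ × ℝ → ℝ} {θ y L : ℝ} {φ : Filter ℝ}
    (hφ : Inner a b ∈ φ) (hle : 𝓝[Icc a b] y ≤ pure y ⊔ φ)
    (e : ∀ θ, ∀ z ∈ Inner a b, H (θ, z) = F (θ, z)) (hy : ∀ t, H (t, y) = L)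
    (hF : Tendsto F (𝓝 θ ×ˢ φ) (𝓝 L)) :
    ContinuousWithinAt H (univ ×ˢ Icc a b) (θ, y) := by
  rw [ContinuousWithinAt, nhdsWithin_prod_eq, nhdsWithin_univ, hy θ]
  refine Tendsto.mono_left ?_ (prod_mono_right _ hle)
  rw [prod_sup]
  refine Tendsto.sup ?_ ?_
  · rw [prod_pure, tendsto_map'_iff]
    exact tendsto_const_nhds.congr fun t => (hy t).symm
  · refine hF.congr' ?_
    filter_upwards [prod_mem_prod univ_mem hφ] with p hp using (e p.1 p.2 hp.2).symm

/-- For `f` in the domain, the differential expression extends to a continuous function on the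
glued cylinder. -/
theorem exists_ext (ha : a < 0) (hb : 0 < b) {f : C(Glued a b, ℝ)} (hf : MemDom lam f) :
    ∃ g : C(Glued a b, ℝ), ∀ θ, ∀ y ∈ Inner a b, coord g θ y = expr lam f θ y := by
  classical
  obtain ⟨l, hl⟩ := hf.lim_zero
  let H : ℝ × ℝ → ℝ := fun p =>
    if p.2 = 0 then l else if p.2 ∈ Inner a b then expr lam f p.1 p.2 else 0
  have e : ∀ θ, ∀ z ∈ Inner a b, H (θ, z) = expr lam f θ z := fun θ z hz => by
    have : z ≠ 0 := hz.2
    simp only [H, if_neg this, if_pos hz]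
  have hcont : ContinuousOn H (univ ×ˢ Icc a b) := by
    rintro ⟨θ, y⟩ ⟨-, hy⟩
    rcases eq_or_ne y 0 with rfl | h0
    · refine continuousWithinAt_ext (inner_zero ha hb) ?_ e (fun t => by simp [H]) (hl θ)
      rw [pure_sup_nhdsNE]
      exact nhdsWithin_le_nhds
    rcases eq_or_ne y a with rfl | h1
    · refine continuousWithinAt_ext (inner_left ha hb) ?_ e
        (fun t => by simp [H, h0, Inner]) (hf.lim_left θ)
      rw [← nhdsWithin_insert]
      exact nhdsWithin_mono _ fun z hz => hz.1.eq_or_lt.imp Eq.symm id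
    rcases eq_or_ne y b with rfl | h2
    · refine continuousWithinAt_ext (inner_right ha hb) ?_ e
        (fun t => by simp [H, h0, Inner]) (hf.lim_right θ)
      rw [← nhdsWithin_insert]
      exact nhdsWithin_mono _ fun z hz => hz.2.eq_or_lt
    · have hy' : y ∈ Inner a b :=
        ⟨⟨lt_of_le_of_ne hy.1 h1.symm, lt_of_le_of_ne hy.2 h2⟩, h0⟩
      have ho : (univ ×ˢ Inner a b : Set (ℝ × ℝ)) ∈ 𝓝 (θ, y) :=
        (isOpen_univ.prod isOpen_inner).mem_nhds ⟨mem_univ _, hy'⟩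
      refine ContinuousAt.continuousWithinAt ?_
      refine (hf.cont_expr.continuousAt ho).congr ?_
      filter_upwards [ho] with p hp using (e p.1 p.2 hp.2).symm
  have hK : Continuous (fun p : ℝ × Icc a b => H (p.1, p.2)) :=
    hcont.comp_continuous (by fun_prop) fun p => ⟨mem_univ _, p.2.2⟩
  have hfac : Function.FactorsThrough (fun p : ℝ × Icc a b => H (p.1, p.2))
      (fun p : ℝ × Icc a b => (pt p.1 p.2 : Glued a b)) := by
    rintro ⟨θ, y⟩ ⟨θ', y'⟩ h
    rcases (Quotient.exact h : (glueSetoid a b).r _ _) with h | h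
    · obtain ⟨h1, rfl⟩ := Prod.mk.inj h
      obtain ⟨n, hn⟩ := QuotientAddGroup.eq.1 h1
      have hn' : θ' = θ + n * (2 * Real.pi) := by
        simp only [zsmul_eq_mul] at hn
        linarith
      simp only [H, hn', expr_periodic]
    · have h1 : (y : ℝ) = 0 := h.1
      have h2 : (y' : ℝ) = 0 := h.2
      simp only [H, h1, h2, if_true]
  let P : C(ℝ × Icc a b, Glued a b) := ⟨_, isQuotientMap_pt.continuous⟩
  have hP : IsQuotientMap P := isQuotientMap_pt
  refine ⟨hP.lift ⟨_, hK⟩ hfac, fun θ y hy => ?_⟩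
  have hy' : y ∈ Icc a b := Ioo_subset_Icc_self hy.1
  rw [← e θ y hy, coord, dif_pos hy']
  exact congrArg (fun k : C(ℝ × Icc a b, ℝ) => k (θ, ⟨y, hy'⟩))
    (hP.lift_comp ⟨_, hK⟩ hfac)

/-- `A f`: the differential expression for `a < y < b`, `y ≠ 0`, extended by its limits to
`y = a`, `y = 0`, `y = b`; that is, the unique continuous function on the glued cylinder that
agrees with the expression where the latter is defined. -/
def ext (ha : a < 0) (hb : 0 < b) {f : C(Glued a b, ℝ)} (hf : MemDom lam f) : C(Glued a b, ℝ) :=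
  (exists_ext ha hb hf).choose

theorem coord_ext (ha : a < 0) (hb : 0 < b) {f : C(Glued a b, ℝ)} (hf : MemDom lam f) (θ : ℝ)
    {y : ℝ} (hy : y ∈ Inner a b) : coord (ext ha hb hf) θ y = expr lam f θ y :=
  (exists_ext ha hb hf).choose_spec θ y hy

theorem ext_comb (ha : a < 0) (hb : 0 < b) {f g k : C(Glued a b, ℝ)} (hf : MemDom lam f)
    (hg : MemDom lam g) (hk : MemDom lam k) (c : ℝ) (h : k = c • f + g) :
    ext ha hb hk = c • ext ha hb hf + ext ha hb hg := by
  subst h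
  refine ext_inner ha hb fun θ y hy => ?_
  rw [coord_comb, coord_ext _ _ _ _ hy, coord_ext _ _ _ _ hy, coord_ext _ _ _ _ hy,
    hf.expr_comb hg c θ hy]

theorem ext_zero (ha : a < 0) (hb : 0 < b) :
    ext ha hb (memDom_zero (lam := lam)) = 0 := by
  simpa using ext_comb ha hb (memDom_zero (lam := lam)) memDom_zero memDom_zero 1 (by simp)

/-- The operator `A` with its domain. -/
def opA (lam : ℝ → ℝ) (ha : a < 0) (hb : 0 < b) : C(Glued a b, ℝ) →ₗ.[ℝ] C(Glued a b, ℝ) where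
  domain := dom lam ha hb
  toFun :=
    { toFun := fun f => ext ha hb (f := f.1) f.2
      map_add' := fun f g => by
        simpa using ext_comb ha hb f.2 g.2 (f + g).2 1 (by simp)
      map_smul' := fun c f => by
        simpa [ext_zero] using ext_comb ha hb f.2 memDom_zero (c • f).2 c (by simp) }

/-! ### Markov semigroups -/

/-- A Markov (Feller) semigroup on `C(X)`, `X` compact: a strongly continuous one-parameter
semigroup of positive bounded operators that fix the constant function `1`. -/
structure IsMarkovSemigroup {X : Type*} [TopologicalSpace X] [CompactSpace X]
    (T : NNReal → C(X, ℝ) →L[ℝ] C(X, ℝ)) : Prop where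
  zero : T 0 = ContinuousLinearMap.id ℝ C(X, ℝ)
  add : ∀ s t, T (s + t) = (T s).comp (T t)
  strong_cont : ∀ f, Tendsto (fun t => T t f) (𝓝[>] 0) (𝓝 f)
  nonneg : ∀ t f, 0 ≤ f → 0 ≤ T t f
  one : ∀ t, T t 1 = 1

/-- `B` is the infinitesimal operator of `T`: `f ∈ D(B)` with `B f = g` iff
`(T t f - f) / t → g` in norm as `t ↓ 0`. -/
def IsInfinitesimalOperator {X : Type*} [TopologicalSpace X] [CompactSpace X]
    (T : NNReal → C(X, ℝ) →L[ℝ] C(X, ℝ)) (B : C(X, ℝ) →ₗ.[ℝ] C(X, ℝ)) : Prop :=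
  ∀ f g : C(X, ℝ), (f, g) ∈ B.graph ↔
    Tendsto (fun t : NNReal => (t : ℝ)⁻¹ • (T t f - f)) (𝓝[>] 0) (𝓝 g)

end VanishingFriction

end

/-! At a minimum of `f` at the vertex `𝔬` one averages over the circle: the second derivative in
`θ` integrates to zero, and the flux condition makes the `ũ`-derivative of the average continuous
across `0`, so a one-dimensional minimum principle in the scale `ũ` gives `0 ≤ A f (𝔬)`. Together
with the interior minimum principle, `A` is dissipative and its resolvent is positive.

The modes `H (ũ y) cos (k θ + φ)`, with `H` of class `C²` and vanishing near `0` unless `k = 0`,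
span a dense subspace of `C(ℭ)`. For each of them the resolvent equation `μ f - A f = F` reduces to
a linear second-order equation in the scale `ũ`. Its coefficients are constant if `k = 0`; if
`k ≠ 0` the term `k² / λ̃²` is singular at `0`, and on each side of `0` a positive solution,
reduction of order and variation of parameters give a solution that vanishes at `0`. Hence `μ - A`
has dense range, and Yosida approximation yields the semigroup. -/

noncomputable section

namespace VanishingFriction

section ContractionSemigroups

open NormedSpace (exp)

variable {E : Type*} [NormedAddCommGroup E] [NormedSpace ℝ E]

theorem tendsto_apply_of_dense {𝕜 ι V W : Type*} [NontriviallyNormedField 𝕜]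
    [SeminormedAddCommGroup V] [NormedSpace 𝕜 V] [SeminormedAddCommGroup W] [NormedSpace 𝕜 W]
    {l : Filter ι} {A : ι → V →L[𝕜] W} {B : V →L[𝕜] W} {C : ℝ} (hA : ∀ i, ‖A i‖ ≤ C)
    {S : Set V} (hS : Dense S) (h : ∀ f ∈ S, Tendsto (fun i => A i f) l (𝓝 (B f))) (f : V) :
    Tendsto (fun i => A i f) l (𝓝 (B f)) := by
  have hequi : Equicontinuous fun i => (A i : V → W) :=
    (LipschitzWith.uniformEquicontinuous _ C.toNNReal fun i =>
      (A i).lipschitz.weaken (NNReal.le_toNNReal_of_coe_le (hA i))).equicontinuous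
  exact closure_minimal h (hequi.isClosed_setOfPred_tendsto B.continuous) (hS f)

section Exponential

variable [CompleteSpace E] {B C J : E →L[ℝ] E} {r t : ℝ}

theorem exp_smul_sub_one : exp (r • (J - 1)) = Real.exp (-r) • exp (r • J) := by
  let +nondep : NormedAlgebra ℚ (E →L[ℝ] E) := .restrictScalars ℚ ℝ _
  have h : exp ((-r) • (1 : E →L[ℝ] E)) = Real.exp (-r) • 1 := by
    simp only [← Algebra.algebraMap_eq_smul_one, Real.exp_eq_exp_ℝ]
    exact (NormedSpace.algebraMap_exp_comm (-r)).symm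
  rw [smul_sub, sub_eq_neg_add, ← neg_smul,
    NormedSpace.exp_add_of_commute ((Commute.one_left _).smul_left _), h, smul_one_mul]

theorem norm_exp_smul_sub_one_le (hJ : ‖J‖ ≤ 1) (hr : 0 ≤ r) : ‖exp (r • (J - 1))‖ ≤ 1 := by
  have hpow (n : ℕ) : ‖J ^ n‖ ≤ 1 := by
    rcases n.eq_zero_or_pos with rfl | hn
    · exact ContinuousLinearMap.norm_id_le
    · exact (norm_pow_le' J hn).trans (pow_le_one₀ (norm_nonneg _) hJ)
  have hterm (n : ℕ) : ‖(n.factorial : ℝ)⁻¹ • (r • J) ^ n‖ ≤ (n.factorial : ℝ)⁻¹ • r ^ n := by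
    rw [smul_pow, norm_smul, norm_smul, Real.norm_of_nonneg (by positivity),
      Real.norm_of_nonneg (by positivity), smul_eq_mul]
    gcongr
    exact mul_le_of_le_one_right (by positivity) (hpow n)
  have hexp : ‖exp (r • J)‖ ≤ Real.exp r := by
    have h := tsum_of_norm_bounded (NormedSpace.exp_series_hasSum_exp' (𝕂 := ℝ) r) hterm
    rwa [(NormedSpace.exp_series_hasSum_exp' (𝕂 := ℝ) (r • J)).tsum_eq,
      ← Real.exp_eq_exp_ℝ] at h
  calc ‖exp (r • (J - 1))‖ = Real.exp (-r) * ‖exp (r • J)‖ := by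
        rw [exp_smul_sub_one, norm_smul, Real.norm_of_nonneg (Real.exp_pos _).le]
    _ ≤ Real.exp (-r) * Real.exp r := by gcongr
    _ = 1 := by rw [← Real.exp_add, neg_add_cancel, Real.exp_zero]

theorem exp_smul_sub_one_mem (K : ProperCone ℝ E) (hJ : ∀ f ∈ K, J f ∈ K) (hr : 0 ≤ r) {f : E}
    (hf : f ∈ K) : exp (r • (J - 1)) f ∈ K := by
  have hsmul {c : ℝ} (hc : 0 ≤ c) {g : E} (hg : g ∈ K) : c • g ∈ K :=
    K.smul_mem hg hc
  have hpow (n : ℕ) : (J ^ n) f ∈ K := by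
    induction n with
    | zero => exact hf
    | succ n ih => rw [pow_succ']; exact hJ _ ih
  have hsum := (ContinuousLinearMap.apply ℝ E f).hasSum
    (NormedSpace.exp_series_hasSum_exp' (𝕂 := ℝ) (r • J))
  rw [exp_smul_sub_one]
  refine hsmul (Real.exp_pos _).le (K.isClosed.mem_of_tendsto hsum (.of_forall fun s => ?_))
  refine K.sum_mem fun n _ => ?_
  simp only [ContinuousLinearMap.apply_apply, smul_pow]
  exact hsmul (by positivity) (hsmul (by positivity) (hpow n))

theorem hasDerivAt_exp_smul_apply (B : E →L[ℝ] E) (f : E) (t : ℝ) :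
    HasDerivAt (fun s : ℝ => exp (s • B) f) (exp (t • B) (B f)) t :=
  (ContinuousLinearMap.apply ℝ E f).hasFDerivAt.comp_hasDerivAt t
    (hasDerivAt_exp_smul_const (𝕂 := ℝ) B t)

theorem norm_exp_sub_exp_apply_le (h : Commute B C) (ht : 0 ≤ t)
    (hB : ∀ s ∈ Icc 0 t, ‖exp (s • B)‖ ≤ 1) (hC : ∀ s ∈ Icc 0 t, ‖exp (s • C)‖ ≤ 1) (f : E) :
    ‖exp (t • B) f - exp (t • C) f‖ ≤ t * ‖B f - C f‖ := by
  let +nondep : NormedAlgebra ℚ (E →L[ℝ] E) := .restrictScalars ℚ ℝ _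
  have hfactor (s : ℝ) : exp (t • C) * exp (s • (B - C)) = exp ((t - s) • C) * exp (s • B) := by
    rw [← NormedSpace.exp_add_of_commute, ← NormedSpace.exp_add_of_commute]
    · congr 1; module
    · exact (h.symm.smul_left _).smul_right _
    · exact ((h.symm.sub_right (.refl C)).smul_left _).smul_right _
  have hderiv (s : ℝ) : HasDerivAt (fun s : ℝ => exp (t • C) (exp (s • (B - C)) f))
      (exp (t • C) (exp (s • (B - C)) (B f - C f))) s :=
    (exp (t • C)).hasFDerivAt.comp_hasDerivAt s (hasDerivAt_exp_smul_apply (B - C) f s)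
  have hbound (s : ℝ) (hs : s ∈ Ico 0 t) :
      ‖exp (t • C) (exp (s • (B - C)) (B f - C f))‖ ≤ ‖B f - C f‖ := by
    rw [← mul_apply_eq_comp, hfactor]
    have hts := hC (t - s) ⟨sub_nonneg.2 hs.2.le, sub_le_self t hs.1⟩
    simpa only [one_mul] using (exp ((t - s) • C) * exp (s • B)).le_of_opNorm_le
      ((norm_mul_le _ _).trans (mul_le_one₀ hts (norm_nonneg _) (hB s ⟨hs.1, hs.2.le⟩))) _
  have hmean := norm_image_sub_le_of_norm_deriv_le_segment'
    (fun s _ => (hderiv s).hasDerivWithinAt) hbound t (right_mem_Icc.2 ht)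
  have hleft : exp (t • C) (exp (t • (B - C)) f) = exp (t • B) f := by
    simpa using congrArg (· f) (hfactor t)
  simpa [hleft, mul_comm] using hmean

theorem norm_exp_apply_sub_self_le (ht : 0 ≤ t) (hB : ∀ s ∈ Icc 0 t, ‖exp (s • B)‖ ≤ 1) (f : E) :
    ‖exp (t • B) f - f‖ ≤ t * ‖B f‖ := by
  simpa using norm_exp_sub_exp_apply_le (Commute.zero_right B) ht hB
    (fun s _ => by
      rw [smul_zero, NormedSpace.exp_zero]
      exact ContinuousLinearMap.norm_id_le) f

theorem norm_exp_taylor_le (ht : 0 ≤ t) (hB : ∀ s ∈ Icc 0 t, ‖exp (s • B)‖ ≤ 1) (f q : E) :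
    ‖exp (t • B) f - f - t • B f‖ ≤ t * (t * ‖B q‖ + 2 * ‖B f - q‖) := by
  have hderiv (s : ℝ) : HasDerivAt (fun s : ℝ => exp (s • B) f - s • B f)
      (exp (s • B) (B f) - B f) s := by
    simpa using (hasDerivAt_exp_smul_apply B f s).fun_sub ((hasDerivAt_id s).smul_const (B f))
  have hbound (s : ℝ) (hs : s ∈ Ico 0 t) :
      ‖exp (s • B) (B f) - B f‖ ≤ t * ‖B q‖ + 2 * ‖B f - q‖ := by
    have hq : ‖exp (s • B) q - q‖ ≤ t * ‖B q‖ :=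
      (norm_exp_apply_sub_self_le hs.1 (fun r hr => hB r ⟨hr.1, hr.2.trans hs.2.le⟩) q).trans
        (by gcongr; exact hs.2.le)
    have hd : ‖exp (s • B) (B f - q)‖ ≤ ‖B f - q‖ := by
      simpa using (exp (s • B)).le_of_opNorm_le (hB s ⟨hs.1, hs.2.le⟩) (B f - q)
    calc ‖exp (s • B) (B f) - B f‖
        = ‖exp (s • B) (B f - q) + (exp (s • B) q - q) - (B f - q)‖ := by
          rw [map_sub]; congr 1; abel
      _ ≤ ‖exp (s • B) (B f - q)‖ + ‖exp (s • B) q - q‖ + ‖B f - q‖ :=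
          (norm_sub_le _ _).trans (add_le_add_left (norm_add_le _ _) _)
      _ ≤ _ := by linarith
  have hmean := norm_image_sub_le_of_norm_deriv_le_segment'
    (fun s _ => (hderiv s).hasDerivWithinAt) hbound t (right_mem_Icc.2 ht)
  simpa [mul_comm, sub_right_comm] using hmean

end Exponential

/-- Dissipativity of a linear relation, that is of a possibly multivalued operator given by its
graph `Γ`. -/
def IsDissipative (Γ : Submodule ℝ (E × E)) : Prop :=
  ∀ p ∈ Γ, ∀ μ : ℝ, 0 < μ → μ * ‖p.1‖ ≤ ‖μ • p.1 - p.2‖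

/-- The hypotheses of the Hille–Yosida theorem for contraction semigroups: `Γ` is the graph of a
densely defined dissipative operator `B` with `μ - B` onto for all `μ > 0`. -/
structure IsMDissipative (Γ : Submodule ℝ (E × E)) : Prop where
  isDissipative : IsDissipative Γ
  dense : Dense (Prod.fst '' (Γ : Set (E × E)))
  surj : ∀ μ : ℝ, 0 < μ → ∀ h : E, ∃ p ∈ Γ, μ • p.1 - p.2 = h

variable {Γ : Submodule ℝ (E × E)}

theorem IsDissipative.topologicalClosure (hΓ : IsDissipative Γ) :
    IsDissipative Γ.topologicalClosure := fun _ hp μ hμ =>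
  closure_minimal (t := {p : E × E | μ * ‖p.1‖ ≤ ‖μ • p.1 - p.2‖}) (fun q hq => hΓ q hq μ hμ)
    (isClosed_le (by fun_prop) (by fun_prop)) hp

theorem IsDissipative.snd_eq_zero (hΓ : IsDissipative Γ)
    (hdense : Dense (Prod.fst '' (Γ : Set (E × E)))) {p : E × E} (hp : p ∈ Γ) (h0 : p.1 = 0) :
    p.2 = 0 := by
  have hlarge (q : E × E) (hq : q ∈ Γ) (μ : ℝ) (hμ : 0 < μ) :
      ‖q.1‖ ≤ ‖q.1 - p.2 - μ⁻¹ • q.2‖ := by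
    have h := hΓ (q + μ • p) (Γ.add_mem hq (Γ.smul_mem μ hp)) μ hμ
    have e : μ • q.1 - (q.2 + μ • p.2) = μ • (q.1 - p.2 - μ⁻¹ • q.2) := by
      rw [smul_sub, smul_sub, smul_inv_smul₀ hμ.ne']; abel
    simp only [Prod.fst_add, Prod.smul_fst, Prod.snd_add, Prod.smul_snd, h0, smul_zero,
      add_zero, e, norm_smul, Real.norm_of_nonneg hμ.le] at h
    exact le_of_mul_le_mul_left h hμ
  have hlimit (q : E × E) (hq : q ∈ Γ) : ‖q.1‖ ≤ ‖q.1 - p.2‖ := by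
    have h := ((tendsto_inv_atTop_zero (𝕜 := ℝ)).smul_const q.2).const_sub (q.1 - p.2)
    rw [zero_smul, sub_zero] at h
    exact ge_of_tendsto h.norm ((eventually_gt_atTop 0).mono (hlarge q hq))
  have hp2 : p.2 ∈ {f : E | ‖f‖ ≤ ‖f - p.2‖} :=
    closure_minimal (by rintro _ ⟨q, hq, rfl⟩; exact hlimit q hq)
      (isClosed_le (by fun_prop) (by fun_prop)) (hdense p.2)
  simpa using hp2

theorem IsDissipative.norm_le (hΓ : IsDissipative Γ) {μ : ℝ} (hμ : 0 < μ) {p : E × E}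
    (hp : p ∈ Γ) : ‖p‖ ≤ (2 + μ⁻¹) * ‖μ • p.1 - p.2‖ := by
  set d := μ • p.1 - p.2 with hd
  have hfst : μ * ‖p.1‖ ≤ ‖d‖ := hΓ p hp μ hμ
  have hsnd : ‖p.2‖ ≤ μ * ‖p.1‖ + ‖d‖ := by
    calc ‖p.2‖ = ‖μ • p.1 - d‖ := by rw [hd, sub_sub_cancel]
      _ ≤ ‖μ • p.1‖ + ‖d‖ := norm_sub_le _ _
      _ = μ * ‖p.1‖ + ‖d‖ := by rw [norm_smul, Real.norm_of_nonneg hμ.le]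
  have hinv : 0 ≤ μ⁻¹ * ‖d‖ := by positivity
  rw [Prod.norm_def, add_mul]
  refine max_le ?_ (by linarith)
  linarith [(le_inv_mul_iff₀ hμ).2 hfst, norm_nonneg d]

/-- Lumer–Phillips: if `B` is dissipative, then `μ - B` is bounded below, so on the closure of its
graph a dense range becomes a full one. -/
theorem IsDissipative.isMDissipative_topologicalClosure [CompleteSpace E] (hΓ : IsDissipative Γ)
    (hdense : Dense (Prod.fst '' (Γ : Set (E × E))))
    (hrange : ∀ μ : ℝ, 0 < μ → Dense ((fun p : E × E => μ • p.1 - p.2) '' (Γ : Set (E × E)))) :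
    IsMDissipative Γ.topologicalClosure where
  isDissipative := hΓ.topologicalClosure
  dense := hdense.mono (image_mono Γ.le_topologicalClosure)
  surj μ hμ h := by
    let Ψ : Γ.topologicalClosure →L[ℝ] E :=
      (μ • ContinuousLinearMap.fst ℝ E E - ContinuousLinearMap.snd ℝ E E).comp
        Γ.topologicalClosure.subtypeL
    have hbelow : AntilipschitzWith (Real.toNNReal (2 + μ⁻¹)) Ψ :=
      ContinuousLinearMap.antilipschitz_of_bound _ fun p => by
        rw [Real.coe_toNNReal _ (by positivity)]
        exact hΓ.topologicalClosure.norm_le hμ p.2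
    have : CompleteSpace Γ.topologicalClosure :=
      Γ.isClosed_topologicalClosure.completeSpace_coe
    have hdenseRange : Dense (range Ψ) := (hrange μ hμ).mono <| by
      rintro _ ⟨p, hp, rfl⟩
      exact ⟨⟨p, Γ.le_topologicalClosure hp⟩, rfl⟩
    obtain ⟨p, hp⟩ : h ∈ range Ψ :=
      (hbelow.isClosed_range Ψ.uniformContinuous).closure_eq ▸ hdenseRange h
    exact ⟨p, p.2, hp⟩

namespace IsMDissipative

variable (hΓ : IsMDissipative Γ) {μ ν : ℝ}

/-- The operator `μ - B` as a linear isomorphism from the graph of `B` onto the space. -/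
def resolventEquiv (hμ : 0 < μ) : Γ ≃ₗ[ℝ] E :=
  LinearEquiv.ofBijective ((μ • LinearMap.fst ℝ E E - LinearMap.snd ℝ E E) ∘ₗ Γ.subtype) <| by
    refine ⟨LinearMap.ker_eq_bot.1 <| LinearMap.ker_eq_bot'.2 fun p hp => ?_, fun h => ?_⟩
    · have hp : μ • p.1.1 - p.1.2 = 0 := hp
      have hle := hΓ.isDissipative.norm_le hμ p.2
      rw [hp, norm_zero, mul_zero, norm_le_zero_iff] at hle
      exact Subtype.ext hle
    · obtain ⟨p, hp, h⟩ := hΓ.surj μ hμ h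
      exact ⟨⟨p, hp⟩, h⟩

/-- Yosida's contraction `μ (μ - B)⁻¹`. -/
def yosida (hμ : 0 < μ) : E →L[ℝ] E :=
  LinearMap.mkContinuous
    (μ • LinearMap.fst ℝ E E ∘ₗ Γ.subtype ∘ₗ (hΓ.resolventEquiv hμ).symm.toLinearMap) 1
    fun h => by
      have hle := hΓ.isDissipative _ ((hΓ.resolventEquiv hμ).symm h).2 μ hμ
      have he : μ • ((hΓ.resolventEquiv hμ).symm h).1.1 - ((hΓ.resolventEquiv hμ).symm h).1.2 = h :=
        (hΓ.resolventEquiv hμ).apply_symm_apply h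
      rw [he] at hle
      rw [one_mul, LinearMap.smul_apply, norm_smul, Real.norm_of_nonneg hμ.le]
      exact hle

theorem norm_yosida_le (hμ : 0 < μ) : ‖hΓ.yosida hμ‖ ≤ 1 :=
  LinearMap.mkContinuous_norm_le _ zero_le_one _

theorem norm_yosida_apply_le (hμ : 0 < μ) (f : E) : ‖hΓ.yosida hμ f‖ ≤ ‖f‖ := by
  simpa using (hΓ.yosida hμ).le_of_opNorm_le (hΓ.norm_yosida_le hμ) f

theorem yosida_smul_sub (hμ : 0 < μ) {p : E × E} (hp : p ∈ Γ) :
    hΓ.yosida hμ (μ • p.1 - p.2) = μ • p.1 :=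
  congrArg (fun q : Γ => μ • q.1.1) ((hΓ.resolventEquiv hμ).symm_apply_apply ⟨p, hp⟩)

theorem smul_yosida_sub (hμ : 0 < μ) {p : E × E} (hp : p ∈ Γ) :
    μ • (hΓ.yosida hμ p.1 - p.1) = hΓ.yosida hμ p.2 := by
  rw [smul_sub, ← hΓ.yosida_smul_sub hμ hp, map_sub, map_smul, sub_sub_cancel]

theorem yosida_mem (hμ : 0 < μ) (h : E) : (hΓ.yosida hμ h, μ • (hΓ.yosida hμ h - h)) ∈ Γ := by
  obtain ⟨p, hp, rfl⟩ := hΓ.surj μ hμ h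
  rw [hΓ.yosida_smul_sub hμ hp, sub_sub_cancel]
  exact Γ.smul_mem μ hp

theorem yosida_maps (hμ : 0 < μ) {p : E × E} (hp : p ∈ Γ) :
    (hΓ.yosida hμ p.1, hΓ.yosida hμ p.2) ∈ Γ :=
  hΓ.smul_yosida_sub hμ hp ▸ hΓ.yosida_mem hμ p.1

theorem commute_yosida (hμ : 0 < μ) (hν : 0 < ν) : Commute (hΓ.yosida hμ) (hΓ.yosida hν) := by
  ext f
  have h := hΓ.yosida_smul_sub hν (hΓ.yosida_maps hμ (hΓ.yosida_mem hν f))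
  simp only [map_smul, map_sub, ← smul_sub, sub_sub_cancel] at h
  exact (smul_right_injective E hν.ne' h).symm

theorem tendsto_yosida (f : E) :
    Tendsto (fun n : ℕ => hΓ.yosida n.cast_add_one_pos f) atTop (𝓝 f) := by
  refine tendsto_apply_of_dense (B := ContinuousLinearMap.id ℝ E)
    (fun n => hΓ.norm_yosida_le n.cast_add_one_pos) hΓ.dense ?_ f
  rintro _ ⟨p, hp, rfl⟩
  have hzero : Tendsto (fun n : ℕ => 1 / ((n : ℝ) + 1) * ‖p.2‖) atTop (𝓝 0) := by
    simpa using tendsto_one_div_add_atTop_nhds_zero_nat.mul_const ‖p.2‖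
  refine tendsto_iff_norm_sub_tendsto_zero.2
    (squeeze_zero (fun _ => norm_nonneg _) (fun n => ?_) hzero)
  have hn : (0 : ℝ) < n + 1 := n.cast_add_one_pos
  rw [one_div, le_inv_mul_iff₀ hn]
  calc (n + 1) * ‖hΓ.yosida hn p.1 - p.1‖ = ‖hΓ.yosida hn p.2‖ := by
        rw [← hΓ.smul_yosida_sub hn hp, norm_smul, Real.norm_of_nonneg hn.le]
    _ ≤ ‖p.2‖ := hΓ.norm_yosida_apply_le hn _

/-- Yosida's bounded approximations `B (1 - B / (n + 1))⁻¹` of `B`. -/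
def approxGenerator (n : ℕ) : E →L[ℝ] E :=
  ((n : ℝ) + 1) • (hΓ.yosida n.cast_add_one_pos - 1)

theorem approxGenerator_apply (n : ℕ) {p : E × E} (hp : p ∈ Γ) :
    hΓ.approxGenerator n p.1 = hΓ.yosida n.cast_add_one_pos p.2 :=
  hΓ.smul_yosida_sub n.cast_add_one_pos hp

theorem commute_approxGenerator (m n : ℕ) :
    Commute (hΓ.approxGenerator m) (hΓ.approxGenerator n) :=
  ((((hΓ.commute_yosida _ _).sub_left (.one_left _)).sub_right (.one_right _)).smul_left
    _).smul_right _

variable [CompleteSpace E] {t : ℝ}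

theorem norm_exp_approxGenerator_le (n : ℕ) (ht : 0 ≤ t) :
    ‖exp (t • hΓ.approxGenerator n)‖ ≤ 1 := by
  rw [approxGenerator, smul_smul]
  exact norm_exp_smul_sub_one_le (hΓ.norm_yosida_le _) (by positivity)

theorem norm_exp_approxGenerator_apply_le (n : ℕ) (ht : 0 ≤ t) (f : E) :
    ‖exp (t • hΓ.approxGenerator n) f‖ ≤ ‖f‖ := by
  simpa using ContinuousLinearMap.le_of_opNorm_le _ (hΓ.norm_exp_approxGenerator_le n ht) f

theorem cauchySeq_exp_approxGenerator (ht : 0 ≤ t) (f : E) :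
    CauchySeq fun n => exp (t • hΓ.approxGenerator n) f := by
  simp only [cauchySeq_iff_tendsto_dist_atTop_0, dist_eq_norm]
  rw [← tendsto_zero_iff_norm_tendsto_zero]
  refine tendsto_apply_of_dense (B := 0) (A := fun n : ℕ × ℕ =>
    exp (t • hΓ.approxGenerator n.1) - exp (t • hΓ.approxGenerator n.2)) (fun n =>
      norm_sub_le_of_le (hΓ.norm_exp_approxGenerator_le n.1 ht)
        (hΓ.norm_exp_approxGenerator_le n.2 ht)) hΓ.dense ?_ f
  rintro _ ⟨p, hp, rfl⟩
  have hcauchy := (cauchySeq_iff_tendsto_dist_atTop_0.1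
    (hΓ.tendsto_yosida p.2).cauchySeq).const_mul t
  rw [mul_zero] at hcauchy
  refine squeeze_zero_norm (fun n => ?_) hcauchy
  rw [dist_eq_norm, ← hΓ.approxGenerator_apply _ hp, ← hΓ.approxGenerator_apply _ hp]
  exact norm_exp_sub_exp_apply_le (hΓ.commute_approxGenerator _ _) ht
    (fun s hs => hΓ.norm_exp_approxGenerator_le _ hs.1)
    (fun s hs => hΓ.norm_exp_approxGenerator_le _ hs.1) p.1

theorem exists_tendsto_exp_approxGenerator (t : NNReal) : ∃ T : E →L[ℝ] E, ∀ f,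
    Tendsto (fun n => exp ((t : ℝ) • hΓ.approxGenerator n) f) atTop (𝓝 (T f)) := by
  choose T hT using fun f =>
    cauchySeq_tendsto_of_complete (hΓ.cauchySeq_exp_approxGenerator t.coe_nonneg f)
  exact ⟨continuousLinearMapOfTendsto _ (tendsto_pi_nhds.2 hT), hT⟩

/-- The contraction semigroup `exp (t B)`, the strong limit of the exponentials of the Yosida
approximations. -/
def semigroup (t : NNReal) : E →L[ℝ] E := (hΓ.exists_tendsto_exp_approxGenerator t).choose

theorem tendsto_exp_approxGenerator (t : NNReal) (f : E) :
    Tendsto (fun n => exp ((t : ℝ) • hΓ.approxGenerator n) f) atTop (𝓝 (hΓ.semigroup t f)) :=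
  (hΓ.exists_tendsto_exp_approxGenerator t).choose_spec f

theorem norm_semigroup_apply_le (t : NNReal) (f : E) : ‖hΓ.semigroup t f‖ ≤ ‖f‖ :=
  le_of_tendsto (hΓ.tendsto_exp_approxGenerator t f).norm
    (.of_forall fun n => hΓ.norm_exp_approxGenerator_apply_le n t.coe_nonneg f)

theorem norm_semigroup_le (t : NNReal) : ‖hΓ.semigroup t‖ ≤ 1 :=
  ContinuousLinearMap.opNorm_le_bound _ zero_le_one fun f => by
    simpa using hΓ.norm_semigroup_apply_le t f

theorem semigroup_zero : hΓ.semigroup 0 = ContinuousLinearMap.id ℝ E := by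
  ext f
  exact tendsto_nhds_unique (hΓ.tendsto_exp_approxGenerator 0 f) (by simp)

theorem semigroup_add (s t : NNReal) :
    hΓ.semigroup (s + t) = (hΓ.semigroup s).comp (hΓ.semigroup t) := by
  ext f
  let A (r : NNReal) (n : ℕ) : E →L[ℝ] E := exp ((r : ℝ) • hΓ.approxGenerator n)
  have hadd (n : ℕ) : A (s + t) n f
      = A s n (A t n f - hΓ.semigroup t f) + A s n (hΓ.semigroup t f) := by
    let +nondep : NormedAlgebra ℚ (E →L[ℝ] E) := .restrictScalars ℚ ℝ _
    have hcomm : Commute ((s : ℝ) • hΓ.approxGenerator n) ((t : ℝ) • hΓ.approxGenerator n) :=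
      ((Commute.refl _).smul_left _).smul_right _
    rw [← map_add, sub_add_cancel]
    simp only [A, NNReal.coe_add, add_smul, NormedSpace.exp_add_of_commute hcomm,
      mul_apply_eq_comp]
  have herror : Tendsto (fun n => A s n (A t n f - hΓ.semigroup t f)) atTop (𝓝 0) :=
    squeeze_zero_norm (fun n => hΓ.norm_exp_approxGenerator_apply_le n s.coe_nonneg _)
      (tendsto_iff_norm_sub_tendsto_zero.1 (hΓ.tendsto_exp_approxGenerator t f))
  refine tendsto_nhds_unique (hΓ.tendsto_exp_approxGenerator (s + t) f) ?_
  have hsum := herror.add (hΓ.tendsto_exp_approxGenerator s (hΓ.semigroup t f))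
  rw [zero_add] at hsum
  exact hsum.congr fun n => (hadd n).symm

theorem norm_semigroup_sub_le (t : NNReal) {p : E × E} (hp : p ∈ Γ) :
    ‖hΓ.semigroup t p.1 - p.1‖ ≤ t * ‖p.2‖ := by
  refine le_of_tendsto ((hΓ.tendsto_exp_approxGenerator t p.1).sub_const p.1).norm
    (.of_forall fun n => ?_)
  calc _ ≤ t * ‖hΓ.approxGenerator n p.1‖ := norm_exp_apply_sub_self_le t.coe_nonneg
        (fun s hs => hΓ.norm_exp_approxGenerator_le n hs.1) p.1
    _ ≤ t * ‖p.2‖ := by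
        rw [hΓ.approxGenerator_apply n hp]
        gcongr
        exact hΓ.norm_yosida_apply_le _ _

theorem tendsto_semigroup (f : E) :
    Tendsto (fun t => hΓ.semigroup t f) (𝓝[>] 0) (𝓝 f) := by
  refine tendsto_apply_of_dense (B := ContinuousLinearMap.id ℝ E)
    hΓ.norm_semigroup_le hΓ.dense ?_ f
  rintro _ ⟨p, hp, rfl⟩
  have hzero : Tendsto (fun t : NNReal => (t : ℝ) * ‖p.2‖) (𝓝[>] 0) (𝓝 0) :=
    (Continuous.tendsto' (by fun_prop) 0 0 (by simp)).mono_left nhdsWithin_le_nhds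
  exact tendsto_iff_norm_sub_tendsto_zero.2
    (squeeze_zero (fun _ => norm_nonneg _) (fun t => hΓ.norm_semigroup_sub_le t hp) hzero)

theorem norm_semigroup_taylor_le (t : NNReal) {p q : E × E} (hp : p ∈ Γ) (hq : q ∈ Γ) :
    ‖hΓ.semigroup t p.1 - p.1 - (t : ℝ) • p.2‖ ≤ t * (t * ‖q.2‖ + 2 * ‖p.2 - q.1‖) := by
  let J (n : ℕ) : E →L[ℝ] E := hΓ.yosida (μ := n + 1) n.cast_add_one_pos
  have hleft : Tendsto
      (fun n => ‖exp ((t : ℝ) • hΓ.approxGenerator n) p.1 - p.1 - (t : ℝ) • J n p.2‖) atTop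
      (𝓝 ‖hΓ.semigroup t p.1 - p.1 - (t : ℝ) • p.2‖) :=
    (((hΓ.tendsto_exp_approxGenerator t p.1).sub_const p.1).sub
      ((hΓ.tendsto_yosida p.2).const_smul (t : ℝ))).norm
  have hright : Tendsto (fun n => (t : ℝ) * (t * ‖q.2‖ + 2 * ‖J n p.2 - q.1‖)) atTop
      (𝓝 (t * (t * ‖q.2‖ + 2 * ‖p.2 - q.1‖))) :=
    ((((hΓ.tendsto_yosida p.2).sub_const q.1).norm.const_mul 2).const_add _).const_mul _
  refine le_of_tendsto_of_tendsto' hleft hright fun n => ?_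
  have htaylor := norm_exp_taylor_le t.coe_nonneg
    (fun s hs => hΓ.norm_exp_approxGenerator_le n hs.1) p.1 q.1
  rw [hΓ.approxGenerator_apply n hp, hΓ.approxGenerator_apply n hq] at htaylor
  refine htaylor.trans ?_
  gcongr
  exact hΓ.norm_yosida_apply_le _ _

theorem tendsto_semigroup_sub_div {p : E × E} (hp : p ∈ Γ) :
    Tendsto (fun t : NNReal => (t : ℝ)⁻¹ • (hΓ.semigroup t p.1 - p.1)) (𝓝[>] 0) (𝓝 p.2) := by
  rw [Metric.tendsto_nhds]
  intro ε hε
  obtain ⟨_, ⟨q, hq, rfl⟩, hpq⟩ := Metric.mem_closure_iff.1 (hΓ.dense p.2) (ε / 4) (by positivity)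
  have hzero : Tendsto (fun t : NNReal => (t : ℝ) * ‖q.2‖) (𝓝[>] 0) (𝓝 0) :=
    (Continuous.tendsto' (by fun_prop) 0 0 (by simp)).mono_left nhdsWithin_le_nhds
  filter_upwards [hzero.eventually (gt_mem_nhds (show 0 < ε / 2 by positivity)),
    self_mem_nhdsWithin] with t htq ht
  have ht : (0 : ℝ) < t := ht
  rw [dist_eq_norm] at hpq
  calc dist ((t : ℝ)⁻¹ • (hΓ.semigroup t p.1 - p.1)) p.2
      = (t : ℝ)⁻¹ * ‖hΓ.semigroup t p.1 - p.1 - (t : ℝ) • p.2‖ := by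
        rw [← norm_smul_of_nonneg (inv_nonneg.2 ht.le), smul_sub _ _ ((t : ℝ) • p.2),
          inv_smul_smul₀ ht.ne', dist_eq_norm]
    _ ≤ (t : ℝ)⁻¹ * (t * (t * ‖q.2‖ + 2 * ‖p.2 - q.1‖)) := by
        gcongr
        exact hΓ.norm_semigroup_taylor_le t hp hq
    _ = t * ‖q.2‖ + 2 * ‖p.2 - q.1‖ := inv_mul_cancel_left₀ ht.ne' _
    _ < ε := by linarith

theorem eq_zero_of_tendsto_semigroup_sub_div {f : E}
    (h : Tendsto (fun t : NNReal => (t : ℝ)⁻¹ • (hΓ.semigroup t f - f)) (𝓝[>] 0) (𝓝 f)) :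
    f = 0 := by
  have hle : ‖f‖ ≤ ‖f - f‖ := by
    refine ge_of_tendsto (h.sub_const f).norm ?_
    filter_upwards [self_mem_nhdsWithin] with t ht
    have ht : (0 : ℝ) < t := ht
    have e : (t : ℝ)⁻¹ • (hΓ.semigroup t f - f) - f
        = (t : ℝ)⁻¹ • (hΓ.semigroup t f - (1 + (t : ℝ)) • f) := by
      rw [add_smul, one_smul, ← sub_sub, smul_sub _ _ ((t : ℝ) • f), inv_smul_smul₀ ht.ne']
    rw [e, norm_smul, norm_inv, Real.norm_of_nonneg ht.le, le_inv_mul_iff₀ ht]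
    have htri := norm_sub_norm_le ((1 + (t : ℝ)) • f) (hΓ.semigroup t f)
    rw [norm_smul, Real.norm_of_nonneg (by positivity), norm_sub_rev] at htri
    linarith [hΓ.norm_semigroup_apply_le t f]
  simpa using hle

theorem mem_iff_tendsto_semigroup_sub_div {f g : E} : (f, g) ∈ Γ ↔
    Tendsto (fun t : NNReal => (t : ℝ)⁻¹ • (hΓ.semigroup t f - f)) (𝓝[>] 0) (𝓝 g) := by
  refine ⟨fun h => hΓ.tendsto_semigroup_sub_div h, fun h => ?_⟩
  obtain ⟨p, hp, he⟩ := hΓ.surj 1 one_pos (f - g)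
  have hdiff : g - p.2 = f - p.1 := by
    rw [one_smul, sub_eq_sub_iff_add_eq_add] at he
    rw [sub_eq_sub_iff_add_eq_add, add_comm g, he, add_comm]
  have hzero : f - p.1 = 0 := hΓ.eq_zero_of_tendsto_semigroup_sub_div <| by
    refine (hdiff ▸ h.sub (hΓ.tendsto_semigroup_sub_div hp)).congr fun t => ?_
    rw [← smul_sub, map_sub]
    congr 1
    abel
  rwa [show (f, g) = p from
    Prod.ext (sub_eq_zero.1 hzero) (sub_eq_zero.1 (hdiff.trans hzero))]

theorem semigroup_mem (K : ProperCone ℝ E)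
    (hres : ∀ μ : ℝ, 0 < μ → ∀ p ∈ Γ, μ • p.1 - p.2 ∈ K → p.1 ∈ K) (t : NNReal) {f : E}
    (hf : f ∈ K) : hΓ.semigroup t f ∈ K := by
  refine K.isClosed.mem_of_tendsto (hΓ.tendsto_exp_approxGenerator t f) (.of_forall fun n => ?_)
  rw [approxGenerator, smul_smul]
  refine exp_smul_sub_one_mem K (fun g hg => ?_) (by positivity) hf
  refine hres (n + 1) n.cast_add_one_pos _ (hΓ.yosida_mem n.cast_add_one_pos g) ?_
  rw [smul_sub, sub_sub_cancel]
  exact K.smul_mem hg (by positivity)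

end IsMDissipative

end ContractionSemigroups

section MarkovSemigroups

instance {X : Type*} [TopologicalSpace X] : OrderClosedTopology C(X, ℝ) where
  isClosed_le' := by
    simp only [ContinuousMap.le_def, ofPred_forall]
    exact isClosed_iInter fun x => isClosed_le (by fun_prop) (by fun_prop)

variable {X : Type*} [TopologicalSpace X] [CompactSpace X]

theorem mul_norm_le_of_minimum_principle {f g : C(X, ℝ)} {μ : ℝ} (hμ : 0 < μ)
    (hmin : ∀ x, (∀ y, f x ≤ f y) → 0 ≤ g x) (hmax : ∀ x, (∀ y, f y ≤ f x) → g x ≤ 0) :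
    μ * ‖f‖ ≤ ‖μ • f - g‖ := by
  have habs (x : X) : |μ * f x - g x| ≤ ‖μ • f - g‖ := (μ • f - g).norm_coe_le_norm x
  rw [← Real.norm_of_nonneg hμ.le, ← norm_smul, Real.norm_of_nonneg hμ.le,
    ContinuousMap.norm_le _ (norm_nonneg _)]
  intro x
  have : Nonempty X := ⟨x⟩
  obtain ⟨y, -, hy⟩ := isCompact_univ.exists_isMinOn univ_nonempty f.continuous.continuousOn
  obtain ⟨z, -, hz⟩ := isCompact_univ.exists_isMaxOn univ_nonempty f.continuous.continuousOn
  rw [ContinuousMap.smul_apply, smul_eq_mul, Real.norm_eq_abs, abs_le]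
  constructor
  · linarith [(abs_le.1 (habs y)).1, hmin y fun w => hy (mem_univ w),
      mul_le_mul_of_nonneg_left (hy (mem_univ x)) hμ.le]
  · linarith [(abs_le.1 (habs z)).2, hmax z fun w => hz (mem_univ w),
      mul_le_mul_of_nonneg_left (hz (mem_univ x)) hμ.le]

/-- With `h = μ f - B f` and `N = ‖h‖`, the resolvent sends `N - h` to `N / μ - f`; since
`‖N - h‖ ≤ N`, the contraction property gives `N / μ - f ≤ N / μ`. -/
theorem IsDissipative.nonneg_of_smul_sub_nonneg {Γ : Submodule ℝ (C(X, ℝ) × C(X, ℝ))}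
    (hΓ : IsDissipative Γ) (hone : ((1 : C(X, ℝ)), (0 : C(X, ℝ))) ∈ Γ) {μ : ℝ} (hμ : 0 < μ)
    {p : C(X, ℝ) × C(X, ℝ)} (hp : p ∈ Γ) (h : 0 ≤ μ • p.1 - p.2) : 0 ≤ p.1 := by
  set N := ‖μ • p.1 - p.2‖
  have hdiss := hΓ (N • (1, 0) - μ • p) (Γ.sub_mem (Γ.smul_mem _ hone) (Γ.smul_mem _ hp)) μ hμ
  have hbound : ‖μ • (N • (1 : C(X, ℝ)) - μ • p.1) - (N • (0 : C(X, ℝ)) - μ • p.2)‖ ≤ μ * N := by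
    rw [ContinuousMap.norm_le _ (by positivity)]
    intro y
    have hlow : 0 ≤ μ * p.1 y - p.2 y := h y
    have hupp : μ * p.1 y - p.2 y ≤ N := (abs_le.1 ((μ • p.1 - p.2).norm_coe_le_norm y)).2
    have e : (μ • (N • (1 : C(X, ℝ)) - μ • p.1) - (N • (0 : C(X, ℝ)) - μ • p.2)) y
        = μ * (N - (μ * p.1 y - p.2 y)) := by
      change μ * (N * 1 - μ * p.1 y) - (N * 0 - μ * p.2 y) = _
      ring
    rw [e, Real.norm_of_nonneg (mul_nonneg hμ.le (by linarith))]
    gcongr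
    linarith
  have hnorm : ‖N • (1 : C(X, ℝ)) - μ • p.1‖ ≤ N := le_of_mul_le_mul_left (hdiss.trans hbound) hμ
  intro x
  change 0 ≤ p.1 x
  have hx : N * 1 - μ * p.1 x ≤ N :=
    (abs_le.1 ((ContinuousMap.norm_coe_le_norm _ x).trans hnorm)).2
  exact nonneg_of_mul_nonneg_right (by linarith) hμ

theorem isDissipative_graph_of_minimum_principle {A : C(X, ℝ) →ₗ.[ℝ] C(X, ℝ)}
    (hmin : ∀ (f : A.domain) (x : X), (∀ y, (f : C(X, ℝ)) x ≤ (f : C(X, ℝ)) y) → 0 ≤ A f x) :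
    IsDissipative A.graph := by
  intro p hp μ hμ
  obtain ⟨f, hf, hAf⟩ := A.mem_graph_iff.1 hp
  rw [← hf, ← hAf]
  refine mul_norm_le_of_minimum_principle hμ (hmin f) fun x hx => ?_
  have h := hmin (-f) x fun y => neg_le_neg (hx y)
  rw [LinearPMap.map_neg] at h
  exact neg_nonneg.1 h

/-- The Hille–Yosida–Ray theorem. -/
theorem exists_markovSemigroup_of_minimum_principle (A : C(X, ℝ) →ₗ.[ℝ] C(X, ℝ))
    (hmin : ∀ (f : A.domain) (x : X), (∀ y, (f : C(X, ℝ)) x ≤ (f : C(X, ℝ)) y) → 0 ≤ A f x)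
    (hone : ((1 : C(X, ℝ)), (0 : C(X, ℝ))) ∈ A.graph)
    (hdense : Dense (A.domain : Set C(X, ℝ)))
    (hrange : ∀ μ : ℝ, 0 < μ → Dense (range fun f : A.domain => μ • (f : C(X, ℝ)) - A f)) :
    A.IsClosable ∧ ∃ T : NNReal → C(X, ℝ) →L[ℝ] C(X, ℝ),
      IsMarkovSemigroup T ∧ IsInfinitesimalOperator T A.closure := by
  have hΓ : IsMDissipative A.graph.topologicalClosure :=
    (isDissipative_graph_of_minimum_principle hmin).isMDissipative_topologicalClosure
      (hdense.mono fun f hf => ⟨_, A.mem_graph ⟨f, hf⟩, rfl⟩)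
      fun μ hμ => (hrange μ hμ).mono <| by
        rintro _ ⟨f, rfl⟩
        exact ⟨_, A.mem_graph f, rfl⟩
  have hclosable : A.IsClosable := ⟨A.graph.topologicalClosure.toLinearPMap,
    (Submodule.toLinearPMap_graph_eq _ fun p hp h0 =>
      hΓ.isDissipative.snd_eq_zero hΓ.dense hp h0).symm⟩
  have hone' := A.graph.le_topologicalClosure hone
  refine ⟨hclosable, hΓ.semigroup, ⟨hΓ.semigroup_zero, hΓ.semigroup_add, hΓ.tendsto_semigroup,
    fun t f hf => ?_, fun t => ?_⟩, fun f g => ?_⟩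
  · exact hΓ.semigroup_mem (ProperCone.positive ℝ C(X, ℝ))
      (fun μ hμ p hp h => hΓ.isDissipative.nonneg_of_smul_sub_nonneg hone' hμ hp h) t hf
  · simpa [sub_eq_zero] using hΓ.norm_semigroup_sub_le t hone'
  · rw [← hclosable.graph_closure_eq_closure_graph]
    exact hΓ.mem_iff_tendsto_semigroup_sub_div

end MarkovSemigroups

section Friction

theorem continuous_shift {h : ℝ → ℝ} (hc : Continuous h) (hneg : h (-1) = 0) (hpos : h 1 = 0) :
    Continuous (shift h) := by
  have e : shift h = fun y => h (min y 0 - 1) + h (max y 0 + 1) := by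
    funext y
    rcases lt_trichotomy y 0 with hy | rfl | hy
    · simp [shift, hy, hy.le, hpos]
    · simp [shift, hneg, hpos]
    · simp [shift, hy, hy.le, hy.not_gt, hneg]
  rw [e]
  fun_prop

theorem hasDerivAt_shift {h : ℝ → ℝ} {h' : ℝ → ℝ} (hd : ∀ y, HasDerivAt h (h' y) y) {y : ℝ}
    (hy : y ≠ 0) : HasDerivAt (shift h) (shift h' y) y := by
  rcases lt_or_gt_of_ne hy with hy | hy
  · rw [shift, if_pos hy]
    refine ((hd (y - 1)).comp_sub_const y 1).congr_of_eventuallyEq ?_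
    filter_upwards [Iio_mem_nhds hy] with z hz using if_pos hz
  · rw [shift, if_neg hy.not_gt, if_pos hy]
    refine ((hd (y + 1)).comp_add_const y 1).congr_of_eventuallyEq ?_
    filter_upwards [Ioi_mem_nhds hy] with z (hz : 0 < z)
    rw [shift, if_neg hz.not_gt, if_pos hz]

/-- A continuous friction coefficient that vanishes exactly on `[-1, 1]`. -/
structure IsFriction (lam : ℝ → ℝ) : Prop where
  continuous : Continuous lam
  eq_zero : ∀ y ∈ Icc (-1 : ℝ) 1, lam y = 0
  pos : ∀ y, y ∉ Icc (-1 : ℝ) 1 → 0 < lam y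

variable {lam : ℝ → ℝ}

theorem uTilde_zero : uTilde lam 0 = 0 := by simp [uTilde, shift]

namespace IsFriction

variable (h : IsFriction lam)
include h

theorem continuous_lamTilde : Continuous (lamTilde lam) :=
  continuous_shift h.continuous (h.eq_zero _ (by norm_num)) (h.eq_zero _ (by norm_num))

theorem lamTilde_pos {y : ℝ} (hy : y ≠ 0) : 0 < lamTilde lam y := by
  rcases lt_or_gt_of_ne hy with hy | hy
  · rw [lamTilde, shift, if_pos hy]
    exact h.pos _ fun hmem => by linarith [hmem.1]
  · rw [lamTilde, shift, if_neg hy.not_gt, if_pos hy]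
    exact h.pos _ fun hmem => by linarith [hmem.2]

theorem continuousOn_sq_div_sq (k : ℤ) :
    ContinuousOn (fun y => (k : ℝ) ^ 2 / lamTilde lam y ^ 2) {0}ᶜ :=
  continuousOn_const.div (h.continuous_lamTilde.continuousOn.pow 2)
    fun _ hy => pow_ne_zero 2 (h.lamTilde_pos hy).ne'

theorem integral_eq_zero {y : ℝ} (hy : y ∈ Icc (-1 : ℝ) 1) : ∫ s in (0 : ℝ)..y, lam s = 0 := by
  refine (intervalIntegral.integral_congr fun s hs => ?_).trans intervalIntegral.integral_zero
  exact h.eq_zero s (uIcc_subset_Icc (by norm_num) hy hs)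

theorem continuous_uTilde : Continuous (uTilde lam) :=
  continuous_shift (intervalIntegral.continuous_primitive (h.continuous.intervalIntegrable) 0)
    (h.integral_eq_zero (by norm_num)) (h.integral_eq_zero (by norm_num))

theorem tendsto_uTilde_zero : Tendsto (uTilde lam) (𝓝 0) (𝓝 0) := by
  simpa only [uTilde_zero] using h.continuous_uTilde.tendsto 0

theorem hasDerivAt_uTilde (y : ℝ) : HasDerivAt (uTilde lam) (lamTilde lam y) y := by
  have hne (z : ℝ) (hz : z ≠ 0) : HasDerivAt (uTilde lam) (lamTilde lam z) z :=
    hasDerivAt_shift (fun z => h.continuous.integral_hasStrictDerivAt 0 z |>.hasDerivAt) hz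
  rcases eq_or_ne y 0 with rfl | hy
  · exact hasDerivAt_of_hasDerivAt_of_ne hne h.continuous_uTilde.continuousAt
      h.continuous_lamTilde.continuousAt
  · exact hne y hy

theorem strictMono_uTilde : StrictMono (uTilde lam) :=
  StrictMonoOn.Iic_union_Ici (a := 0)
    (strictMonoOn_of_deriv_pos (convex_Iic 0) h.continuous_uTilde.continuousOn fun y hy => by
      rw [interior_Iic] at hy
      exact (h.hasDerivAt_uTilde y).deriv ▸ h.lamTilde_pos (ne_of_lt hy))
    (strictMonoOn_of_deriv_pos (convex_Ici 0) h.continuous_uTilde.continuousOn fun y hy => by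
      rw [interior_Ici] at hy
      exact (h.hasDerivAt_uTilde y).deriv ▸ h.lamTilde_pos (ne_of_gt hy))

end IsFriction

theorem hasDerivWrt_iff_hasDerivAt {w g : ℝ → ℝ} {w' L y : ℝ} (hw : HasDerivAt w w' y)
    (h0 : w' ≠ 0) (hinj : Function.Injective w) :
    HasDerivWrt w g L y ↔ HasDerivAt g (L * w') y := by
  have hslope : Tendsto (slope w y) (𝓝[≠] y) (𝓝 w') := hasDerivAt_iff_tendsto_slope.1 hw
  have hfactor {z : ℝ} (hz : z ≠ y) :
      (g z - g y) / (w z - w y) = slope g y z / slope w y z ∧ slope w y z ≠ 0 := by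
    rw [slope_def_field, slope_def_field]
    exact ⟨(div_div_div_cancel_right₀ (sub_ne_zero.2 hz) _ _).symm,
      div_ne_zero (sub_ne_zero.2 (hinj.ne hz)) (sub_ne_zero.2 hz)⟩
  rw [hasDerivAt_iff_tendsto_slope, HasDerivWrt]
  constructor <;> intro hg
  · refine (hg.mul hslope).congr' ?_
    filter_upwards [self_mem_nhdsWithin] with z hz
    rw [(hfactor hz).1, div_mul_cancel₀ _ (hfactor hz).2]
  · have hquot := hg.div hslope h0
    rw [mul_div_cancel_right₀ _ h0] at hquot
    refine hquot.congr' ?_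
    filter_upwards [self_mem_nhdsWithin] with z hz using (hfactor hz).1.symm

theorem IsFriction.hasDerivWrt_uTilde_iff (h : IsFriction lam) {g : ℝ → ℝ} {L y : ℝ}
    (hy : y ≠ 0) : HasDerivWrt (uTilde lam) g L y ↔ HasDerivAt g (L * lamTilde lam y) y :=
  hasDerivWrt_iff_hasDerivAt (h.hasDerivAt_uTilde y) (h.lamTilde_pos hy).ne'
    h.strictMono_uTilde.injective

theorem IsFriction.hasDerivWrt_vTilde_iff (h : IsFriction lam) {g : ℝ → ℝ} {L y : ℝ}
    (hy : y ≠ 0) : HasDerivWrt (vTilde lam) g L y ↔ HasDerivAt g (2 * L * lamTilde lam y) y := by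
  rw [vTilde_eq, hasDerivWrt_iff_hasDerivAt ((h.hasDerivAt_uTilde y).const_mul 2)
    (mul_ne_zero two_ne_zero (h.lamTilde_pos hy).ne')
    fun x z hxz => h.strictMono_uTilde.injective (mul_left_cancel₀ two_ne_zero hxz)]
  ring_nf

end Friction

section SecondOrder

theorem nonneg_of_isLocalMin {g p w : ℝ → ℝ} {y r : ℝ}
    (hg : ∀ᶠ z in 𝓝 y, HasDerivAt g (p z * w z) z ∧ 0 < w z) (hp : HasDerivAt p r y)
    (hmin : IsLocalMin g y) : 0 ≤ r := by
  by_contra! hr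
  obtain ⟨hgy, hwy⟩ := hg.self_of_nhds
  have hp0 : p y = 0 := (mul_eq_zero.1 (hmin.hasDerivAt_eq_zero hgy)).resolve_right hwy.ne'
  have hneg : ∀ᶠ z in 𝓝[>] y, p z < 0 := by
    filter_upwards [nhdsGT_le_nhdsNE y
      ((hasDerivAt_iff_tendsto_slope.1 hp).eventually (gt_mem_nhds hr)),
      self_mem_nhdsWithin] with z hz (hzy : y < z)
    rw [slope_def_field, hp0, sub_zero, div_lt_iff₀ (sub_pos.2 hzy), zero_mul] at hz
    exact hz
  obtain ⟨d, hyd, hd⟩ := mem_nhdsGT_iff_exists_Ioo_subset.1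
    (hneg.and ((hg.and hmin).filter_mono nhdsWithin_le_nhds))
  obtain ⟨m, hym, hmd⟩ := exists_between (show y < d from hyd)
  have hIoo {z : ℝ} (hz : z ∈ Ioc y m) : z ∈ Ioo y d := ⟨hz.1, hz.2.trans_lt hmd⟩
  have hanti : StrictAntiOn g (Icc y m) := by
    refine strictAntiOn_of_deriv_neg (convex_Icc y m) (fun z hz => ?_) fun z hz => ?_
    · rcases hz.1.eq_or_lt with rfl | hyz
      · exact hgy.continuousAt.continuousWithinAt
      · exact (hd (hIoo ⟨hyz, hz.2⟩)).2.1.1.continuousAt.continuousWithinAt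
    · rw [interior_Icc] at hz
      obtain ⟨hpz, ⟨hgz, hwz⟩, -⟩ := hd (hIoo (Ioo_subset_Ioc_self hz))
      exact hgz.deriv ▸ mul_neg_of_neg_of_pos hpz hwz
  exact (hd (hIoo (right_mem_Ioc.2 hym))).2.2.not_gt
    (hanti (left_mem_Icc.2 hym.le) (right_mem_Icc.2 hym.le) hym)

theorem lt_of_strictAntiOn_of_tendsto {P : ℝ → ℝ} {c δ L y : ℝ} (hP : StrictAntiOn P (Ioo c δ))
    (hlim : Tendsto P (𝓝[>] c) (𝓝 L)) (hy : y ∈ Ioo c δ) : P y < L := by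
  obtain ⟨m, hcm, hmy⟩ := exists_between hy.1
  have hm : m ∈ Ioo c δ := ⟨hcm, hmy.trans hy.2⟩
  refine (hP hm hy hmy).trans_le (ge_of_tendsto hlim ?_)
  filter_upwards [Ioo_mem_nhdsGT hcm] with z hz
  exact (hP ⟨hz.1, hz.2.trans hm.2⟩ hm hz.2).le

theorem strictAntiOn_of_second_neg {F P r w : ℝ → ℝ} {δ P₀ : ℝ}
    (hF : ContinuousOn F (Ico 0 δ)) (hw : ∀ y ∈ Ioo 0 δ, 0 < w y)
    (hF' : ∀ y ∈ Ioo 0 δ, HasDerivAt F (P y * w y) y)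
    (hP' : ∀ y ∈ Ioo 0 δ, HasDerivAt P (r y * w y) y) (hr : ∀ y ∈ Ioo 0 δ, r y < 0)
    (hlim : Tendsto P (𝓝[>] 0) (𝓝 P₀)) (hP₀ : P₀ ≤ 0) : StrictAntiOn F (Ico 0 δ) := by
  have hP : StrictAntiOn P (Ioo 0 δ) :=
    strictAntiOn_of_deriv_neg (convex_Ioo 0 δ)
      (fun y hy => (hP' y hy).continuousAt.continuousWithinAt) fun y hy => by
        rw [interior_Ioo] at hy
        exact (hP' y hy).deriv ▸ mul_neg_of_neg_of_pos (hr y hy) (hw y hy)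
  refine strictAntiOn_of_deriv_neg (convex_Ico 0 δ) hF fun y hy => ?_
  rw [interior_Ico] at hy
  exact (hF' y hy).deriv ▸ mul_neg_of_neg_of_pos
    ((lt_of_strictAntiOn_of_tendsto hP hlim hy).trans_le hP₀) (hw y hy)

/-- According to the sign of the common limit of `P`, the function `F` decreases to the right or to
the left of `0`. -/
theorem exists_lt_of_second_neg {F P r w : ℝ → ℝ} {δ P₀ : ℝ} (hδ : 0 < δ)
    (hF : ContinuousOn F (Ioo (-δ) δ)) (hw : ∀ y, y ≠ 0 → 0 < w y)
    (hF' : ∀ y ∈ Ioo (-δ) δ, y ≠ 0 → HasDerivAt F (P y * w y) y)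
    (hP' : ∀ y ∈ Ioo (-δ) δ, y ≠ 0 → HasDerivAt P (r y * w y) y)
    (hr : ∀ y ∈ Ioo (-δ) δ, r y < 0)
    (hleft : Tendsto P (𝓝[<] 0) (𝓝 P₀)) (hright : Tendsto P (𝓝[>] 0) (𝓝 P₀)) :
    ∃ y ∈ Ioo (-δ) δ, F y < F 0 := by
  have hIoo {y : ℝ} (hy : y ∈ Ico 0 δ) : y ∈ Ioo (-δ) δ := ⟨by linarith [hy.1], hy.2⟩
  have hneg {y : ℝ} (hy : y ∈ Ioo (-δ) δ) : -y ∈ Ioo (-δ) δ := ⟨neg_lt_neg hy.2, neg_lt.1 hy.1⟩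
  have hmid : δ / 2 ∈ Ico 0 δ := ⟨by positivity, half_lt_self hδ⟩
  rcases le_total P₀ 0 with h0 | h0
  · have hanti : StrictAntiOn F (Ico 0 δ) :=
      strictAntiOn_of_second_neg (hF.mono fun _ => hIoo) (fun y hy => hw y hy.1.ne')
        (fun y hy => hF' y (hIoo (Ioo_subset_Ico_self hy)) hy.1.ne')
        (fun y hy => hP' y (hIoo (Ioo_subset_Ico_self hy)) hy.1.ne')
        (fun y hy => hr y (hIoo (Ioo_subset_Ico_self hy))) hright h0
    exact ⟨δ / 2, hIoo hmid, hanti (left_mem_Ico.2 hδ) hmid (by positivity)⟩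
  · have hanti : StrictAntiOn (fun y => F (-y)) (Ico 0 δ) := by
      refine strictAntiOn_of_second_neg (P := fun y => -P (-y)) (r := fun y => r (-y))
        (w := fun y => w (-y)) (P₀ := -P₀)
        (hF.comp continuous_neg.continuousOn fun _ hy => hneg (hIoo hy))
        (fun y hy => hw _ (neg_ne_zero.2 hy.1.ne')) (fun y hy => ?_) (fun y hy => ?_)
        (fun y hy => hr _ (hneg (hIoo (Ioo_subset_Ico_self hy)))) ?_ (neg_nonpos.2 h0)
      · exact ((hF' (-y) (hneg (hIoo (Ioo_subset_Ico_self hy))) (neg_ne_zero.2 hy.1.ne')).scomp y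
          (hasDerivAt_neg y)).congr_deriv (by simp)
      · exact ((hP' (-y) (hneg (hIoo (Ioo_subset_Ico_self hy))) (neg_ne_zero.2 hy.1.ne')).scomp y
          (hasDerivAt_neg y)).neg.congr_deriv (by simp)
      · exact (hleft.comp (by simpa using tendsto_neg_nhdsGT (a := (0 : ℝ)))).neg
    exact ⟨-(δ / 2), hneg (hIoo hmid),
      by simpa using hanti (left_mem_Ico.2 hδ) hmid (by positivity)⟩

end SecondOrder

section ParametricIntegrals

theorem hasDerivAt_intervalIntegral_param {G G' : ℝ → ℝ → ℝ} {U : Set ℝ} (hU : IsOpen U)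
    {c d y : ℝ} (hy : y ∈ U) (hG : ∀ z ∈ U, Continuous fun θ => G θ z)
    (hd : ∀ θ, ∀ z ∈ U, HasDerivAt (G θ) (G' θ z) z)
    (hc : ContinuousOn (fun p : ℝ × ℝ => G' p.1 p.2) (univ ×ˢ U)) :
    HasDerivAt (fun z => ∫ θ in c..d, G θ z) (∫ θ in c..d, G' θ y) y := by
  obtain ⟨ε, hε, hball⟩ := Metric.nhds_basis_closedBall.mem_iff.1 (hU.mem_nhds hy)
  obtain ⟨C, hC⟩ := (isCompact_uIcc.prod (isCompact_closedBall y ε)).exists_bound_of_continuousOn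
    (s := uIcc c d ×ˢ Metric.closedBall y ε) (hc.mono (prod_mono (subset_univ _) hball))
  have hG' : Continuous fun θ => G' θ y :=
    hc.comp_continuous (Continuous.prodMk_left y) fun _ => ⟨mem_univ _, hy⟩
  exact (intervalIntegral.hasDerivAt_integral_of_dominated_loc_of_deriv_le
    (F := fun z θ => G θ z) (F' := fun z θ => G' θ z) (bound := fun _ => C)
    (Metric.closedBall_mem_nhds y hε)
    ((hU.eventually_mem hy).mono fun z hz => (hG z hz).aestronglyMeasurable)
    ((hG y hy).intervalIntegrable _ _) hG'.aestronglyMeasurable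
    (.of_forall fun θ hθ z hz => hC (θ, z) ⟨uIoc_subset_uIcc hθ, hz⟩) intervalIntegrable_const
    (.of_forall fun θ _ z hz => hd θ z (hball hz))).2

theorem tendsto_intervalIntegral_of_tendsto_prod {G : ℝ → ℝ → ℝ} {L : ℝ → ℝ} {φ : Filter ℝ}
    [φ.NeBot] [φ.IsCountablyGenerated] {c d : ℝ} (hG : ∀ᶠ z in φ, Continuous fun θ => G θ z)
    (h : ∀ θ, Tendsto (fun p : ℝ × ℝ => G p.1 p.2) (𝓝 θ ×ˢ φ) (𝓝 (L θ))) :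
    Tendsto (fun z => ∫ θ in c..d, G θ z) φ (𝓝 (∫ θ in c..d, L θ)) := by
  obtain ⟨C, hC⟩ := isCompact_uIcc.exists_bound_of_continuousOn (s := uIcc c d)
    (continuous_lim h).continuousOn
  have hbound : {p : ℝ × ℝ | ‖G p.1 p.2‖ < C + 1} ∈ 𝓝ˢ (uIcc c d) ×ˢ φ :=
    isCompact_uIcc.mem_nhdsSet_prod_of_forall fun θ hθ =>
      (h θ).norm.eventually (gt_mem_nhds ((hC θ hθ).trans_lt (lt_add_one C)))
  obtain ⟨U, hU, V, hV, hUV⟩ := mem_prod_iff.1 hbound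
  refine intervalIntegral.tendsto_integral_filter_of_dominated_convergence (fun _ => C + 1)
    (hG.mono fun z hz => hz.aestronglyMeasurable) ?_ intervalIntegrable_const
    (.of_forall fun θ _ => (h θ).comp (tendsto_const_nhds.prodMk tendsto_id))
  filter_upwards [hV] with z hz
  refine .of_forall fun θ hθ => le_of_lt (b := C + 1) ?_
  exact hUV (mk_mem_prod (subset_of_mem_nhdsSet hU (uIoc_subset_uIcc hθ)) hz)

end ParametricIntegrals

section Coordinates

variable {a b : ℝ}

theorem inner_subset : Inner a b ⊆ Icc a b := fun _ hy => Ioo_subset_Icc_self hy.1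

theorem coord_eq (f : C(Glued a b, ℝ)) (θ : ℝ) (y : Icc a b) : coord f θ y = f (pt θ y) := by
  rw [coord, dif_pos y.2]

theorem exists_pt (x : Glued a b) : ∃ (θ : ℝ) (y : Icc a b), pt θ y = x := by
  obtain ⟨p, hp⟩ := isQuotientMap_pt.surjective x
  exact ⟨p.1, p.2, hp⟩

theorem ext_coord {f g : C(Glued a b, ℝ)}
    (h : ∀ θ, ∀ y ∈ Icc a b, coord f θ y = coord g θ y) : f = g := by
  ext x
  obtain ⟨θ, y, rfl⟩ := exists_pt x
  rw [← coord_eq, ← coord_eq, h θ y y.2]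

theorem coord_zero_eq (f : C(Glued a b, ℝ)) (θ θ' : ℝ) : coord f θ 0 = coord f θ' 0 := by
  unfold coord
  split_ifs
  · exact congrArg f (Quotient.sound (Or.inr ⟨rfl, rfl⟩))
  · rfl

theorem continuousOn_coord (f : C(Glued a b, ℝ)) :
    ContinuousOn (fun p : ℝ × ℝ => coord f p.1 p.2) (univ ×ˢ Icc a b) := by
  rw [continuousOn_iff_continuous_domRestrict]
  have e : (univ ×ˢ Icc a b).domRestrict (fun p : ℝ × ℝ => coord f p.1 p.2)
      = fun p : (univ ×ˢ Icc a b : Set (ℝ × ℝ)) => f (pt p.1.1 ⟨p.1.2, p.2.2⟩) :=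
    funext fun p => dif_pos p.2.2
  rw [e]
  exact f.continuous.comp (isQuotientMap_pt.continuous.comp
    (f := fun p : (univ ×ˢ Icc a b : Set (ℝ × ℝ)) => (p.1.1, (⟨p.1.2, p.2.2⟩ : Icc a b)))
    (by fun_prop))

theorem continuousOn_coord_right (f : C(Glued a b, ℝ)) (θ : ℝ) :
    ContinuousOn (coord f θ) (Icc a b) :=
  (continuousOn_coord f).comp (Continuous.prodMk_right θ).continuousOn
    fun _ hy => ⟨mem_univ _, hy⟩

theorem continuous_coord_left (f : C(Glued a b, ℝ)) {y : ℝ} (hy : y ∈ Icc a b) :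
    Continuous fun θ => coord f θ y :=
  (continuousOn_coord f).comp_continuous (Continuous.prodMk_left y) fun _ => ⟨mem_univ _, hy⟩

theorem continuousOn_integral_coord (f : C(Glued a b, ℝ)) (c d : ℝ) :
    ContinuousOn (fun y => ∫ θ in c..d, coord f θ y) (Ioo a b) := by
  refine continuousOn_of_forall_continuousAt fun y hy => ?_
  refine tendsto_intervalIntegral_of_tendsto_prod ?_ fun θ => ?_
  · filter_upwards [isOpen_Ioo.mem_nhds hy] with z hz
      using continuous_coord_left f (Ioo_subset_Icc_self hz)
  · rw [← nhds_prod_eq]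
    exact (continuousOn_coord f).continuousAt
      (prod_mem_nhds univ_mem (Icc_mem_nhds hy.1 hy.2))

theorem exists_coord_eq {H : ℝ → ℝ → ℝ}
    (hc : ContinuousOn (fun p : ℝ × ℝ => H p.1 p.2) (univ ×ˢ Icc a b))
    (hper : ∀ y ∈ Icc a b, Function.Periodic (fun θ => H θ y) (2 * Real.pi))
    (h0 : ∀ θ θ', H θ 0 = H θ' 0) :
    ∃ f : C(Glued a b, ℝ), ∀ θ, ∀ y ∈ Icc a b, coord f θ y = H θ y := by
  let P : C(ℝ × Icc a b, Glued a b) := ⟨_, isQuotientMap_pt.continuous⟩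
  let K : C(ℝ × Icc a b, ℝ) :=
    ⟨fun p => H p.1 p.2, hc.comp_continuous (f := fun p : ℝ × Icc a b => (p.1, (p.2 : ℝ)))
      (by fun_prop) fun p => ⟨mem_univ _, p.2.2⟩⟩
  have hP : IsQuotientMap P := isQuotientMap_pt
  have hfac : Function.FactorsThrough K P := by
    rintro ⟨θ, y⟩ ⟨θ', y'⟩ h
    rcases (Quotient.exact h : (glueSetoid a b).r _ _) with h | ⟨hy, hy'⟩
    · obtain ⟨hθ, rfl⟩ := Prod.mk.inj h
      exact ((hper y y.2).lift_coe θ).symm.trans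
        ((congrArg _ hθ).trans ((hper y y.2).lift_coe θ'))
    · change H θ y = H θ' y'
      rw [show (y : ℝ) = 0 from hy, show (y' : ℝ) = 0 from hy', h0]
  refine ⟨hP.lift K hfac, fun θ y hy => ?_⟩
  rw [coord, dif_pos hy]
  exact DFunLike.congr_fun (hP.lift_comp K hfac) (θ, ⟨y, hy⟩)

end Coordinates

section MinimumPrinciple

variable {a b : ℝ} {lam : ℝ → ℝ}

theorem ext_eq_of_tendsto (ha : a < 0) (hb : 0 < b) {f : C(Glued a b, ℝ)} (hf : MemDom lam f)
    (θ : ℝ) {y : ℝ} (hy : y ∈ Icc a b) {φ : Filter ℝ} [φ.NeBot] (hφ : Inner a b ∈ φ)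
    (hle : φ ≤ 𝓝 y) {l : ℝ}
    (hl : Tendsto (fun p : ℝ × ℝ => expr lam f p.1 p.2) (𝓝 θ ×ˢ φ) (𝓝 l)) :
    coord (ext ha hb hf) θ y = l := by
  have hlim : Tendsto (coord (ext ha hb hf) θ) φ (𝓝 (coord (ext ha hb hf) θ y)) :=
    (continuousOn_coord_right _ θ y hy).mono_left
      (le_inf hle (le_principal_iff.2 (mem_of_superset hφ inner_subset)))
  refine tendsto_nhds_unique hlim
    ((hl.comp (tendsto_const_nhds.prodMk tendsto_id)).congr' ?_)
  filter_upwards [hφ] with z hz using (coord_ext ha hb hf θ hz).symm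

namespace MemDom

variable {f : C(Glued a b, ℝ)} (hf : MemDom lam f)
include hf

theorem hasDerivAt_coord (h : IsFriction lam) (θ : ℝ) {y : ℝ} (hy : y ∈ Inner a b) :
    HasDerivAt (coord f θ) (derivWrt (uTilde lam) (coord f θ) y * lamTilde lam y) y :=
  (h.hasDerivWrt_uTilde_iff hy.2).1 (hf.diff_u θ hy).has

theorem derivWrt_uTilde (h : IsFriction lam) (θ : ℝ) {y : ℝ} (hy : y ∈ Inner a b) :
    derivWrt (uTilde lam) (coord f θ) y = 2 * derivWrt (vTilde lam) (coord f θ) y :=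
  ((h.hasDerivWrt_uTilde_iff hy.2).2
    ((h.hasDerivWrt_vTilde_iff hy.2).1 (hf.diff_v θ y hy).has)).derivWrt

theorem hasDerivAt_derivWrt (h : IsFriction lam) (θ : ℝ) {y : ℝ} (hy : y ∈ Inner a b) :
    HasDerivAt (derivWrt (uTilde lam) (coord f θ))
      (2 * derivWrt (uTilde lam) (derivWrt (vTilde lam) (coord f θ)) y * lamTilde lam y) y := by
  have hd := ((h.hasDerivWrt_uTilde_iff hy.2).1 (hf.diff_uv θ y hy).has).const_mul 2
  rw [← mul_assoc] at hd
  refine hd.congr_of_eventuallyEq ?_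
  filter_upwards [isOpen_inner.mem_nhds hy] with z hz using hf.derivWrt_uTilde h θ hz

theorem hasDerivAt_angle (θ : ℝ) {y : ℝ} (hy : y ∈ Inner a b) :
    HasDerivAt (fun t => coord f t y) (deriv (fun t => coord f t y) θ) θ :=
  ((hf.diff_θ y hy).differentiable two_ne_zero θ).hasDerivAt

theorem hasDerivAt_deriv_angle (θ : ℝ) {y : ℝ} (hy : y ∈ Inner a b) :
    HasDerivAt (deriv fun t => coord f t y) (iteratedDeriv 2 (fun t => coord f t y) θ) θ := by
  rw [iteratedDeriv_succ, iteratedDeriv_one]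
  simpa only [iteratedDeriv_one] using
    ((hf.diff_θ y hy).differentiable_iteratedDeriv 1 (by norm_num) θ).hasDerivAt

theorem integral_iteratedDeriv_angle {y : ℝ} (hy : y ∈ Inner a b) :
    ∫ θ in (0 : ℝ)..(2 * Real.pi), iteratedDeriv 2 (fun t => coord f t y) θ = 0 := by
  have hper : deriv (fun t => coord f t y) (2 * Real.pi) = deriv (fun t => coord f t y) 0 := by
    have hshift := deriv_comp_add_const (f := fun t => coord f t y) (a := 2 * Real.pi) (x := 0)
    rwa [show (fun t => coord f (t + 2 * Real.pi) y) = fun t => coord f t y from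
      funext (coord_periodic f y), zero_add, eq_comm] at hshift
  rw [intervalIntegral.integral_eq_sub_of_hasDerivAt
    (fun θ _ => hf.hasDerivAt_deriv_angle θ hy)
    (((hf.diff_θ y hy).continuous_iteratedDeriv 2 le_rfl).intervalIntegrable _ _), hper, sub_self]

theorem expr_nonneg_of_min (h : IsFriction lam) {θ y : ℝ} (hy : y ∈ Inner a b)
    (hmin : ∀ t, ∀ z ∈ Inner a b, coord f θ y ≤ coord f t z) : 0 ≤ expr lam f θ y := by
  have hheight : 0 ≤ 2 * derivWrt (uTilde lam) (derivWrt (vTilde lam) (coord f θ)) y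
      * lamTilde lam y := by
    refine nonneg_of_isLocalMin (g := coord f θ) (w := lamTilde lam) ?_
      (hf.hasDerivAt_derivWrt h θ hy) ?_
    · filter_upwards [isOpen_inner.mem_nhds hy] with z hz
      exact ⟨hf.hasDerivAt_coord h θ hz, h.lamTilde_pos hz.2⟩
    · filter_upwards [isOpen_inner.mem_nhds hy] with z hz using hmin θ z hz
  have hangle : 0 ≤ iteratedDeriv 2 (fun t => coord f t y) θ :=
    nonneg_of_isLocalMin (g := fun t => coord f t y) (w := fun _ => 1)
      (.of_forall fun t => ⟨by simpa using hf.hasDerivAt_angle t hy, one_pos⟩)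
      (hf.hasDerivAt_deriv_angle θ hy) (.of_forall fun t => hmin t y hy)
  have hheight' := nonneg_of_mul_nonneg_left hheight (h.lamTilde_pos hy.2)
  exact add_nonneg (by linarith) (by positivity)

theorem continuousOn_derivWrt_uTilde (h : IsFriction lam) :
    ContinuousOn (fun p : ℝ × ℝ => derivWrt (uTilde lam) (coord f p.1) p.2)
      (univ ×ˢ Inner a b) :=
  (hf.cont_v.const_mul 2).congr fun p hp => hf.derivWrt_uTilde h p.1 hp.2

theorem continuous_derivWrt_uTilde (h : IsFriction lam) {y : ℝ} (hy : y ∈ Inner a b) :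
    Continuous fun θ => derivWrt (uTilde lam) (coord f θ) y :=
  (hf.continuousOn_derivWrt_uTilde h).comp_continuous (f := fun θ : ℝ => (θ, y))
    (Continuous.prodMk_left y) fun _ => ⟨mem_univ _, hy⟩

theorem hasDerivAt_integral_coord (h : IsFriction lam) {y : ℝ} (hy : y ∈ Inner a b) (c d : ℝ) :
    HasDerivAt (fun z => ∫ θ in c..d, coord f θ z)
      ((∫ θ in c..d, derivWrt (uTilde lam) (coord f θ) y) * lamTilde lam y) y := by
  rw [← intervalIntegral.integral_mul_const]
  exact hasDerivAt_intervalIntegral_param isOpen_inner hy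
    (fun z hz => continuous_coord_left f (inner_subset hz))
    (fun θ z hz => hf.hasDerivAt_coord h θ hz)
    ((hf.continuousOn_derivWrt_uTilde h).mul
      (h.continuous_lamTilde.comp continuous_snd).continuousOn)

/-- Only the derivatives in the height survive averaging over the circle. -/
theorem hasDerivAt_integral_derivWrt (h : IsFriction lam) {y : ℝ} (hy : y ∈ Inner a b) :
    HasDerivAt (fun z => ∫ θ in (0 : ℝ)..(2 * Real.pi), derivWrt (uTilde lam) (coord f θ) z)
      (2 * (∫ θ in (0 : ℝ)..(2 * Real.pi), expr lam f θ y) * lamTilde lam y) y := by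
  refine (hasDerivAt_intervalIntegral_param isOpen_inner hy
    (fun z hz => hf.continuous_derivWrt_uTilde h hz)
    (fun θ z hz => hf.hasDerivAt_derivWrt h θ hz) ((hf.cont_uv.const_mul 2).mul
      (h.continuous_lamTilde.comp continuous_snd).continuousOn)).congr_deriv ?_
  have huv : Continuous fun θ => derivWrt (uTilde lam) (derivWrt (vTilde lam) (coord f θ)) y :=
    hf.cont_uv.comp_continuous (f := fun θ : ℝ => (θ, y)) (Continuous.prodMk_left y)
      fun _ => ⟨mem_univ _, hy⟩
  have hθθ : Continuous (iteratedDeriv 2 fun t => coord f t y) :=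
    (hf.diff_θ y hy).continuous_iteratedDeriv 2 le_rfl
  simp only [expr]
  rw [intervalIntegral.integral_mul_const, intervalIntegral.integral_const_mul,
    intervalIntegral.integral_add (huv.intervalIntegrable _ _)
      ((hθθ.const_mul _).intervalIntegrable _ _), intervalIntegral.integral_const_mul,
    hf.integral_iteratedDeriv_angle hy, mul_zero, add_zero]

theorem exists_tendsto_integral_derivWrt (h : IsFriction lam) (ha : a < 0) (hb : 0 < b) :
    ∃ L,
      Tendsto (fun y => ∫ θ in (0 : ℝ)..(2 * Real.pi), derivWrt (uTilde lam) (coord f θ) y)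
        (𝓝[<] 0) (𝓝 L) ∧
      Tendsto (fun y => ∫ θ in (0 : ℝ)..(2 * Real.pi), derivWrt (uTilde lam) (coord f θ) y)
        (𝓝[>] 0) (𝓝 L) := by
  obtain ⟨Lm, Lp, hm, hp, hmp⟩ := hf.glue
  have hc : ∀ᶠ y in 𝓝[≠] 0, Continuous fun θ => derivWrt (uTilde lam) (coord f θ) y := by
    filter_upwards [inner_zero ha hb] with y hy using hf.continuous_derivWrt_uTilde h hy
  exact ⟨_, hmp ▸
    tendsto_intervalIntegral_of_tendsto_prod (hc.filter_mono (nhdsLT_le_nhdsNE 0)) hm,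
    tendsto_intervalIntegral_of_tendsto_prod (hc.filter_mono (nhdsGT_le_nhdsNE 0)) hp⟩

theorem ext_zero_nonneg_of_min (h : IsFriction lam) (ha : a < 0) (hb : 0 < b) (θ : ℝ)
    (hmin : ∀ t, ∀ z ∈ Icc a b, coord f θ 0 ≤ coord f t z) :
    0 ≤ coord (ext ha hb hf) θ 0 := by
  by_contra! hneg
  let M (y : ℝ) : ℝ := ∫ t in (0 : ℝ)..(2 * Real.pi), coord (ext ha hb hf) t y
  have h0 : (0 : ℝ) ∈ Ioo a b := ⟨ha, hb⟩
  have hM0 : M 0 < 0 := by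
    simp only [M, coord_zero_eq (ext ha hb hf) _ θ, intervalIntegral.integral_const, sub_zero]
    exact mul_neg_of_pos_of_neg Real.two_pi_pos hneg
  have hM : ∀ᶠ y in 𝓝 0, y ∈ Ioo a b ∧ M y < 0 :=
    (isOpen_Ioo.eventually_mem h0).and (((continuousOn_integral_coord _ _ _).continuousAt
      (isOpen_Ioo.mem_nhds h0)).eventually (gt_mem_nhds hM0))
  obtain ⟨δ, hδ, hball⟩ := Metric.eventually_nhds_iff_ball.1 hM
  simp only [Real.ball_eq_Ioo, zero_sub, zero_add] at hball
  have hInner {y : ℝ} (hy : y ∈ Ioo (-δ) δ) (hy0 : y ≠ 0) : y ∈ Inner a b := ⟨(hball y hy).1, hy0⟩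
  obtain ⟨L, hleft, hright⟩ := hf.exists_tendsto_integral_derivWrt h ha hb
  obtain ⟨y, hy, hlt⟩ := exists_lt_of_second_neg (r := fun y => 2 * M y) hδ
    ((continuousOn_integral_coord f 0 (2 * Real.pi)).mono fun y hy => (hball y hy).1)
    (fun y => h.lamTilde_pos)
    (fun y hy hy0 => hf.hasDerivAt_integral_coord h (hInner hy hy0) _ _)
    (fun y hy hy0 => by
      simpa only [M, coord_ext ha hb hf _ (hInner hy hy0)]
        using hf.hasDerivAt_integral_derivWrt h (hInner hy hy0))
    (fun y hy => mul_neg_of_pos_of_neg two_pos (hball y hy).2)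
    hleft hright
  have hyab : y ∈ Icc a b := Ioo_subset_Icc_self (hball y hy).1
  refine hlt.not_ge (intervalIntegral.integral_mono_on Real.two_pi_pos.le
    ((continuous_coord_left f (Ioo_subset_Icc_self h0)).intervalIntegrable _ _)
    ((continuous_coord_left f hyab).intervalIntegrable _ _) fun t _ => ?_)
  exact (coord_zero_eq f t θ).trans_le (hmin t y hyab)

end MemDom

theorem opA_nonneg_of_min (h : IsFriction lam) (ha : a < 0) (hb : 0 < b)
    (f : (opA lam ha hb).domain) (x : Glued a b)
    (hx : ∀ y, (f : C(Glued a b, ℝ)) x ≤ (f : C(Glued a b, ℝ)) y) : 0 ≤ opA lam ha hb f x := by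
  have hf : MemDom lam (f : C(Glued a b, ℝ)) := f.2
  change 0 ≤ ext ha hb hf x
  obtain ⟨θ, ⟨y, hy⟩, rfl⟩ := exists_pt x
  rw [← coord_eq (ext ha hb hf) θ ⟨y, hy⟩]
  have hmin (t : ℝ) (z : ℝ) (hz : z ∈ Icc a b) :
      coord (f : C(Glued a b, ℝ)) θ y ≤ coord (f : C(Glued a b, ℝ)) t z := by
    rw [coord_eq _ θ ⟨y, hy⟩, coord_eq _ t ⟨z, hz⟩]
    exact hx _
  rcases eq_or_ne y 0 with rfl | hy0
  · exact hf.ext_zero_nonneg_of_min h ha hb θ hmin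
  rcases hy.1.eq_or_lt with rfl | hay
  · exact (ext_eq_of_tendsto ha hb hf θ hy (inner_left ha hb) nhdsWithin_le_nhds
      (hf.lim_left θ)).ge
  rcases hy.2.eq_or_lt with rfl | hyb
  · exact (ext_eq_of_tendsto ha hb hf θ hy (inner_right ha hb) nhdsWithin_le_nhds
      (hf.lim_right θ)).ge
  have hyI : y ∈ Inner a b := ⟨⟨hay, hyb⟩, hy0⟩
  exact (hf.expr_nonneg_of_min h hyI fun t z hz => hmin t z (inner_subset hz)).trans_eq
    (coord_ext ha hb hf θ hyI).symm

end MinimumPrinciple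

section Modes

variable {a b : ℝ} {lam : ℝ → ℝ}

/-- The function `f` separates in the coordinates: it is the profile `g` in the height times the
Fourier mode `cos (k θ + φ)` in the angle. -/
def IsMode (f : C(Glued a b, ℝ)) (g : ℝ → ℝ) (k : ℤ) (φ : ℝ) : Prop :=
  ∀ θ, ∀ y ∈ Icc a b, coord f θ y = g y * Real.cos (k * θ + φ)

/-- Conditions on the height profile `g` of a mode under which the mode belongs to the domain;
`p = D_u g`, `r = D_u D_u g`, and `s` is the profile of the image under the operator. -/
structure IsProfile (a b : ℝ) (lam : ℝ → ℝ) (k : ℤ) (g p r s : ℝ → ℝ) : Prop where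
  deriv_g : ∀ y ∈ Inner a b, HasDerivAt g (p y * lamTilde lam y) y
  deriv_p : ∀ y ∈ Inner a b, HasDerivAt p (r y * lamTilde lam y) y
  cont_r : ContinuousOn r (Inner a b)
  eq_s : ∀ y ∈ Inner a b, s y = r y / 2 - (k : ℝ) ^ 2 / lamTilde lam y ^ 2 * g y
  lim_p : ∃ pm pp, Tendsto p (𝓝[<] 0) (𝓝 pm) ∧ Tendsto p (𝓝[>] 0) (𝓝 pp) ∧ (k = 0 → pm = pp)
  lim_s : ∃ l, Tendsto s (𝓝[≠] 0) (𝓝 l) ∧ (k ≠ 0 → l = 0)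
  lim_left : Tendsto s (𝓝[>] a) (𝓝 0)
  lim_right : Tendsto s (𝓝[<] b) (𝓝 0)

theorem periodic_cos_int (k : ℤ) (φ : ℝ) :
    Function.Periodic (fun θ : ℝ => Real.cos (k * θ + φ)) (2 * Real.pi) := fun θ => by
  beta_reduce
  rw [← Real.cos_add_int_mul_two_pi (k * θ + φ) k]
  ring_nf

theorem hasDerivAt_cos_mul_add (k φ θ : ℝ) :
    HasDerivAt (fun t => Real.cos (k * t + φ)) (-(k * Real.sin (k * θ + φ))) θ :=
  (((hasDerivAt_id' θ).const_mul k).add_const φ).cos.congr_deriv (by ring)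

theorem hasDerivAt_sin_mul_add (k φ θ : ℝ) :
    HasDerivAt (fun t => Real.sin (k * t + φ)) (k * Real.cos (k * θ + φ)) θ :=
  (((hasDerivAt_id' θ).const_mul k).add_const φ).sin.congr_deriv (by ring)

theorem integral_cos_int {k : ℤ} (hk : k ≠ 0) (φ : ℝ) :
    ∫ θ in (0 : ℝ)..(2 * Real.pi), Real.cos (k * θ + φ) = 0 := by
  have hk' : (k : ℝ) ≠ 0 := Int.cast_ne_zero.2 hk
  have hprim (θ : ℝ) : HasDerivAt (fun t => (k : ℝ)⁻¹ * Real.sin (k * t + φ))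
      (Real.cos (k * θ + φ)) θ :=
    ((hasDerivAt_sin_mul_add k φ θ).const_mul _).congr_deriv (by field_simp)
  have hper : Real.sin (k * (2 * Real.pi) + φ) = Real.sin (k * 0 + φ) := by
    rw [← Real.sin_add_int_mul_two_pi (k * 0 + φ) k]
    ring_nf
  have hc : Continuous fun θ : ℝ => Real.cos (k * θ + φ) := by fun_prop
  rw [intervalIntegral.integral_eq_sub_of_hasDerivAt (fun θ _ => hprim θ)
    (hc.intervalIntegrable _ _), hper, sub_self]

theorem exists_isMode {g : ℝ → ℝ} (hg : ContinuousOn g (Icc a b)) (k : ℤ) (φ : ℝ)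
    (h0 : k = 0 ∨ g 0 = 0) : ∃ f : C(Glued a b, ℝ), IsMode f g k φ := by
  refine exists_coord_eq (H := fun θ y => g y * Real.cos (k * θ + φ)) ?_ (fun y _ => ?_)
    fun θ θ' => ?_
  · exact (hg.comp continuousOn_snd fun p hp => hp.2).mul (by fun_prop)
  · exact fun θ => congrArg (g y * ·) (periodic_cos_int k φ θ)
  · rcases h0 with rfl | h0
    · simp only [Int.cast_zero, zero_mul]
    · simp only [h0, zero_mul]

theorem tendsto_mul_cos {H : ℝ × ℝ → ℝ} {q : ℝ → ℝ} {k φ θ l : ℝ} {Φ : Filter ℝ} {S : Set ℝ}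
    (hS : S ∈ Φ) (e : ∀ t, ∀ y ∈ S, H (t, y) = q y * Real.cos (k * t + φ))
    (hq : Tendsto q Φ (𝓝 l)) :
    Tendsto H (𝓝 θ ×ˢ Φ) (𝓝 (l * Real.cos (k * θ + φ))) := by
  have hc : Continuous fun t : ℝ => Real.cos (k * t + φ) := by fun_prop
  refine ((hq.comp tendsto_snd).mul ((hc.tendsto θ).comp tendsto_fst)).congr' ?_
  filter_upwards [prod_mem_prod univ_mem hS] with p hp using (e p.1 p.2 hp.2).symm

theorem continuousOn_mul_cos {H : ℝ × ℝ → ℝ} {q : ℝ → ℝ} {k φ : ℝ} {S : Set ℝ}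
    (e : ∀ t, ∀ y ∈ S, H (t, y) = q y * Real.cos (k * t + φ)) (hq : ContinuousOn q S) :
    ContinuousOn H (univ ×ˢ S) :=
  ((hq.comp continuousOn_snd fun p hp => hp.2).mul
    (Continuous.continuousOn (f := fun p : ℝ × ℝ => Real.cos (k * p.1 + φ)) (by fun_prop))).congr
    fun p hp => e p.1 p.2 hp.2

namespace IsProfile

variable {k : ℤ} {g p r s : ℝ → ℝ} (hg : IsProfile a b lam k g p r s)
include hg

theorem continuousOn : ContinuousOn g (Inner a b) :=
  fun y hy => (hg.deriv_g y hy).continuousAt.continuousWithinAt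

theorem continuousOn_derivWrt : ContinuousOn p (Inner a b) :=
  fun y hy => (hg.deriv_p y hy).continuousAt.continuousWithinAt

theorem continuousOn_image (h : IsFriction lam) : ContinuousOn s (Inner a b) :=
  ((hg.cont_r.div_const 2).sub
    (((h.continuousOn_sq_div_sq k).mono fun _ hy => hy.2).mul hg.continuousOn)).congr hg.eq_s

end IsProfile

namespace IsMode

variable {f : C(Glued a b, ℝ)} {g p r s : ℝ → ℝ} {k : ℤ} {φ : ℝ} (hf : IsMode f g k φ)
include hf

theorem hasDerivAt_height {θ y g' : ℝ} (hy : y ∈ Inner a b) (hg : HasDerivAt g g' y) :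
    HasDerivAt (coord f θ) (g' * Real.cos (k * θ + φ)) y := by
  refine (hg.mul_const _).congr_of_eventuallyEq ?_
  filter_upwards [isOpen_inner.mem_nhds hy] with z hz using hf θ z (inner_subset hz)

theorem deriv_angle (θ : ℝ) {y : ℝ} (hy : y ∈ Inner a b) :
    deriv (fun t => coord f t y) θ = g y * -(k * Real.sin (k * θ + φ)) := by
  simp only [hf _ y (inner_subset hy)]
  exact ((hasDerivAt_cos_mul_add k φ θ).const_mul _).deriv

theorem iteratedDeriv_angle (θ : ℝ) {y : ℝ} (hy : y ∈ Inner a b) :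
    iteratedDeriv 2 (fun t => coord f t y) θ = -(k : ℝ) ^ 2 * g y * Real.cos (k * θ + φ) := by
  have hderiv : deriv (fun t => coord f t y) = fun t => g y * -(k * Real.sin (k * t + φ)) :=
    funext fun t => hf.deriv_angle t hy
  rw [iteratedDeriv_succ, iteratedDeriv_one, hderiv]
  exact ((((hasDerivAt_sin_mul_add k φ θ).const_mul (k : ℝ)).neg.const_mul (g y)).congr_deriv
    (by ring)).deriv

variable (h : IsFriction lam) (hg : IsProfile a b lam k g p r s)
include h hg

theorem hasDerivWrt_uTilde (θ : ℝ) {y : ℝ} (hy : y ∈ Inner a b) :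
    HasDerivWrt (uTilde lam) (coord f θ) (p y * Real.cos (k * θ + φ)) y :=
  (h.hasDerivWrt_uTilde_iff hy.2).2
    ((hf.hasDerivAt_height hy (hg.deriv_g y hy)).congr_deriv (by ring))

theorem hasDerivWrt_vTilde (θ : ℝ) {y : ℝ} (hy : y ∈ Inner a b) :
    HasDerivWrt (vTilde lam) (coord f θ) (p y / 2 * Real.cos (k * θ + φ)) y :=
  (h.hasDerivWrt_vTilde_iff hy.2).2
    ((hf.hasDerivAt_height hy (hg.deriv_g y hy)).congr_deriv (by ring))

theorem hasDerivWrt_derivWrt (θ : ℝ) {y : ℝ} (hy : y ∈ Inner a b) :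
    HasDerivWrt (uTilde lam) (derivWrt (vTilde lam) (coord f θ))
      (r y / 2 * Real.cos (k * θ + φ)) y := by
  refine (h.hasDerivWrt_uTilde_iff hy.2).2 ((((hg.deriv_p y hy).div_const 2).mul_const
    (Real.cos (k * θ + φ))).congr_deriv (by ring) |>.congr_of_eventuallyEq ?_)
  filter_upwards [isOpen_inner.mem_nhds hy] with z hz
    using (hf.hasDerivWrt_vTilde h hg θ hz).derivWrt

theorem expr_eq (θ : ℝ) {y : ℝ} (hy : y ∈ Inner a b) :
    expr lam f θ y = s y * Real.cos (k * θ + φ) := by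
  rw [expr, (hf.hasDerivWrt_derivWrt h hg θ hy).derivWrt, hf.iteratedDeriv_angle θ hy,
    hg.eq_s y hy]
  ring

theorem tendsto_expr {Φ : Filter ℝ} (hΦ : Inner a b ∈ Φ) {l : ℝ} (hs : Tendsto s Φ (𝓝 l))
    (θ : ℝ) : Tendsto (fun q : ℝ × ℝ => expr lam f q.1 q.2) (𝓝 θ ×ˢ Φ)
      (𝓝 (l * Real.cos (k * θ + φ))) :=
  tendsto_mul_cos hΦ (fun t _ hy => hf.expr_eq h hg t hy) hs

theorem exists_glue (ha : a < 0) (hb : 0 < b) : ∃ Lm Lp : ℝ → ℝ,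
    (∀ θ, Tendsto (fun q : ℝ × ℝ => derivWrt (uTilde lam) (coord f q.1) q.2)
      (𝓝 θ ×ˢ 𝓝[<] 0) (𝓝 (Lm θ))) ∧
    (∀ θ, Tendsto (fun q : ℝ × ℝ => derivWrt (uTilde lam) (coord f q.1) q.2)
      (𝓝 θ ×ˢ 𝓝[>] 0) (𝓝 (Lp θ))) ∧
    ∫ θ in (0 : ℝ)..(2 * Real.pi), Lm θ = ∫ θ in (0 : ℝ)..(2 * Real.pi), Lp θ := by
  obtain ⟨pm, pp, hpm, hpp, hpe⟩ := hg.lim_p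
  refine ⟨fun θ => pm * Real.cos (k * θ + φ), fun θ => pp * Real.cos (k * θ + φ),
    fun θ => tendsto_mul_cos (nhdsLT_le_nhdsNE 0 (inner_zero ha hb))
      (fun t y hy => (hf.hasDerivWrt_uTilde h hg t hy).derivWrt) hpm,
    fun θ => tendsto_mul_cos (nhdsGT_le_nhdsNE 0 (inner_zero ha hb))
      (fun t y hy => (hf.hasDerivWrt_uTilde h hg t hy).derivWrt) hpp, ?_⟩
  rcases eq_or_ne k 0 with hk | hk
  · rw [hpe hk]
  · simp only [intervalIntegral.integral_const_mul, integral_cos_int hk, mul_zero]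

theorem memDom (ha : a < 0) (hb : 0 < b) : MemDom lam f where
  diff_v θ _ hy := ⟨_, hf.hasDerivWrt_vTilde h hg θ hy⟩
  diff_uv θ _ hy := ⟨_, hf.hasDerivWrt_derivWrt h hg θ hy⟩
  diff_θ y hy := by
    simp only [hf _ y (inner_subset hy)]
    fun_prop
  cont_v := continuousOn_mul_cos (fun θ _ hy => (hf.hasDerivWrt_vTilde h hg θ hy).derivWrt)
    (hg.continuousOn_derivWrt.div_const 2)
  cont_uv := continuousOn_mul_cos (fun θ _ hy => (hf.hasDerivWrt_derivWrt h hg θ hy).derivWrt)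
    (hg.cont_r.div_const 2)
  cont_θ := by
    refine ContinuousOn.congr (f := fun q : ℝ × ℝ => g q.2 * -(k * Real.sin (k * q.1 + φ))) ?_
      fun q hq => hf.deriv_angle q.1 hq.2
    exact (hg.continuousOn.comp continuousOn_snd fun q hq => hq.2).mul (by fun_prop)
  cont_θθ := continuousOn_mul_cos (fun θ _ hy => hf.iteratedDeriv_angle θ hy)
    (hg.continuousOn.const_mul _)
  cont_expr := continuousOn_mul_cos (fun θ _ hy => hf.expr_eq h hg θ hy)
    (hg.continuousOn_image h)
  glue := hf.exists_glue h hg ha hb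
  lim_zero := by
    obtain ⟨l, hl, hl0⟩ := hg.lim_s
    have hlim := hf.tendsto_expr h hg (inner_zero ha hb) hl
    refine ⟨l * Real.cos φ, fun θ => ?_⟩
    rcases eq_or_ne k 0 with rfl | hk
    · simpa only [Int.cast_zero, zero_mul, zero_add] using hlim θ
    · simpa only [hl0 hk, zero_mul] using hlim θ
  lim_left θ := by
    simpa only [zero_mul] using hf.tendsto_expr h hg (inner_left ha hb) hg.lim_left θ
  lim_right θ := by
    simpa only [zero_mul] using hf.tendsto_expr h hg (inner_right ha hb) hg.lim_right θ

end IsMode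

/-- Solving the resolvent equation for a mode amounts to solving the ordinary differential equation
`μ g - s = H` for its profile. -/
theorem IsMode.mem_range (h : IsFriction lam) (ha : a < 0) (hb : 0 < b) {F : C(Glued a b, ℝ)}
    {g p r H : ℝ → ℝ} {k : ℤ} {φ μ : ℝ} (hF : IsMode F H k φ)
    (hgc : ContinuousOn g (Icc a b)) (h0 : k = 0 ∨ g 0 = 0)
    (hg : IsProfile a b lam k g p r fun y => μ * g y - H y) :
    F ∈ range fun f : (opA lam ha hb).domain => μ • (f : C(Glued a b, ℝ)) - opA lam ha hb f := by
  obtain ⟨f, hf⟩ := exists_isMode hgc k φ h0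
  have hm : MemDom lam f := hf.memDom h hg ha hb
  refine ⟨⟨f, hm⟩, ?_⟩
  change μ • f - ext ha hb hm = F
  rw [sub_eq_iff_eq_add', ← sub_eq_iff_eq_add, sub_eq_neg_add, ← neg_one_smul ℝ F]
  refine ext_inner ha hb fun θ y hy => ?_
  have hsmul : coord (μ • f) θ y = μ * coord f θ y := by
    rw [coord_eq _ θ ⟨y, inner_subset hy⟩, coord_eq f θ ⟨y, inner_subset hy⟩]
    rfl
  rw [coord_comb, hsmul, coord_ext _ _ _ _ hy, hf.expr_eq h hg θ hy,
    hf θ y (inner_subset hy), hF θ y (inner_subset hy)]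
  ring

end Modes

section Density

variable {a b : ℝ} {lam : ℝ → ℝ}

theorem iteratedDeriv_two_const_mul_sub_sq (K c : ℝ) :
    iteratedDeriv 2 (fun x => K * (x - c) ^ 2) c = 2 * K := by
  have hderiv (x : ℝ) : HasDerivAt (fun x => K * (x - c) ^ 2) (2 * K * (x - c)) x :=
    ((((hasDerivAt_id' x).sub_const c).pow 2).const_mul K).congr_deriv (by ring)
  rw [iteratedDeriv_succ, iteratedDeriv_one, funext fun x => (hderiv x).deriv]
  exact (((hasDerivAt_id' c).sub_const c).const_mul _).deriv.trans (mul_one _)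

theorem exists_small_bump (K : ℝ) {c δ : ℝ} {s : Set ℝ} (hs : s ∈ 𝓝 c) (hδ : 0 < δ) :
    ∃ B : ℝ → ℝ, ContDiff ℝ 2 B ∧ tsupport B ⊆ s ∧ B c = 0 ∧ iteratedDeriv 2 B c = 2 * K ∧
      ∀ x, |B x| ≤ δ := by
  have hlim : Tendsto (fun ε : ℝ => |K| * ε ^ 2) (𝓝[>] 0) (𝓝 0) := by
    have hc : Continuous fun ε : ℝ => |K| * ε ^ 2 := by fun_prop
    simpa using (hc.tendsto 0).mono_left nhdsWithin_le_nhds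
  obtain ⟨r, hr, hrs⟩ := Metric.mem_nhds_iff.1 hs
  obtain ⟨ε, hεδ, hε, hεr⟩ :=
    ((hlim.eventually_le_const hδ).and (Ioo_mem_nhdsGT hr)).exists
  let χ : ContDiffBump c := ⟨ε / 2, ε, half_pos hε, half_lt_self hε⟩
  refine ⟨fun x => K * (x - c) ^ 2 * χ x, ?_, ?_, by simp, ?_, fun x => ?_⟩
  · have hχ := χ.contDiff (n := 2)
    fun_prop
  · exact tsupport_mul_subset_right.trans
      (χ.tsupport_eq.trans_subset ((Metric.closedBall_subset_ball hεr).trans hrs))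
  · have hnear : (fun x => K * (x - c) ^ 2 * χ x) =ᶠ[𝓝 c] fun x => K * (x - c) ^ 2 := by
      filter_upwards [χ.eventuallyEq_one] with x hx using by simp [hx]
    rw [hnear.iteratedDeriv_eq, iteratedDeriv_two_const_mul_sub_sq]
  · rcases le_or_gt ε (dist x c) with hx | hx
    · simpa [χ.zero_of_le_dist hx] using hδ.le
    · rw [abs_mul, abs_mul, abs_of_nonneg χ.nonneg, abs_pow, ← Real.dist_eq]
      calc |K| * dist x c ^ 2 * χ x ≤ |K| * ε ^ 2 * 1 :=
            mul_le_mul (by gcongr) χ.le_one χ.nonneg (by positivity)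
        _ ≤ δ := (mul_one _).trans_le hεδ

theorem iteratedDeriv_eq_zero_of_notMem_tsupport {f : ℝ → ℝ} {x : ℝ} (n : ℕ)
    (hx : x ∉ tsupport f) : iteratedDeriv n f x = 0 := by
  rw [(notMem_tsupport_iff_eventuallyEq.1 hx).iteratedDeriv_eq n]
  simp

theorem exists_small_correction (K K' : ℝ) {α β δ : ℝ} (hα : α < 0) (hβ : 0 < β) (hδ : 0 < δ) :
    ∃ G : ℝ → ℝ, ContDiff ℝ 2 G ∧ G =ᶠ[𝓝 0] 0 ∧ G α = 0 ∧ iteratedDeriv 2 G α = 2 * K ∧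
      G β = 0 ∧ iteratedDeriv 2 G β = 2 * K' ∧ ∀ x, |G x| ≤ δ := by
  obtain ⟨A, hA, hsA, hA0, hA2, hAδ⟩ := exists_small_bump K (Iio_mem_nhds hα) (half_pos hδ)
  obtain ⟨B, hB, hsB, hB0, hB2, hBδ⟩ := exists_small_bump K' (Ioi_mem_nhds hβ) (half_pos hδ)
  have offA {x : ℝ} (hx : 0 ≤ x) : x ∉ tsupport A := fun hm => (hsA hm).not_ge hx
  have offB {x : ℝ} (hx : x ≤ 0) : x ∉ tsupport B := fun hm => (hsB hm).not_ge hx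
  have hAB (x : ℝ) : iteratedDeriv 2 (A + B) x = iteratedDeriv 2 A x + iteratedDeriv 2 B x :=
    iteratedDeriv_add hA.contDiffAt hB.contDiffAt
  refine ⟨A + B, hA.add hB, ?_, ?_, ?_, ?_, ?_, fun x => ?_⟩
  · filter_upwards [notMem_tsupport_iff_eventuallyEq.1 (offA le_rfl),
      notMem_tsupport_iff_eventuallyEq.1 (offB le_rfl)] with x hxA hxB
    rw [Pi.add_apply, hxA, hxB, Pi.zero_apply, add_zero]
  · rw [Pi.add_apply, hA0, image_eq_zero_of_notMem_tsupport (offB hα.le), add_zero]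
  · rw [hAB, hA2, iteratedDeriv_eq_zero_of_notMem_tsupport 2 (offB hα.le), add_zero]
  · rw [Pi.add_apply, hB0, image_eq_zero_of_notMem_tsupport (offA hβ.le), add_zero]
  · rw [hAB, hB2, iteratedDeriv_eq_zero_of_notMem_tsupport 2 (offA hβ.le), zero_add]
  · exact (abs_add_le _ _).trans ((add_le_add (hAδ x) (hBδ x)).trans (add_halves δ).le)

/-- The profile of the image under the operator of the mode with profile `H ∘ ũ` and frequency
`k`. -/
def imageProfile (lam : ℝ → ℝ) (k : ℤ) (H : ℝ → ℝ) (y : ℝ) : ℝ :=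
  iteratedDeriv 2 H (uTilde lam y) / 2 - (k : ℝ) ^ 2 / lamTilde lam y ^ 2 * H (uTilde lam y)

theorem continuousAt_imageProfile (h : IsFriction lam) (k : ℤ) {H : ℝ → ℝ} (hH : ContDiff ℝ 2 H)
    {y : ℝ} (hy : y ≠ 0) : ContinuousAt (imageProfile lam k H) y := by
  have hH2 : Continuous (iteratedDeriv 2 H) := hH.continuous_iteratedDeriv 2 le_rfl
  have hcoef := (h.continuousOn_sq_div_sq k).continuousAt (isOpen_ne.mem_nhds hy)
  exact ((hH2.comp h.continuous_uTilde).continuousAt.div_const 2).sub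
    (hcoef.mul (hH.continuous.comp h.continuous_uTilde).continuousAt)

theorem exists_tendsto_imageProfile (h : IsFriction lam) {k : ℤ} {H : ℝ → ℝ}
    (hH : ContDiff ℝ 2 H) (h0 : k = 0 ∨ H =ᶠ[𝓝 0] 0) :
    ∃ l, Tendsto (imageProfile lam k H) (𝓝 0) (𝓝 l) ∧ (k ≠ 0 → l = 0) := by
  rcases h0 with rfl | h0
  · have hH2 : Continuous (iteratedDeriv 2 H) := hH.continuous_iteratedDeriv 2 le_rfl
    have heq : imageProfile lam 0 H = fun y => iteratedDeriv 2 H (uTilde lam y) / 2 := by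
      ext y
      simp [imageProfile]
    exact ⟨_, heq ▸ ((hH2.comp h.continuous_uTilde).div_const 2).tendsto 0,
      fun hk => absurd rfl hk⟩
  · refine ⟨0, tendsto_const_nhds.congr' ?_, fun _ => rfl⟩
    filter_upwards [h.tendsto_uTilde_zero.eventually h0.eventually_nhds] with y hy
    have hderiv : iteratedDeriv 2 H (uTilde lam y) = 0 :=
      iteratedDeriv_eq_zero_of_notMem_tsupport 2 (notMem_tsupport_iff_eventuallyEq.2 hy)
    rw [imageProfile, hderiv, hy.self_of_nhds, Pi.zero_apply, mul_zero, zero_div, sub_zero]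

theorem isProfile_comp (h : IsFriction lam) (ha : a < 0) (hb : 0 < b) {H : ℝ → ℝ} {k : ℤ}
    (hH : ContDiff ℝ 2 H) (h0 : k = 0 ∨ H =ᶠ[𝓝 0] 0) (hla : imageProfile lam k H a = 0)
    (hlb : imageProfile lam k H b = 0) :
    IsProfile a b lam k (fun y => H (uTilde lam y)) (fun y => deriv H (uTilde lam y))
      (fun y => iteratedDeriv 2 H (uTilde lam y)) (imageProfile lam k H) where
  deriv_g y _ := ((hH.differentiable two_ne_zero) _).hasDerivAt.comp y (h.hasDerivAt_uTilde y)
  deriv_p y _ := by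
    rw [iteratedDeriv_succ, iteratedDeriv_one]
    exact (hH.differentiable_deriv_two _).hasDerivAt.comp y (h.hasDerivAt_uTilde y)
  cont_r := ((hH.continuous_iteratedDeriv 2 le_rfl).comp h.continuous_uTilde).continuousOn
  eq_s _ _ := rfl
  lim_p := by
    have hp : Tendsto (fun y => deriv H (uTilde lam y)) (𝓝 0) (𝓝 (deriv H (uTilde lam 0))) :=
      (hH.differentiable_deriv_two.continuous.comp h.continuous_uTilde).tendsto 0
    exact ⟨_, _, hp.mono_left nhdsWithin_le_nhds, hp.mono_left nhdsWithin_le_nhds, fun _ => rfl⟩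
  lim_s := by
    obtain ⟨l, hl, hl0⟩ := exists_tendsto_imageProfile h hH h0
    exact ⟨l, hl.mono_left nhdsWithin_le_nhds, hl0⟩
  lim_left := hla ▸ (continuousAt_imageProfile h k hH ha.ne).tendsto.mono_left nhdsWithin_le_nhds
  lim_right :=
    hlb ▸ (continuousAt_imageProfile h k hH hb.ne').tendsto.mono_left nhdsWithin_le_nhds

/-- Modes whose profile is a `C²` function of `ũ` that vanishes near the centre unless the mode
is rotationally symmetric. Their span is an algebra to which Stone–Weierstrass applies. -/
def smoothModes (a b : ℝ) (lam : ℝ → ℝ) : Set C(Glued a b, ℝ) :=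
  {f | ∃ (H : ℝ → ℝ) (k : ℤ) (φ : ℝ), ContDiff ℝ 2 H ∧ (k = 0 ∨ H =ᶠ[𝓝 0] 0) ∧
    IsMode f (fun y => H (uTilde lam y)) k φ}

theorem exists_smoothMode (a b : ℝ) (h : IsFriction lam) {H : ℝ → ℝ} {k : ℤ} (φ : ℝ)
    (hH : ContDiff ℝ 2 H) (h0 : k = 0 ∨ H =ᶠ[𝓝 0] 0) :
    ∃ f ∈ smoothModes a b lam, IsMode f (fun y => H (uTilde lam y)) k φ := by
  have h00 : k = 0 ∨ H (uTilde lam 0) = 0 :=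
    h0.imp_right fun h0 => by rw [uTilde_zero, h0.self_of_nhds, Pi.zero_apply]
  obtain ⟨f, hf⟩ := exists_isMode (hH.continuous.comp h.continuous_uTilde).continuousOn k φ h00
  exact ⟨f, ⟨H, k, φ, hH, h0, hf⟩, hf⟩

theorem isMode_one {H : ℝ → ℝ} (hH : ∀ y, H y = 1) :
    IsMode (1 : C(Glued a b, ℝ)) H 0 0 := fun θ y hy => by
  rw [coord_eq _ θ ⟨y, hy⟩]
  simp [hH y]

theorem IsMode.mul {f g m n : C(Glued a b, ℝ)} {H K : ℝ → ℝ} {k l : ℤ} {φ ψ : ℝ}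
    (hf : IsMode f H k φ) (hg : IsMode g K l ψ)
    (hm : IsMode m (fun y => H y * K y / 2) (k + l) (φ + ψ))
    (hn : IsMode n (fun y => H y * K y / 2) (k - l) (φ - ψ)) : f * g = m + n := by
  refine ext_coord fun θ y hy => ?_
  have hmul : coord (f * g) θ y = coord f θ y * coord g θ y := by
    simp only [coord_eq _ θ ⟨y, hy⟩, ContinuousMap.mul_apply]
  have hadd : coord (m + n) θ y = coord m θ y + coord n θ y := by
    simp only [coord_eq _ θ ⟨y, hy⟩, ContinuousMap.add_apply]
  have hsum : ((k + l : ℤ) : ℝ) * θ + (φ + ψ) = (k * θ + φ) + (l * θ + ψ) := by push_cast; ring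
  have hdiff : ((k - l : ℤ) : ℝ) * θ + (φ - ψ) = (k * θ + φ) - (l * θ + ψ) := by push_cast; ring
  rw [hmul, hadd, hf θ y hy, hg θ y hy, hm θ y hy, hn θ y hy, hsum, hdiff,
    Real.cos_add (k * θ + φ), Real.cos_sub (k * θ + φ)]
  ring

theorem smoothModes_mul (h : IsFriction lam) {f g : C(Glued a b, ℝ)}
    (hf : f ∈ smoothModes a b lam) (hg : g ∈ smoothModes a b lam) :
    f * g ∈ Submodule.span ℝ (smoothModes a b lam) := by
  obtain ⟨H, k, φ, hH, hH0, hf⟩ := hf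
  obtain ⟨K, l, ψ, hK, hK0, hg⟩ := hg
  have hHK : ContDiff ℝ 2 fun x => H x * K x / 2 := (hH.mul hK).div_const 2
  have h0 : (k = 0 ∧ l = 0) ∨ (fun x => H x * K x / 2) =ᶠ[𝓝 0] 0 := by
    rcases hH0 with hk | hH0
    · refine hK0.imp (⟨hk, ·⟩) fun hK0 => ?_
      filter_upwards [hK0] with x hx using by simp [hx]
    · right
      filter_upwards [hH0] with x hx using by simp [hx]
  obtain ⟨m, hm, hm'⟩ := exists_smoothMode a b h (k := k + l) (φ + ψ) hHK
    (h0.imp_left fun hkl => by omega)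
  obtain ⟨n, hn, hn'⟩ := exists_smoothMode a b h (k := k - l) (φ - ψ) hHK
    (h0.imp_left fun hkl => by omega)
  rw [hf.mul hg hm' hn']
  exact Submodule.add_mem _ (Submodule.subset_span hm) (Submodule.subset_span hn)

theorem one_mem_smoothModes : (1 : C(Glued a b, ℝ)) ∈ smoothModes a b lam :=
  ⟨fun _ => 1, 0, 0, contDiff_const, Or.inl rfl, isMode_one fun _ => rfl⟩

/-- The algebra spanned by the smooth modes. -/
def smoothModesAlgebra (a b : ℝ) (h : IsFriction lam) : Subalgebra ℝ C(Glued a b, ℝ) :=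
  (Submodule.span ℝ (smoothModes a b lam)).toSubalgebra
    (Submodule.subset_span one_mem_smoothModes) fun f g hf hg => by
      have hfg := Submodule.mul_mem_mul hf hg
      rw [Submodule.span_mul_span] at hfg
      refine Submodule.span_le.2 ?_ hfg
      rintro _ ⟨f, hf, g, hg, rfl⟩
      exact smoothModes_mul h hf hg

theorem exists_bump_eventuallyEq_zero {c : ℝ} (hc : c ≠ 0) :
    ∃ χ : ℝ → ℝ, ContDiff ℝ 2 χ ∧ χ c = 1 ∧ χ =ᶠ[𝓝 0] 0 := by
  obtain ⟨χ, hsupp, -, hχ, -, hχc⟩ :=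
    exists_contDiff_tsupport_subset (n := 2) (isOpen_ne.mem_nhds hc)
  exact ⟨χ, hχ, hχc, notMem_tsupport_iff_eventuallyEq.1 fun h0 => hsupp h0 rfl⟩

theorem addCircle_coe_eq_of_cos_sin {θ θ' : ℝ} (hcos : Real.cos θ = Real.cos θ')
    (hsin : Real.sin θ = Real.sin θ') : (θ : AddCircle (2 * Real.pi)) = θ' :=
  Real.Angle.cos_sin_inj hcos hsin

theorem separatesPoints_smoothModesAlgebra (h : IsFriction lam) :
    (smoothModesAlgebra a b h).SeparatesPoints := by
  intro x x' hne
  obtain ⟨θ, y, rfl⟩ := exists_pt x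
  obtain ⟨θ', y', rfl⟩ := exists_pt x'
  have hinj := h.strictMono_uTilde.injective
  by_contra! hcon
  have heq {H : ℝ → ℝ} {k : ℤ} (φ : ℝ) (hH : ContDiff ℝ 2 H) (h0 : k = 0 ∨ H =ᶠ[𝓝 0] 0) :
      H (uTilde lam y) * Real.cos (k * θ + φ) = H (uTilde lam y') * Real.cos (k * θ' + φ) := by
    obtain ⟨f, hf, hf'⟩ := exists_smoothMode a b h φ hH h0
    rw [← hf' θ y y.2, ← hf' θ' y' y'.2, coord_eq, coord_eq]
    exact hcon _ ⟨f, Submodule.subset_span hf, rfl⟩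
  obtain rfl : y = y' := by
    have hu := heq (H := id) (k := 0) 0 contDiff_id (Or.inl rfl)
    simp only [Int.cast_zero, zero_mul, zero_add, Real.cos_zero, mul_one, id] at hu
    exact Subtype.ext (hinj hu)
  have hy0 : (y : ℝ) ≠ 0 := fun hy0 => hne (Quotient.sound (Or.inr ⟨hy0, hy0⟩))
  obtain ⟨χ, hχ, hχ1, hχ0⟩ :=
    exists_bump_eventuallyEq_zero fun h0 => hy0 (hinj (h0.trans uTilde_zero.symm))
  have hcos := heq (k := 1) 0 hχ (Or.inr hχ0)
  have hsin := heq (k := 1) (-(Real.pi / 2)) hχ (Or.inr hχ0)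
  simp only [hχ1, Int.cast_one, one_mul, add_zero, ← sub_eq_add_neg, Real.cos_sub_pi_div_two]
    at hcos hsin
  exact hne (congrArg (fun t => Quotient.mk (glueSetoid a b) (t, y))
    (addCircle_coe_eq_of_cos_sin hcos hsin))

theorem dense_span_smoothModes (h : IsFriction lam) :
    Dense (Submodule.span ℝ (smoothModes a b lam) : Set C(Glued a b, ℝ)) := by
  have htop := ContinuousMap.subalgebra_topologicalClosure_eq_top_of_separatesPoints _
    (separatesPoints_smoothModesAlgebra (a := a) (b := b) h)
  exact dense_iff_closure_eq.2 (congrArg SetLike.coe htop)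

theorem dense_of_smoothModes (h : IsFriction lam) {S : Submodule ℝ C(Glued a b, ℝ)}
    (hS : smoothModes a b lam ⊆ closure (S : Set C(Glued a b, ℝ))) :
    Dense (S : Set C(Glued a b, ℝ)) := by
  have hspan : Submodule.span ℝ (smoothModes a b lam) ≤ S.topologicalClosure :=
    Submodule.span_le.2 hS
  exact dense_closure.1 ((dense_span_smoothModes h).mono hspan)

theorem imageProfile_add_eq_zero {H G : ℝ → ℝ} (hH : ContDiff ℝ 2 H) (hG : ContDiff ℝ 2 G) {k : ℤ}
    {y : ℝ} (hG0 : G (uTilde lam y) = 0)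
    (hG2 : iteratedDeriv 2 G (uTilde lam y) = 2 * -imageProfile lam k H y) :
    imageProfile lam k (H + G) y = 0 := by
  rw [imageProfile, iteratedDeriv_add hH.contDiffAt hG.contDiffAt, Pi.add_apply, hG0, hG2,
    imageProfile]
  ring

theorem IsMode.dist_le {f F : C(Glued a b, ℝ)} {g G : ℝ → ℝ} {k : ℤ} {φ δ : ℝ}
    (hf : IsMode f g k φ) (hF : IsMode F G k φ) (hδ : 0 ≤ δ) (h : ∀ y, |g y - G y| ≤ δ) :
    dist f F ≤ δ := by
  refine (ContinuousMap.dist_le hδ).2 fun x => ?_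
  obtain ⟨θ, y, rfl⟩ := exists_pt x
  rw [← coord_eq, ← coord_eq, hf θ y y.2, hF θ y y.2, Real.dist_eq, ← sub_mul, abs_mul]
  exact (mul_le_of_le_one_right (abs_nonneg _) (Real.abs_cos_le_one _)).trans (h y)

theorem smoothModes_subset_closure_dom (h : IsFriction lam) (ha : a < 0) (hb : 0 < b) :
    smoothModes a b lam ⊆ closure (dom lam ha hb : Set C(Glued a b, ℝ)) := by
  rintro f ⟨H, k, φ, hH, h0, hf⟩
  refine Metric.mem_closure_iff.2 fun ε hε => ?_
  have hα : uTilde lam a < 0 := uTilde_zero.subst (h.strictMono_uTilde ha)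
  have hβ : 0 < uTilde lam b := uTilde_zero.subst (motive := (· < _)) (h.strictMono_uTilde hb)
  obtain ⟨G, hG, hG0, hGα, hG2α, hGβ, hG2β, hGε⟩ := exists_small_correction
    (-imageProfile lam k H a) (-imageProfile lam k H b) hα hβ (half_pos hε)
  have hHG0 : k = 0 ∨ H + G =ᶠ[𝓝 0] 0 :=
    h0.imp_right fun h0 => by simpa only [add_zero] using h0.add hG0
  obtain ⟨F, -, hF⟩ := exists_smoothMode a b h φ (hH.add hG) hHG0
  refine ⟨F, hF.memDom h (isProfile_comp h ha hb (hH.add hG) hHG0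
    (imageProfile_add_eq_zero hH hG hGα hG2α) (imageProfile_add_eq_zero hH hG hGβ hG2β)) ha hb,
    (hf.dist_le hF (half_pos hε).le fun y => ?_).trans_lt (half_lt_self hε)⟩
  simpa only [Pi.add_apply, sub_add_cancel_left, abs_neg] using hGε (uTilde lam y)

theorem dense_dom (h : IsFriction lam) (ha : a < 0) (hb : 0 < b) :
    Dense (dom lam ha hb : Set C(Glued a b, ℝ)) :=
  dense_of_smoothModes h (smoothModes_subset_closure_dom h ha hb)

theorem one_mem_graph (h : IsFriction lam) (ha : a < 0) (hb : 0 < b) :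
    ((1 : C(Glued a b, ℝ)), (0 : C(Glued a b, ℝ))) ∈ (opA lam ha hb).graph := by
  have himage (y : ℝ) : imageProfile lam 0 (fun _ => 1) y = 0 := by
    simp [imageProfile, iteratedDeriv_const]
  have hmode := isMode_one (a := a) (b := b) (H := fun _ => 1) fun _ => rfl
  have hprofile := isProfile_comp h ha hb contDiff_const (Or.inl rfl) (himage a) (himage b)
  have hmem : MemDom lam (1 : C(Glued a b, ℝ)) := hmode.memDom h hprofile ha hb
  refine (LinearPMap.mem_graph_iff _).2 ⟨⟨1, hmem⟩, rfl, ext_inner ha hb fun θ y hy => ?_⟩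
  change coord (ext ha hb hmem) θ y = _
  rw [coord_ext _ _ _ _ hy, hmode.expr_eq h hprofile θ hy, himage, zero_mul,
    coord_eq _ θ ⟨y, inner_subset hy⟩, ContinuousMap.zero_apply]

theorem dense_range_sub (h : IsFriction lam) (ha : a < 0) (hb : 0 < b) (μ : ℝ)
    (hμ : smoothModes a b lam ⊆
      range fun f : (opA lam ha hb).domain => μ • (f : C(Glued a b, ℝ)) - opA lam ha hb f) :
    Dense (range fun f : (opA lam ha hb).domain =>
      μ • (f : C(Glued a b, ℝ)) - opA lam ha hb f) :=
  dense_of_smoothModes h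
    (S := LinearMap.range (μ • (opA lam ha hb).domain.subtype - (opA lam ha hb).toFun))
    (hμ.trans subset_closure)

end Density

section LinearODE

open scoped BoundedContinuousFunction

variable {E : Type*} [NormedAddCommGroup E] [NormedSpace ℝ E] {A : ℝ → E →L[ℝ] E}

/-- Bielecki's weight for the equation `x' = A x`: measured relative to it, the Picard integral
operator contracts by the factor `1 / 2` on the whole half-line. -/
def bieleckiWeight (A : ℝ → E →L[ℝ] E) (t : ℝ) : ℝ :=
  Real.exp (2 * ∫ s in (0 : ℝ)..t, ‖A s‖)

theorem bieleckiWeight_pos (t : ℝ) : 0 < bieleckiWeight A t := Real.exp_pos _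

theorem bieleckiWeight_zero : bieleckiWeight A 0 = 1 := by simp [bieleckiWeight]

theorem one_le_bieleckiWeight {t : ℝ} (ht : 0 ≤ t) : 1 ≤ bieleckiWeight A t :=
  Real.one_le_exp (mul_nonneg zero_le_two
    (intervalIntegral.integral_nonneg ht fun _ _ => norm_nonneg _))

theorem hasDerivAt_bieleckiWeight (hA : Continuous A) (t : ℝ) :
    HasDerivAt (bieleckiWeight A) (2 * (‖A t‖ * bieleckiWeight A t)) t :=
  (((hA.norm.integral_hasStrictDerivAt 0 t).hasDerivAt.const_mul 2).exp).congr_deriv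
    (by simp only [bieleckiWeight]; ring)

theorem continuous_bieleckiWeight (hA : Continuous A) : Continuous (bieleckiWeight A) :=
  continuous_iff_continuousAt.2 fun t => (hasDerivAt_bieleckiWeight hA t).continuousAt

theorem integral_norm_mul_bieleckiWeight (hA : Continuous A) (t : ℝ) :
    ∫ s in (0 : ℝ)..t, ‖A s‖ * bieleckiWeight A s = (bieleckiWeight A t - 1) / 2 := by
  have hint := intervalIntegral.integral_eq_sub_of_hasDerivAt (a := 0) (b := t)
    (fun s _ => hasDerivAt_bieleckiWeight hA s) ((continuous_const.mul
      (hA.norm.mul (continuous_bieleckiWeight hA))).intervalIntegrable _ _)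
  rw [intervalIntegral.integral_const_mul, bieleckiWeight_zero] at hint
  linarith

/-- The Picard integral operator of `x' = A x`, `x 0 = x₀`, acting on the quotient
`ω = x / bieleckiWeight A`; negative times are truncated to `0`. -/
def weightedPicard (A : ℝ → E →L[ℝ] E) (x₀ : E) (ω : ℝ → E) (t : ℝ) : E :=
  (bieleckiWeight A (max t 0))⁻¹ •
    (x₀ + ∫ s in (0 : ℝ)..max t 0, A s (bieleckiWeight A s • ω s))

theorem continuous_apply_bieleckiWeight_smul (hA : Continuous A) {ω : ℝ → E} (hω : Continuous ω) :
    Continuous fun s => A s (bieleckiWeight A s • ω s) :=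
  hA.clm_apply ((continuous_bieleckiWeight hA).smul hω)

theorem continuous_weightedPicard (hA : Continuous A) (x₀ : E) {ω : ℝ → E} (hω : Continuous ω) :
    Continuous (weightedPicard A x₀ ω) := by
  have hmax : Continuous fun t : ℝ => max t 0 := by fun_prop
  have hint := intervalIntegral.continuous_primitive (μ := MeasureTheory.volume)
    (fun c d => (continuous_apply_bieleckiWeight_smul hA hω).intervalIntegrable c d) 0
  exact (((continuous_bieleckiWeight hA).comp hmax).inv₀ fun _ => (bieleckiWeight_pos _).ne').smul
    (continuous_const.add (hint.comp hmax))

theorem norm_weightedPicard_zero_le (x₀ : E) (t : ℝ) : ‖weightedPicard A x₀ 0 t‖ ≤ ‖x₀‖ := by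
  simp only [weightedPicard, Pi.zero_apply, smul_zero, map_zero, intervalIntegral.integral_zero,
    add_zero, norm_smul, norm_inv, Real.norm_of_nonneg (bieleckiWeight_pos _).le]
  exact mul_le_of_le_one_left (norm_nonneg _)
    (inv_le_one_of_one_le₀ (one_le_bieleckiWeight (le_max_right _ _)))

theorem norm_weightedPicard_sub_le (hA : Continuous A) (x₀ : E) {ω η : ℝ → E} (hω : Continuous ω)
    (hη : Continuous η) {C : ℝ} (hC : ∀ t, ‖ω t - η t‖ ≤ C) (t : ℝ) :
    ‖weightedPicard A x₀ ω t - weightedPicard A x₀ η t‖ ≤ C / 2 := by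
  have hC0 : 0 ≤ C := (norm_nonneg _).trans (hC 0)
  simp only [weightedPicard]
  generalize max t 0 = τ, le_max_right t 0 = hτ
  have hbound : ‖∫ s in (0 : ℝ)..τ,
      (A s (bieleckiWeight A s • ω s) - A s (bieleckiWeight A s • η s))‖
        ≤ ∫ s in (0 : ℝ)..τ, C * (‖A s‖ * bieleckiWeight A s) := by
    refine intervalIntegral.norm_integral_le_of_norm_le hτ (.of_forall fun s _ => ?_)
      ((continuous_const.mul
        (hA.norm.mul (continuous_bieleckiWeight hA))).intervalIntegrable _ _)
    calc ‖A s (bieleckiWeight A s • ω s) - A s (bieleckiWeight A s • η s)‖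
        ≤ ‖A s‖ * ‖bieleckiWeight A s • (ω s - η s)‖ := by
          rw [← map_sub, ← smul_sub]; exact (A s).le_opNorm _
      _ = ‖A s‖ * bieleckiWeight A s * ‖ω s - η s‖ := by
          rw [norm_smul, Real.norm_of_nonneg (bieleckiWeight_pos s).le, mul_assoc]
      _ ≤ ‖A s‖ * bieleckiWeight A s * C :=
          mul_le_mul_of_nonneg_left (hC s)
            (mul_nonneg (norm_nonneg _) (bieleckiWeight_pos s).le)
      _ = C * (‖A s‖ * bieleckiWeight A s) := mul_comm _ _
  rw [intervalIntegral.integral_const_mul, integral_norm_mul_bieleckiWeight hA,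
    intervalIntegral.integral_sub
      ((continuous_apply_bieleckiWeight_smul hA hω).intervalIntegrable _ _)
      ((continuous_apply_bieleckiWeight_smul hA hη).intervalIntegrable _ _)] at hbound
  rw [← smul_sub, add_sub_add_left_eq_sub, norm_smul, norm_inv,
    Real.norm_of_nonneg (bieleckiWeight_pos τ).le, inv_mul_le_iff₀ (bieleckiWeight_pos τ)]
  linarith

theorem exists_fixed_weightedPicard [CompleteSpace E] (hA : Continuous A) (x₀ : E) :
    ∃ ω : ℝ → E, Continuous ω ∧ weightedPicard A x₀ ω = ω := by
  have hbound (ω : ℝ →ᵇ E) (t : ℝ) : ‖weightedPicard A x₀ ω t‖ ≤ ‖x₀‖ + ‖ω‖ / 2 := by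
    have hsub := norm_weightedPicard_sub_le hA x₀ ω.continuous (η := 0) continuous_const
      (fun s => by simpa using ω.norm_coe_le_norm s) t
    linarith [norm_le_norm_sub_add (weightedPicard A x₀ ω t) (weightedPicard A x₀ 0 t),
      norm_weightedPicard_zero_le (A := A) x₀ t]
  let T : (ℝ →ᵇ E) → (ℝ →ᵇ E) := fun ω => BoundedContinuousFunction.ofNormedAddCommGroup
    (weightedPicard A x₀ ω) (continuous_weightedPicard hA x₀ ω.continuous) _ (hbound ω)
  have hT : ContractingWith (1 / 2) T := by
    refine ⟨by norm_num, LipschitzWith.of_dist_le_mul fun ω η => ?_⟩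
    rw [BoundedContinuousFunction.dist_le (by positivity)]
    intro t
    rw [NNReal.coe_div, NNReal.coe_one, NNReal.coe_ofNat, one_div_mul_eq_div, dist_eq_norm]
    exact norm_weightedPicard_sub_le hA x₀ ω.continuous η.continuous
      (fun s => dist_eq_norm (ω s) (η s) ▸ BoundedContinuousFunction.dist_coe_le_dist s) t
  exact ⟨⇑(hT.fixedPoint T), (hT.fixedPoint T).continuous,
    congrArg (⇑) hT.fixedPoint_isFixedPt.eq⟩

theorem exists_forward_solution [CompleteSpace E] (hA : Continuous A) (x₀ : E) :
    ∃ x : ℝ → E, Continuous x ∧ x 0 = x₀ ∧ ∀ t, 0 < t → HasDerivAt x (A t (x t)) t := by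
  obtain ⟨ω, hω, hfix⟩ := exists_fixed_weightedPicard hA x₀
  have hderiv (t : ℝ) : HasDerivAt
      (fun t => x₀ + ∫ s in (0 : ℝ)..t, A s (bieleckiWeight A s • ω s))
      (A t (bieleckiWeight A t • ω t)) t :=
    ((continuous_apply_bieleckiWeight_smul hA hω).integral_hasStrictDerivAt 0
      t).hasDerivAt.const_add x₀
  refine ⟨_, continuous_iff_continuousAt.2 fun t => (hderiv t).continuousAt, by simp,
    fun t ht => (hderiv t).congr_deriv (congrArg (A t) ?_)⟩
  have hωt := congrFun hfix t
  rw [weightedPicard, max_eq_left ht.le] at hωt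
  rw [← hωt, smul_inv_smul₀ (bieleckiWeight_pos t).ne']

end LinearODE

section FirstOrderSystems

/-- The pair `(g, p)` solves the first order system `g' = p w`, `p' = Q g - H` on `s`. For `Q = q w`
and `H = h w` this is `(d/du)² g = q g - h` with `du = w dy`. -/
structure IsSolutionOn (w Q H g p : ℝ → ℝ) (s : Set ℝ) : Prop where
  deriv_fst : ∀ y ∈ s, HasDerivAt g (p y * w y) y
  deriv_snd : ∀ y ∈ s, HasDerivAt p (Q y * g y - H y) y

namespace IsSolutionOn

variable {w Q H g p φ ρ : ℝ → ℝ} {s t : Set ℝ}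

theorem mono (h : IsSolutionOn w Q H g p t) (hst : s ⊆ t) : IsSolutionOn w Q H g p s :=
  ⟨fun y hy => h.deriv_fst y (hst hy), fun y hy => h.deriv_snd y (hst hy)⟩

theorem continuousOn_fst (h : IsSolutionOn w Q H g p s) : ContinuousOn g s :=
  HasDerivAt.continuousOn h.deriv_fst

theorem continuousOn_snd (h : IsSolutionOn w Q H g p s) : ContinuousOn p s :=
  HasDerivAt.continuousOn h.deriv_snd

theorem add_const_mul (h : IsSolutionOn w Q H g p s) (h₀ : IsSolutionOn w Q 0 φ ρ s) (C : ℝ) :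
    IsSolutionOn w Q H (fun y => g y + C * φ y) (fun y => p y + C * ρ y) s where
  deriv_fst y hy := ((h.deriv_fst y hy).add ((h₀.deriv_fst y hy).const_mul C)).congr_deriv (by ring)
  deriv_snd y hy := ((h.deriv_snd y hy).add ((h₀.deriv_snd y hy).const_mul C)).congr_deriv
    (by rw [Pi.zero_apply]; ring)

theorem antitoneOn_fst (h : IsSolutionOn w Q H g p s) (hs : Convex ℝ s) (hw : ∀ y ∈ s, 0 ≤ w y)
    (hp : ∀ y ∈ s, p y ≤ 0) : AntitoneOn g s :=
  antitoneOn_of_hasDerivWithinAt_nonpos hs h.continuousOn_fst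
    (fun y hy => (h.deriv_fst y (interior_subset hy)).hasDerivWithinAt)
    fun y hy => mul_nonpos_of_nonpos_of_nonneg (hp y (interior_subset hy))
      (hw y (interior_subset hy))

theorem monotoneOn_snd (h : IsSolutionOn w Q 0 g p s) (hs : Convex ℝ s) (hQ : ∀ y ∈ s, 0 ≤ Q y)
    (hg : ∀ y ∈ s, 0 ≤ g y) : MonotoneOn p s :=
  monotoneOn_of_hasDerivWithinAt_nonneg hs h.continuousOn_snd
    (fun y hy => (h.deriv_snd y (interior_subset hy)).hasDerivWithinAt) fun y hy => by
      rw [Pi.zero_apply, sub_zero]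
      exact mul_nonneg (hQ y (interior_subset hy)) (hg y (interior_subset hy))

variable {c : ℝ} (h : IsSolutionOn w Q 0 g p (Ioi c)) (hg : ContinuousOn g (Ici c))
  (hp : ContinuousOn p (Ici c)) (hw : ∀ y ∈ Ioi c, 0 ≤ w y) (hQ : ∀ y ∈ Ioi c, 0 ≤ Q y)
include h hg hp hw hQ

theorem monotoneOn_mul : MonotoneOn (fun y => g y * p y) (Ici c) := by
  refine monotoneOn_of_hasDerivWithinAt_nonneg (convex_Ici c) (hg.mul hp)
    (f' := fun y => w y * p y ^ 2 + Q y * g y ^ 2) (fun y hy => ?_) fun y hy => ?_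
  all_goals rw [interior_Ici] at hy
  · refine (((h.deriv_fst y hy).mul (h.deriv_snd y hy)).congr_deriv ?_).hasDerivWithinAt
    rw [Pi.zero_apply]
    ring
  · exact add_nonneg (mul_nonneg (hw y hy) (sq_nonneg _)) (mul_nonneg (hQ y hy) (sq_nonneg _))

theorem monotoneOn_sq (hc : 0 ≤ g c * p c) : MonotoneOn (fun y => g y ^ 2) (Ici c) := by
  refine monotoneOn_of_hasDerivWithinAt_nonneg (convex_Ici c) (hg.pow 2)
    (f' := fun y => 2 * (w y * (g y * p y))) (fun y hy => ?_) fun y hy => ?_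
  all_goals rw [interior_Ici] at hy
  · exact (((h.deriv_fst y hy).pow 2).congr_deriv (by norm_num; ring)).hasDerivWithinAt
  · exact mul_nonneg zero_le_two (mul_nonneg (hw y hy) (hc.trans
      (h.monotoneOn_mul hg hp hw hQ self_mem_Ici (mem_Ici_of_Ioi hy) (le_of_lt hy))))

theorem le_fst_and_nonneg_snd (hgc : 0 < g c) (hpc : 0 ≤ p c) {y : ℝ} (hy : c ≤ y) :
    g c ≤ g y ∧ 0 ≤ p y := by
  have hsq {z : ℝ} (hz : c ≤ z) : g c ^ 2 ≤ g z ^ 2 :=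
    h.monotoneOn_sq hg hp hw hQ (mul_nonneg hgc.le hpc) self_mem_Ici hz hz
  have hpos : 0 < g y := by
    by_contra! hneg
    obtain ⟨z, hz, hz0⟩ := intermediate_value_Icc' hy (hg.mono Icc_subset_Ici_self) ⟨hneg, hgc.le⟩
    exact (hsq hz.1).not_gt (by rw [hz0, zero_pow two_ne_zero]; exact pow_pos hgc 2)
  refine ⟨(sq_le_sq₀ hgc.le hpos.le).1 (hsq hy), nonneg_of_mul_nonneg_right ?_ hpos⟩
  exact (mul_nonneg hgc.le hpc).trans (h.monotoneOn_mul hg hp hw hQ self_mem_Ici hy hy)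

end IsSolutionOn

theorem exists_positive_solution {w Q : ℝ → ℝ} (hw : Continuous w) (hQ : Continuous Q)
    (hw0 : ∀ t, 0 ≤ w t) (hQ0 : ∀ t, 0 ≤ Q t) : ∃ g p : ℝ → ℝ, IsSolutionOn w Q 0 g p (Ioi 0) ∧
      ∀ t, 0 ≤ t → 1 ≤ g t ∧ 0 ≤ p t := by
  let M : ℝ × ℝ →L[ℝ] ℝ × ℝ := .inl ℝ ℝ ℝ ∘L .snd ℝ ℝ ℝ
  let N : ℝ × ℝ →L[ℝ] ℝ × ℝ := .inr ℝ ℝ ℝ ∘L .fst ℝ ℝ ℝ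
  obtain ⟨x, hx, hx0, hderiv⟩ := exists_forward_solution (A := fun t => w t • M + Q t • N)
    (by fun_prop) (1, 0)
  have hsol : IsSolutionOn w Q 0 (fun t => (x t).1) (fun t => (x t).2) (Ioi 0) :=
    ⟨fun t ht => ((ContinuousLinearMap.fst ℝ ℝ ℝ).hasFDerivAt.comp_hasDerivAt t
      (hderiv t ht)).congr_deriv (by simp [M, N, mul_comm]),
    fun t ht => ((ContinuousLinearMap.snd ℝ ℝ ℝ).hasFDerivAt.comp_hasDerivAt t
      (hderiv t ht)).congr_deriv (by simp [M, N])⟩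
  refine ⟨_, _, hsol, fun t ht => ?_⟩
  simpa [hx0] using hsol.le_fst_and_nonneg_snd hx.fst.continuousOn hx.snd.continuousOn
    (fun t _ => hw0 t) (fun t _ => hQ0 t) (by simp [hx0]) (by simp [hx0]) ht

/-- The substitution `y = d exp (-t)` carries a solution on `(0, ∞)` to one on `(0, d)`. -/
theorem IsSolutionOn.comp_log {w Q g p : ℝ → ℝ} {d : ℝ} (hd : 0 < d)
    (h : IsSolutionOn (fun t => d * Real.exp (-t) * w (d * Real.exp (-t)))
      (fun t => d * Real.exp (-t) * Q (d * Real.exp (-t))) 0 g p (Ioi 0)) :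
    IsSolutionOn w Q 0 (fun y => g (Real.log (d / y))) (fun y => -p (Real.log (d / y)))
      (Ioo 0 d) := by
  have hlog {y : ℝ} (hy : y ∈ Ioo 0 d) : 0 < Real.log (d / y) :=
    Real.log_pos ((one_lt_div hy.1).2 hy.2)
  have hexp {y : ℝ} (hy : y ∈ Ioo 0 d) : d * Real.exp (-Real.log (d / y)) = y := by
    rw [Real.exp_neg, Real.exp_log (div_pos hd hy.1), inv_div, mul_div_cancel₀ _ hd.ne']
  have hderiv {y : ℝ} (hy : y ∈ Ioo 0 d) : HasDerivAt (fun y => Real.log (d / y)) (-y⁻¹) y := by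
    refine ((Real.hasDerivAt_log hy.1.ne').const_sub (Real.log d)).congr_of_eventuallyEq ?_
    filter_upwards [isOpen_Ioo.mem_nhds hy] with z hz using Real.log_div hd.ne' hz.1.ne'
  constructor
  · refine fun y hy => ((h.deriv_fst _ (hlog hy)).comp y (hderiv hy)).congr_deriv ?_
    have hy0 := hy.1.ne'
    rw [hexp hy]
    field_simp
  · refine fun y hy => ((h.deriv_snd _ (hlog hy)).comp y (hderiv hy)).neg.congr_deriv ?_
    have hy0 := hy.1.ne'
    rw [hexp hy, Pi.zero_apply, Pi.zero_apply]
    field_simp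
    ring

theorem exists_decreasing_solution {w Q : ℝ → ℝ} (hw : ContinuousOn w (Ioi 0))
    (hQ : ContinuousOn Q (Ioi 0)) (hw0 : ∀ y, 0 < y → 0 ≤ w y) (hQ0 : ∀ y, 0 < y → 0 ≤ Q y)
    {d : ℝ} (hd : 0 < d) : ∃ ψ π : ℝ → ℝ, IsSolutionOn w Q 0 ψ π (Ioo 0 d) ∧
      ∀ y ∈ Ioo 0 d, 1 ≤ ψ y ∧ π y ≤ 0 := by
  have hpos (t : ℝ) : 0 < d * Real.exp (-t) := mul_pos hd (Real.exp_pos _)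
  have hexp : Continuous fun t => d * Real.exp (-t) := by fun_prop
  obtain ⟨g, p, hgp, hsign⟩ := exists_positive_solution
    (hexp.mul (hw.comp_continuous hexp hpos)) (hexp.mul (hQ.comp_continuous hexp hpos))
    (fun t => mul_nonneg (hpos t).le (hw0 _ (hpos t)))
    (fun t => mul_nonneg (hpos t).le (hQ0 _ (hpos t)))
  refine ⟨_, _, hgp.comp_log hd, fun y hy => ?_⟩
  have hlog : 0 ≤ Real.log (d / y) := Real.log_nonneg ((one_le_div hy.1).2 hy.2.le)
  exact ⟨(hsign _ hlog).1, neg_nonpos.2 (hsign _ hlog).2⟩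

end FirstOrderSystems

section VariationOfParameters

variable {w Q φ ρ ψ π : ℝ → ℝ}

/-- Two solutions of the homogeneous system on `s` with constant Wronskian `W`. -/
structure IsFundamentalSystem (w Q φ ρ ψ π : ℝ → ℝ) (s : Set ℝ) (W : ℝ) : Prop where
  fst : IsSolutionOn w Q 0 φ ρ s
  snd : IsSolutionOn w Q 0 ψ π s
  wronskian : ∀ y ∈ s, ρ y * ψ y - π y * φ y = W

theorem hasDerivAt_integral_of_continuousOn {F : ℝ → ℝ} {s : Set ℝ} (hs : IsOpen s)
    (hc : s.OrdConnected) (hF : ContinuousOn F s) {x₀ y : ℝ} (hx : x₀ ∈ s) (hy : y ∈ s) :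
    HasDerivAt (fun y => ∫ t in x₀..y, F t) (F y) y :=
  intervalIntegral.integral_hasDerivAt_right
    (hF.mono (hc.uIcc_subset hx hy)).intervalIntegrable
    (hF.stronglyMeasurableAtFilter hs y hy) (hF.continuousAt (hs.mem_nhds hy))

theorem IsFundamentalSystem.exists_particular {H : ℝ → ℝ} {s : Set ℝ} {W x₀ : ℝ}
    (h : IsFundamentalSystem w Q φ ρ ψ π s W) (hW : W ≠ 0) (hs : IsOpen s) (hc : s.OrdConnected)
    (hH : ContinuousOn H s) (hx₀ : x₀ ∈ s) : ∃ g p : ℝ → ℝ, IsSolutionOn w Q H g p s ∧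
      ∀ y, (∀ t ∈ uIoc x₀ y, H t = 0) → g y = 0 ∧ p y = 0 := by
  let U : ℝ → ℝ := fun y => ∫ t in x₀..y, -(H t * ψ t / W)
  let V : ℝ → ℝ := fun y => ∫ t in x₀..y, H t * φ t / W
  have hU (y : ℝ) (hy : y ∈ s) : HasDerivAt U (-(H y * ψ y / W)) y :=
    hasDerivAt_integral_of_continuousOn hs hc
      ((hH.mul h.snd.continuousOn_fst).div_const W).neg hx₀ hy
  have hV (y : ℝ) (hy : y ∈ s) : HasDerivAt V (H y * φ y / W) y :=
    hasDerivAt_integral_of_continuousOn hs hc ((hH.mul h.fst.continuousOn_fst).div_const W) hx₀ hy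
  refine ⟨fun y => φ y * U y + ψ y * V y, fun y => ρ y * U y + π y * V y,
    ⟨fun y hy => ?_, fun y hy => ?_⟩, fun y hy => ?_⟩
  · refine (((h.fst.deriv_fst y hy).mul (hU y hy)).add
      ((h.snd.deriv_fst y hy).mul (hV y hy))).congr_deriv ?_
    ring
  · refine (((h.fst.deriv_snd y hy).mul (hU y hy)).add
      ((h.snd.deriv_snd y hy).mul (hV y hy))).congr_deriv ?_
    have hwr := h.wronskian y hy
    rw [Pi.zero_apply]
    field_simp
    linear_combination -H y * hwr
  · have hU0 : U y = 0 := intervalIntegral.integral_zero_ae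
      (.of_forall fun t ht => by rw [hy t ht, zero_mul, zero_div, neg_zero])
    have hV0 : V y = 0 := intervalIntegral.integral_zero_ae
      (.of_forall fun t ht => by rw [hy t ht, zero_mul, zero_div])
    simp only [hU0, hV0, mul_zero, add_zero, and_self]

theorem isFundamentalSystem_of_reduction {J : ℝ → ℝ} {s : Set ℝ}
    (hψ : IsSolutionOn w Q 0 ψ π s) (hne : ∀ y ∈ s, ψ y ≠ 0)
    (hJ : ∀ y ∈ s, HasDerivAt J (w y / ψ y ^ 2) y) :
    IsFundamentalSystem w Q (fun y => ψ y * J y) (fun y => π y * J y + (ψ y)⁻¹) ψ π s 1 where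
  fst := ⟨fun y hy => ((hψ.deriv_fst y hy).mul (hJ y hy)).congr_deriv (by
      have := hne y hy
      field_simp),
    fun y hy => (((hψ.deriv_snd y hy).mul (hJ y hy)).add
      ((hψ.deriv_fst y hy).inv (hne y hy))).congr_deriv (by
        have := hne y hy
        rw [Pi.zero_apply]
        field_simp
        ring)⟩
  snd := hψ
  wronskian y hy := by
    have := hne y hy
    field_simp
    ring

end VariationOfParameters

section SingularFundamentalSystem

variable {w Q φ ρ ψ π : ℝ → ℝ} {d : ℝ}

theorem intervalIntegrable_div_sq (hw : Continuous w) (hψ : ContinuousOn ψ (Ioo 0 d))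
    (hψ1 : ∀ y ∈ Ioo 0 d, 1 ≤ ψ y) {y : ℝ} (hy : y ∈ Ioo 0 d) :
    IntervalIntegrable (fun t => w t / ψ t ^ 2) MeasureTheory.volume 0 y := by
  have hsub {t : ℝ} (ht : t ∈ uIoc 0 y) : t ∈ Ioo 0 d := by
    rw [uIoc_of_le hy.1.le] at ht
    exact ⟨ht.1, ht.2.trans_lt hy.2⟩
  have hcont : ContinuousOn (fun t => w t / ψ t ^ 2) (uIoc 0 y) :=
    (hw.continuousOn.div (hψ.pow 2) fun t ht =>
      pow_ne_zero 2 (zero_lt_one.trans_le (hψ1 t ht)).ne').mono fun t => hsub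
  refine (hw.intervalIntegrable 0 y).mono_fun
    (hcont.aestronglyMeasurable measurableSet_uIoc) ?_
  refine (MeasureTheory.ae_restrict_iff' measurableSet_uIoc).2 (.of_forall fun t ht => ?_)
  beta_reduce
  rw [norm_div, norm_pow]
  exact div_le_self (norm_nonneg _)
    (one_le_pow₀ ((hψ1 t (hsub ht)).trans (Real.le_norm_self _)))

theorem mul_integral_div_sq_le (hw : Continuous w) (hw0 : ∀ y ∈ Ioo 0 d, 0 ≤ w y)
    (hψ : ContinuousOn ψ (Ioo 0 d)) (hanti : AntitoneOn ψ (Ioo 0 d))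
    (hψ1 : ∀ y ∈ Ioo 0 d, 1 ≤ ψ y) {y : ℝ} (hy : y ∈ Ioo 0 d) :
    ψ y * ∫ t in (0 : ℝ)..y, w t / ψ t ^ 2 ≤ ∫ t in (0 : ℝ)..y, w t := by
  rw [← intervalIntegral.integral_const_mul]
  refine intervalIntegral.integral_mono_on_of_le_Ioo hy.1.le
    ((intervalIntegrable_div_sq hw hψ hψ1 hy).const_mul _) (hw.intervalIntegrable _ _)
    fun t ht => ?_
  have htd : t ∈ Ioo 0 d := ⟨ht.1, ht.2.trans hy.2⟩
  have hψt := hψ1 t htd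
  have hle : ψ y ≤ ψ t ^ 2 := (hanti htd hy ht.2.le).trans (le_self_pow₀ hψt two_ne_zero)
  rw [mul_div_assoc', div_le_iff₀ (by positivity), mul_comm]
  exact mul_le_mul_of_nonneg_left hle (hw0 t htd)

/-- Otherwise `φ` would be decreasing near `0` and hence nonpositive. -/
theorem IsSolutionOn.nonneg_snd_of_tendsto_zero (h : IsSolutionOn w Q 0 φ ρ (Ioo 0 d))
    (hw : ∀ y ∈ Ioo 0 d, 0 ≤ w y) (hρ : MonotoneOn ρ (Ioo 0 d)) (hφ : ∀ y ∈ Ioo 0 d, 0 < φ y)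
    (hφ0 : Tendsto φ (𝓝[>] 0) (𝓝 0)) {y : ℝ} (hy : y ∈ Ioo 0 d) : 0 ≤ ρ y := by
  by_contra! hneg
  have hsub : Ioc 0 y ⊆ Ioo 0 d := fun z hz => ⟨hz.1, hz.2.trans_lt hy.2⟩
  have hanti : AntitoneOn φ (Ioc 0 y) := (h.mono hsub).antitoneOn_fst (convex_Ioc 0 y)
    (fun z hz => hw z (hsub hz)) fun z hz => (hρ (hsub hz) hy hz.2).trans hneg.le
  refine (hφ y hy).not_ge (ge_of_tendsto hφ0 ?_)
  filter_upwards [Ioo_mem_nhdsGT hy.1] with z hz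
  exact hanti (Ioo_subset_Ioc_self hz) (right_mem_Ioc.2 hy.1) hz.2.le

theorem IsSolutionOn.exists_tendsto_snd (h : IsSolutionOn w Q 0 φ ρ (Ioo 0 d)) (hd : 0 < d)
    (hw : ∀ y ∈ Ioo 0 d, 0 ≤ w y) (hQ : ∀ y ∈ Ioo 0 d, 0 ≤ Q y) (hφ : ∀ y ∈ Ioo 0 d, 0 < φ y)
    (hφ0 : Tendsto φ (𝓝[>] 0) (𝓝 0)) : ∃ l, Tendsto ρ (𝓝[>] 0) (𝓝 l) := by
  have hρ := h.monotoneOn_snd (convex_Ioo 0 d) hQ fun y hy => (hφ y hy).le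
  refine ⟨_, hρ.tendsto_nhdsWithin_Ioo_right (nonempty_Ioo.2 hd) ⟨0, ?_⟩⟩
  rintro _ ⟨y, hy, rfl⟩
  exact h.nonneg_snd_of_tendsto_zero hw hρ hφ hφ0 hy

/-- The solution `φ` that vanishes at the singular endpoint is obtained from a decreasing solution
by reduction of order. -/
theorem exists_isFundamentalSystem (hw : Continuous w) (hQ : ContinuousOn Q (Ioi 0))
    (hw0 : ∀ y, 0 < y → 0 < w y) (hQ0 : ∀ y, 0 < y → 0 ≤ Q y) (hd : 0 < d) :
    ∃ φ ρ ψ π : ℝ → ℝ, IsFundamentalSystem w Q φ ρ ψ π (Ioo 0 d) 1 ∧ (∀ y ∈ Ioo 0 d, 0 < φ y) ∧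
      Tendsto φ (𝓝[>] 0) (𝓝 0) ∧ ∃ l, Tendsto ρ (𝓝[>] 0) (𝓝 l) := by
  obtain ⟨ψ, π, hψπ, hsign⟩ := exists_decreasing_solution hw.continuousOn hQ
    (fun y hy => (hw0 y hy).le) hQ0 hd
  have hψ1 (y : ℝ) (hy : y ∈ Ioo 0 d) : 1 ≤ ψ y := (hsign y hy).1
  have hψpos (y : ℝ) (hy : y ∈ Ioo 0 d) : 0 < ψ y := zero_lt_one.trans_le (hψ1 y hy)
  have hw0' (y : ℝ) (hy : y ∈ Ioo 0 d) : 0 ≤ w y := (hw0 y hy.1).le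
  have hint (y : ℝ) (hy : y ∈ Ioo 0 d) :=
    intervalIntegrable_div_sq hw hψπ.continuousOn_fst hψ1 hy
  have hcont : ContinuousOn (fun t => w t / ψ t ^ 2) (Ioo 0 d) :=
    hw.continuousOn.div (hψπ.continuousOn_fst.pow 2) fun t ht => pow_ne_zero 2 (hψpos t ht).ne'
  have hsystem := isFundamentalSystem_of_reduction hψπ (fun y hy => (hψpos y hy).ne')
    fun y hy => intervalIntegral.integral_hasDerivAt_right (hint y hy)
      (hcont.stronglyMeasurableAtFilter isOpen_Ioo y hy)
      (hcont.continuousAt (isOpen_Ioo.mem_nhds hy))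
  have hφpos (y : ℝ) (hy : y ∈ Ioo 0 d) : 0 < ψ y * ∫ t in (0 : ℝ)..y, w t / ψ t ^ 2 :=
    mul_pos (hψpos y hy) (intervalIntegral.intervalIntegral_pos_of_pos_on (hint y hy)
      (fun t ht => div_pos (hw0 t ht.1) (pow_pos (hψpos t ⟨ht.1, ht.2.trans hy.2⟩) 2)) hy.1)
  have hφ0 : Tendsto (fun y => ψ y * ∫ t in (0 : ℝ)..y, w t / ψ t ^ 2) (𝓝[>] 0) (𝓝 0) := by
    have hprim := (hw.integral_hasStrictDerivAt 0 0).hasDerivAt.continuousAt.tendsto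
    rw [intervalIntegral.integral_same] at hprim
    refine squeeze_zero' ?_ ?_ (hprim.mono_left nhdsWithin_le_nhds)
    · filter_upwards [Ioo_mem_nhdsGT hd] with y hy using (hφpos y hy).le
    · filter_upwards [Ioo_mem_nhdsGT hd] with y hy
      exact mul_integral_div_sq_le hw hw0' hψπ.continuousOn_fst
        (hψπ.antitoneOn_fst (convex_Ioo 0 d) hw0' fun y hy => (hsign y hy).2) hψ1 hy
  exact ⟨_, _, ψ, π, hsystem, hφpos, hφ0,
    hsystem.fst.exists_tendsto_snd hd hw0' (fun y hy => hQ0 y hy.1) hφpos hφ0⟩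

end SingularFundamentalSystem

section SingularBoundaryValueProblem

variable {w Q H g p g₁ p₁ : ℝ → ℝ}

theorem exists_solution_Ioc (hw : Continuous w) (hQ : ContinuousOn Q (Ioi 0))
    (hH : ContinuousOn H (Ioi 0)) (hw0 : ∀ y, 0 < y → 0 < w y) (hQ0 : ∀ y, 0 < y → 0 ≤ Q y)
    (hH0 : H =ᶠ[𝓝[>] 0] 0) {c : ℝ} (hc : 0 < c) (β : ℝ) : ∃ (g p : ℝ → ℝ) (l : ℝ),
    IsSolutionOn w Q H g p (Ioc 0 c) ∧ Tendsto g (𝓝[>] 0) (𝓝 0) ∧ Tendsto p (𝓝[>] 0) (𝓝 l) ∧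
      g c = β := by
  have hcd : Ioc 0 c ⊆ Ioo 0 (c + 1) := fun y hy => ⟨hy.1, hy.2.trans_lt (lt_add_one c)⟩
  obtain ⟨φ, ρ, ψ, π, hsystem, hφpos, hφ0, l, hρ⟩ :=
    exists_isFundamentalSystem hw hQ hw0 hQ0 (hc.trans (lt_add_one c))
  obtain ⟨x, hx, hHx⟩ := mem_nhdsGT_iff_exists_Ioc_subset.1 (hH0.and (Ioc_mem_nhdsGT hc))
  have hxc : x ∈ Ioc 0 c := (hHx (right_mem_Ioc.2 hx)).2
  obtain ⟨g, p, hgp, hzero⟩ := hsystem.exists_particular one_ne_zero isOpen_Ioo ordConnected_Ioo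
    (hH.mono Ioo_subset_Ioi_self) (hcd hxc)
  have hnear : ∀ᶠ y in 𝓝[>] (0 : ℝ), g y = 0 ∧ p y = 0 := by
    filter_upwards [Ioc_mem_nhdsGT hxc.1] with y hy
    refine hzero y fun t ht => ?_
    rw [uIoc_of_ge hy.2] at ht
    exact (hHx ⟨hy.1.trans ht.1, ht.2⟩).1
  refine ⟨_, _, l * ((β - g c) / φ c),
    (hgp.add_const_mul hsystem.fst ((β - g c) / φ c)).mono hcd, ?_, ?_, ?_⟩
  · refine (mul_zero ((β - g c) / φ c) ▸ hφ0.const_mul _).congr' ?_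
    filter_upwards [hnear] with y hy using by rw [hy.1, zero_add]
  · rw [mul_comm]
    refine (hρ.const_mul _).congr' ?_
    filter_upwards [hnear] with y hy using by rw [hy.2, zero_add]
  · rw [div_mul_cancel₀ _ (hφpos c (hcd (right_mem_Ioc.2 hc))).ne', add_sub_cancel]

theorem IsSolutionOn.comp_neg {c d : ℝ}
    (h : IsSolutionOn (fun y => w (-y)) (fun y => Q (-y)) (fun y => H (-y)) g p (Ioc c d)) :
    IsSolutionOn w Q H (fun y => g (-y)) (fun y => -p (-y)) (Ico (-d) (-c)) where
  deriv_fst y hy := by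
    have hderiv := h.deriv_fst (-y) ⟨lt_neg_of_lt_neg hy.2, neg_le.1 hy.1⟩
    exact (hderiv.comp y (hasDerivAt_neg y)).congr_deriv (by rw [neg_neg]; ring)
  deriv_snd y hy := by
    have hderiv := h.deriv_snd (-y) ⟨lt_neg_of_lt_neg hy.2, neg_le.1 hy.1⟩
    exact (hderiv.comp y (hasDerivAt_neg y)).neg.congr_deriv (by rw [neg_neg]; ring)

theorem IsSolutionOn.congr {s U : Set ℝ} (h : IsSolutionOn w Q H g p s) (hU : IsOpen U)
    (hsU : s ⊆ U) (hg : EqOn g₁ g U) (hp : EqOn p₁ p U) : IsSolutionOn w Q H g₁ p₁ s where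
  deriv_fst y hy := by
    rw [hp (hsU hy)]
    exact (h.deriv_fst y hy).congr_of_eventuallyEq (hg.eventuallyEq_of_mem (hU.mem_nhds (hsU hy)))
  deriv_snd y hy := by
    rw [hg (hsU hy)]
    exact (h.deriv_snd y hy).congr_of_eventuallyEq (hp.eventuallyEq_of_mem (hU.mem_nhds (hsU hy)))

theorem IsSolutionOn.union {s t : Set ℝ} (hs : IsSolutionOn w Q H g p s)
    (ht : IsSolutionOn w Q H g p t) : IsSolutionOn w Q H g p (s ∪ t) :=
  ⟨fun y hy => hy.elim (hs.deriv_fst y) (ht.deriv_fst y),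
    fun y hy => hy.elim (hs.deriv_snd y) (ht.deriv_snd y)⟩

/-- The function equal to `gneg` on the negative half-line, to `gpos` on the positive one and to `0`
at `0`; it joins the solutions of two half-line problems. -/
def glueAtZero (gneg gpos : ℝ → ℝ) : ℝ → ℝ := (Iio 0).indicator gneg + (Ioi 0).indicator gpos

theorem eqOn_glueAtZero_neg (gneg gpos : ℝ → ℝ) :
    EqOn (glueAtZero gneg gpos) gneg (Iio 0) := fun y hy => by
  simp [glueAtZero, mem_Iio.1 hy, (mem_Iio.1 hy).le]

theorem eqOn_glueAtZero_pos (gneg gpos : ℝ → ℝ) :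
    EqOn (glueAtZero gneg gpos) gpos (Ioi 0) := fun y hy => by
  simp [glueAtZero, mem_Ioi.1 hy, (mem_Ioi.1 hy).le]

theorem exists_solution_singular (hw : Continuous w) (hQ : ContinuousOn Q {0}ᶜ)
    (hH : ContinuousOn H {0}ᶜ) (hw0 : ∀ y, y ≠ 0 → 0 < w y) (hQ0 : ∀ y, y ≠ 0 → 0 ≤ Q y)
    (hH0 : H =ᶠ[𝓝[≠] 0] 0) {a b : ℝ} (ha : a < 0) (hb : 0 < b) (α β : ℝ) :
    ∃ (g p : ℝ → ℝ) (lneg lpos : ℝ), IsSolutionOn w Q H g p (Icc a b \ {0}) ∧ ContinuousAt g 0 ∧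
      g 0 = 0 ∧ Tendsto p (𝓝[<] 0) (𝓝 lneg) ∧ Tendsto p (𝓝[>] 0) (𝓝 lpos) ∧ g a = α ∧ g b = β := by
  have hneg : MapsTo (fun y : ℝ => -y) (Ioi 0) {0}ᶜ := fun y hy => neg_ne_zero.2 (ne_of_gt hy)
  have hpos : Ioi (0 : ℝ) ⊆ {0}ᶜ := fun y hy => ne_of_gt hy
  have hneg0 : Tendsto (fun y : ℝ => -y) (𝓝[<] 0) (𝓝[>] 0) := by
    simpa using tendsto_neg_nhdsLT (a := (0 : ℝ))
  have hneg0' : Tendsto (fun y : ℝ => -y) (𝓝[>] 0) (𝓝[<] 0) := by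
    simpa using tendsto_neg_nhdsGT (a := (0 : ℝ))
  obtain ⟨gpos, ppos, lpos, hsolpos, hgpos, hppos, hbpos⟩ := exists_solution_Ioc hw
    (hQ.mono hpos) (hH.mono hpos) (fun y hy => hw0 y hy.ne') (fun y hy => hQ0 y hy.ne')
    (hH0.filter_mono (nhdsWithin_mono 0 hpos)) hb β
  obtain ⟨gneg, pneg, lneg, hsolneg, hgneg, hpneg, haneg⟩ := exists_solution_Ioc
    (hw.comp continuous_neg) (hQ.comp continuous_neg.continuousOn hneg)
    (hH.comp continuous_neg.continuousOn hneg)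
    (fun y hy => hw0 _ (hneg hy)) (fun y hy => hQ0 _ (hneg hy))
    ((hneg0'.mono_right (nhdsLT_le_nhdsNE 0)).eventually hH0) (neg_pos.2 ha) α
  have hsplit : Icc a b \ {0} = Ico (- -a) (-0) ∪ Ioc 0 b := by
    ext y
    rw [neg_neg, neg_zero]
    grind
  have hIco : Ico (- -a) (-0) ⊆ Iio (0 : ℝ) := fun y hy => neg_zero (G := ℝ) ▸ hy.2
  have hEqneg := eqOn_glueAtZero_neg (fun y => gneg (-y)) gpos
  have hEqpos := eqOn_glueAtZero_pos (fun y => gneg (-y)) gpos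
  have hEqneg' := eqOn_glueAtZero_neg (fun y => -pneg (-y)) ppos
  have hEqpos' := eqOn_glueAtZero_pos (fun y => -pneg (-y)) ppos
  have hzero : glueAtZero (fun y => gneg (-y)) gpos 0 = 0 := by simp [glueAtZero]
  refine ⟨_, _, -lneg, lpos, hsplit ▸ (hsolneg.comp_neg.congr isOpen_Iio hIco hEqneg hEqneg').union
    (hsolpos.congr isOpen_Ioi Ioc_subset_Ioi_self hEqpos hEqpos'), ?_, hzero, ?_, ?_, ?_, ?_⟩
  · rw [continuousAt_iff_punctured_nhds, hzero, ← nhdsLT_sup_nhdsGT]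
    exact ((hgneg.comp hneg0).congr' hEqneg.symm.eventuallyEq_nhdsWithin).sup
      (hgpos.congr' hEqpos.symm.eventuallyEq_nhdsWithin)
  · exact (hpneg.comp hneg0).neg.congr' hEqneg'.symm.eventuallyEq_nhdsWithin
  · exact hppos.congr' hEqpos'.symm.eventuallyEq_nhdsWithin
  · exact (hEqneg ha).trans haneg
  · exact (hEqpos hb).trans hbpos

end SingularBoundaryValueProblem

section Resolvent

variable {a b : ℝ} {lam : ℝ → ℝ}

/-- The coefficient of `g` in `p' = 2 (μ g + (k² / λ̃²) g - F) λ̃`, which with `g' = p λ̃` is the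
equation `μ g - A g = F` for the profile of a mode of frequency `k`. -/
def resolventCoeff (lam : ℝ → ℝ) (μ : ℝ) (k : ℤ) (y : ℝ) : ℝ :=
  2 * (μ + (k : ℝ) ^ 2 / lamTilde lam y ^ 2) * lamTilde lam y

theorem resolventCoeff_zero (μ : ℝ) :
    resolventCoeff lam μ 0 = fun y => 2 * μ * lamTilde lam y := by
  funext y
  simp [resolventCoeff]

theorem IsSolutionOn.isProfile (h : IsFriction lam) (ha : a < 0) (hb : 0 < b) {k : ℤ} {μ : ℝ}
    {F g p : ℝ → ℝ} (hF : Continuous F)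
    (hsol : IsSolutionOn (lamTilde lam) (resolventCoeff lam μ k) (fun y => 2 * F y * lamTilde lam y)
      g p (Icc a b \ {0})) (hg : ContinuousAt g 0) (hga : μ * g a = F a) (hgb : μ * g b = F b)
    (hp : ∃ pm pp, Tendsto p (𝓝[<] 0) (𝓝 pm) ∧ Tendsto p (𝓝[>] 0) (𝓝 pp) ∧ (k = 0 → pm = pp))
    (hg0 : k ≠ 0 → μ * g 0 = F 0) :
    IsProfile a b lam k g p (fun y => 2 * ((μ + (k : ℝ) ^ 2 / lamTilde lam y ^ 2) * g y - F y))
      fun y => μ * g y - F y := by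
  have hInner {y : ℝ} (hy : y ∈ Inner a b) : y ∈ Icc a b \ {0} := ⟨inner_subset hy, hy.2⟩
  have hlim {y : ℝ} (hy : ContinuousAt g y) :
      Tendsto (fun y => μ * g y - F y) (𝓝 y) (𝓝 (μ * g y - F y)) :=
    (hy.const_mul μ).sub hF.continuousAt
  have hgaCont := (hsol.deriv_fst a ⟨⟨le_rfl, (ha.trans hb).le⟩, ha.ne⟩).continuousAt
  have hgbCont := (hsol.deriv_fst b ⟨⟨(ha.trans hb).le, le_rfl⟩, hb.ne'⟩).continuousAt
  exact
    { deriv_g := fun y hy => hsol.deriv_fst y (hInner hy)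
      deriv_p := fun y hy => (hsol.deriv_snd y (hInner hy)).congr_deriv
        (by rw [resolventCoeff]; ring)
      cont_r := continuousOn_const.mul (((continuousOn_const.add
        ((h.continuousOn_sq_div_sq k).mono fun _ hy => hy.2)).mul
          (hsol.continuousOn_fst.mono fun _ => hInner)).sub hF.continuousOn)
      eq_s := fun y _ => by ring
      lim_p := hp
      lim_s := ⟨_, (hlim hg).mono_left nhdsWithin_le_nhds, fun hk => sub_eq_zero.2 (hg0 hk)⟩
      lim_left := sub_eq_zero.2 hga ▸ (hlim hgaCont).mono_left nhdsWithin_le_nhds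
      lim_right := sub_eq_zero.2 hgb ▸ (hlim hgbCont).mono_left nhdsWithin_le_nhds }

theorem IsFriction.isFundamentalSystem_sinh (h : IsFriction lam) (κ c d : ℝ) :
    IsFundamentalSystem (lamTilde lam) (fun y => κ ^ 2 * lamTilde lam y)
      (fun y => Real.sinh (κ * (uTilde lam y - c)))
      (fun y => κ * Real.cosh (κ * (uTilde lam y - c)))
      (fun y => Real.sinh (κ * (d - uTilde lam y)))
      (fun y => -(κ * Real.cosh (κ * (d - uTilde lam y)))) univ (κ * Real.sinh (κ * (d - c))) := by
  have hsub (y : ℝ) := ((h.hasDerivAt_uTilde y).sub_const c).const_mul κ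
  have hsub' (y : ℝ) := ((h.hasDerivAt_uTilde y).const_sub d).const_mul κ
  refine ⟨⟨fun y _ => ?_, fun y _ => ?_⟩, ⟨fun y _ => ?_, fun y _ => ?_⟩, fun y _ => ?_⟩
  · exact (hsub y).sinh.congr_deriv (by ring)
  · exact ((hsub y).cosh.const_mul κ).congr_deriv (by rw [Pi.zero_apply]; ring)
  · exact (hsub' y).sinh.congr_deriv (by ring)
  · exact ((hsub' y).cosh.const_mul κ).neg.congr_deriv (by rw [Pi.zero_apply]; ring)
  · rw [show κ * (d - c) = κ * (uTilde lam y - c) + κ * (d - uTilde lam y) by ring, Real.sinh_add]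
    ring

theorem exists_solution_rotationInvariant (h : IsFriction lam) (hab : a < b) {H : ℝ → ℝ}
    (hH : Continuous H) {μ : ℝ} (hμ : 0 < μ) (α β : ℝ) : ∃ g p : ℝ → ℝ,
    IsSolutionOn (lamTilde lam) (resolventCoeff lam μ 0) H g p univ ∧ g a = α ∧ g b = β := by
  obtain ⟨κ, hκ, hκμ⟩ : ∃ κ : ℝ, 0 < κ ∧ κ ^ 2 = 2 * μ :=
    ⟨√(2 * μ), Real.sqrt_pos.2 (by positivity), Real.sq_sqrt (by positivity)⟩
  have hsystem := h.isFundamentalSystem_sinh κ (uTilde lam a) (uTilde lam b)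
  have hsinh : 0 < Real.sinh (κ * (uTilde lam b - uTilde lam a)) :=
    Real.sinh_pos_iff.2 (mul_pos hκ (sub_pos.2 (h.strictMono_uTilde hab)))
  obtain ⟨g, p, hgp, -⟩ := hsystem.exists_particular (mul_pos hκ hsinh).ne' isOpen_univ
    ordConnected_univ hH.continuousOn (mem_univ 0)
  set S := Real.sinh (κ * (uTilde lam b - uTilde lam a))
  rw [resolventCoeff_zero, ← hκμ]
  refine ⟨_, _, (hgp.add_const_mul hsystem.fst ((β - g b) / S)).add_const_mul hsystem.snd
    ((α - g a) / S), ?_, ?_⟩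
  · rw [sub_self, mul_zero, Real.sinh_zero, mul_zero, add_zero, div_mul_cancel₀ _ hsinh.ne',
      add_sub_cancel]
  · rw [sub_self, mul_zero, Real.sinh_zero, mul_zero, add_zero, div_mul_cancel₀ _ hsinh.ne',
      add_sub_cancel]

theorem exists_isProfile_zero (h : IsFriction lam) (ha : a < 0) (hb : 0 < b) {F : ℝ → ℝ}
    (hF : Continuous F) {μ : ℝ} (hμ : 0 < μ) : ∃ g p r : ℝ → ℝ, ContinuousOn g (Icc a b) ∧
      IsProfile a b lam 0 g p r fun y => μ * g y - F y := by
  obtain ⟨g, p, hsol, hga, hgb⟩ := exists_solution_rotationInvariant h (ha.trans hb)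
    ((hF.const_mul 2).mul h.continuous_lamTilde) hμ (F a / μ) (F b / μ)
  have hp : Tendsto p (𝓝 0) (𝓝 (p 0)) := (hsol.deriv_snd 0 (mem_univ 0)).continuousAt
  exact ⟨g, p, _, hsol.continuousOn_fst.mono (subset_univ _),
    (hsol.mono (subset_univ _)).isProfile h ha hb hF (hsol.deriv_fst 0 (mem_univ 0)).continuousAt
      (by rw [hga, mul_div_cancel₀ _ hμ.ne']) (by rw [hgb, mul_div_cancel₀ _ hμ.ne'])
      ⟨p 0, p 0, hp.mono_left nhdsWithin_le_nhds, hp.mono_left nhdsWithin_le_nhds, fun _ => rfl⟩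
      fun hk => absurd rfl hk⟩

theorem exists_isProfile_of_ne_zero (h : IsFriction lam) (ha : a < 0) (hb : 0 < b) {k : ℤ}
    (hk : k ≠ 0) {F : ℝ → ℝ} (hF : Continuous F) (hF0 : F =ᶠ[𝓝 0] 0) {μ : ℝ} (hμ : 0 < μ) :
    ∃ g p r : ℝ → ℝ, ContinuousOn g (Icc a b) ∧ g 0 = 0 ∧
      IsProfile a b lam k g p r fun y => μ * g y - F y := by
  have hw := h.continuous_lamTilde
  have hQ : ContinuousOn (resolventCoeff lam μ k) {0}ᶜ :=
    (continuousOn_const.mul (continuousOn_const.add (h.continuousOn_sq_div_sq k))).mul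
      hw.continuousOn
  have hQ0 (y : ℝ) (hy : y ≠ 0) : 0 ≤ resolventCoeff lam μ k y :=
    mul_nonneg (by positivity) (h.lamTilde_pos hy).le
  obtain ⟨g, p, lm, lp, hsol, hg, hg0, hlm, hlp, hga, hgb⟩ := exists_solution_singular hw hQ
    ((hF.const_mul 2).mul hw).continuousOn (fun y hy => h.lamTilde_pos hy) hQ0
    (by filter_upwards [hF0.filter_mono nhdsWithin_le_nhds] with y hy using by simp [hy])
    ha hb (F a / μ) (F b / μ)
  refine ⟨g, p, _, fun y hy => ?_, hg0, hsol.isProfile h ha hb hF hg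
    (by rw [hga, mul_div_cancel₀ _ hμ.ne']) (by rw [hgb, mul_div_cancel₀ _ hμ.ne'])
    ⟨lm, lp, hlm, hlp, fun h0 => absurd h0 hk⟩
    fun _ => by rw [hg0, mul_zero, hF0.self_of_nhds, Pi.zero_apply]⟩
  rcases eq_or_ne y 0 with rfl | hy0
  · exact hg.continuousWithinAt
  · exact (hsol.deriv_fst y ⟨hy, hy0⟩).continuousAt.continuousWithinAt

theorem smoothModes_subset_range (h : IsFriction lam) (ha : a < 0) (hb : 0 < b) {μ : ℝ}
    (hμ : 0 < μ) : smoothModes a b lam ⊆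
      range fun f : (opA lam ha hb).domain => μ • (f : C(Glued a b, ℝ)) - opA lam ha hb f := by
  rintro f ⟨H, k, φ, hH, h0, hf⟩
  have hc : Continuous fun y => H (uTilde lam y) := hH.continuous.comp h.continuous_uTilde
  rcases eq_or_ne k 0 with rfl | hk
  · obtain ⟨g, p, r, hg, hprofile⟩ := exists_isProfile_zero h ha hb hc hμ
    exact hf.mem_range h ha hb hg (Or.inl rfl) hprofile
  · obtain ⟨g, p, r, hg, hg0, hprofile⟩ := exists_isProfile_of_ne_zero h ha hb hk hc
      (h.tendsto_uTilde_zero.eventually (h0.resolve_left hk)) hμ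
    exact hf.mem_range h ha hb hg (Or.inr hg0) hprofile

end Resolvent

end VanishingFriction

end

theorem lemma3p1_general (a b : ℝ) (ha : a < 0) (hb : 0 < b) (lam : ℝ → ℝ)
    (hcont : Continuous lam)
    (hzero : ∀ y ∈ Set.Icc (-1 : ℝ) 1, lam y = 0)
    (hpos : ∀ y, y ∉ Set.Icc (-1 : ℝ) 1 → 0 < lam y) :
    (VanishingFriction.opA lam ha hb).IsClosable ∧
      ∃ T : NNReal → C(VanishingFriction.Glued a b, ℝ) →L[ℝ]
          C(VanishingFriction.Glued a b, ℝ),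
        VanishingFriction.IsMarkovSemigroup T ∧
          VanishingFriction.IsInfinitesimalOperator T
            (VanishingFriction.opA lam ha hb).closure := by
  have h : VanishingFriction.IsFriction lam := ⟨hcont, hzero, hpos⟩
  exact VanishingFriction.exists_markovSemigroup_of_minimum_principle _
    (VanishingFriction.opA_nonneg_of_min h ha hb) (VanishingFriction.one_mem_graph h ha hb)
    (VanishingFriction.dense_dom h ha hb) fun μ hμ =>
      VanishingFriction.dense_range_sub h ha hb μ
        (VanishingFriction.smoothModes_subset_range h ha hb hμ)

theorem lemma3p1 (a b : ℝ) (ha : a < 0) (hb : 0 < b) (lam : ℝ → ℝ)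
    (hsmooth : ContDiff ℝ 1 lam)
    (hzero : ∀ y ∈ Set.Icc (-1 : ℝ) 1, lam y = 0)
    (hpos : ∀ y, y ∉ Set.Icc (-1 : ℝ) 1 → 0 < lam y)
    (hdivm : ∀ ε : ℝ, 0 < ε →
      ∫⁻ y in Set.Ioo (-ε - 1) (-1), ENNReal.ofReal (1 / lam y) = ⊤)
    (hdivp : ∀ ε : ℝ, 0 < ε →
      ∫⁻ y in Set.Ioo 1 (1 + ε), ENNReal.ofReal (1 / lam y) = ⊤) :
    (VanishingFriction.opA lam ha hb).IsClosable ∧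
      ∃ T : NNReal → C(VanishingFriction.Glued a b, ℝ) →L[ℝ]
          C(VanishingFriction.Glued a b, ℝ),
        VanishingFriction.IsMarkovSemigroup T ∧
          VanishingFriction.IsInfinitesimalOperator T (VanishingFriction.opA lam ha hb).closure :=
  lemma3p1_general a b ha hb lam hsmooth.continuous hzero hpos
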